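/- Let $p\ge 1$ be an integer and $m,\omega,\hbar>0$. Let $\mathfrak{osp}(3|2)$ be the Lie superalgebra of complex matrices $$\begin{pmatrix} a&0&b&x&u\\ 0&-a&c&y&v\\ -c&-b&0&z&w\\ v&u&w&d&e\\ -y&-x&-z&f&-d\end{pmatrix}$$ (even part $x=y=z=u=v=w=0$, odd part $a=b=c=d=e=f=0$) with bracket $[\![A,B]\!]=AB-(-1)^{\deg A\deg B}BA$, and put $c_1^+=\sqrt2(e_{13}-e_{32})$, $c_1^-=\sqrt2(e_{31}-e_{23})$ (even), $c_2^+=\sqrt2(e_{35}+e_{43})$, $c_2^-=\sqrt2(e_{34}-e_{53})$ (odd), $h_1=e_{11}-e_{22}$, $h_2=e_{44}-e_{55}$. The parastatistics Fock space $V(p)$ is the $\mathfrak{osp}(3|2)$-module with a positive definite inner product generated by a vector $|0\rangle$ such that $\langle0|0\rangle=1$, $(c_j^\pm)^\dagger=c_j^\mp$, $c_j^-|0\rangle=0$, $[\![c_j^-,c_k^+]\!]|0\rangle=p\,\delta_{jk}|0\rangle$ (the unitary lowest-weight module of lowest weight $(-\frac p2|\frac p2)$); $W$ denotes its Hilbert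 space completion. Define on $V(p)$ $$a_1^\pm=\tfrac1{2\sqrt3}[c_1^--c_1^+,c_2^\pm],\quad a_2^\pm=\tfrac{i}{2\sqrt3}[c_1^-+c_1^+,c_2^\pm],\quad a_3^\pm=\tfrac1{\sqrt3}c_2^\pm,$$ the operators $r_k,p_k$ by $a_k^\pm=\sqrt{\tfrac{m\omega}{2\hbar}}\,r_k\mp\tfrac{i}{\sqrt{2m\omega\hbar}}\,p_k$, and the Hamiltonian $H=\frac1{2m}\sum_{k=1}^3p_k^2+\frac{m\omega^2}2\sum_{k=1}^3r_k^2$. Then $V(p)$ exists, and in every realization of it the following hold. (a) $V(p)$ has an orthonormal (algebraic) basis of vectors $|\mu)=\left|\begin{smallmatrix}\mu_{12},\ \mu_{22}\\ \mu_{11}\end{smallmatrix}\right)$, indexed by the integers with $0\le\mu_{12}\le p$, $\mu_{22}\ge0$, $\mu_{12}\ge1$ if $\mu_{22}\ge1$, $\theta:=\mu_{12}-\mu_{11}\in\{0,1\}$, and $\theta=0$ if $\mu_{12}=0$, such that the vector with all labels zero is $|0\rangle$, $h_1|\mu)=(-\frac p2+\mu_{11})|\mu)$, $h_2|\mu)=(\frac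 p2+\mu_{12}+\mu_{22}-\mu_{11})|\mu)$, and, with $s=\mu_{12}+\mu_{22}$, writing vectors as $|\mu_{12},\mu_{22};\mu_{11})$ and reading them as $0$ for inadmissible labels (the term is then dropped), $$c_1^+|\mu)=\Big(\tfrac{s}{s+1}\Big)^{\theta/2}G_1(\mu_{12},\mu_{22})|\mu_{12}{+}1,\mu_{22};\mu_{11}{+}1)-\theta\Big(\tfrac1{s+1}\Big)^{1/2}G_2(\mu_{12},\mu_{22})|\mu_{12},\mu_{22}{+}1;\mu_{11}{+}1),$$ $$c_2^+|\mu)=(1-\theta)\Big(\tfrac1{s+1}\Big)^{1/2}G_1(\mu_{12},\mu_{22})|\mu_{12}{+}1,\mu_{22};\mu_{11})+(-1)^\theta\Big(\tfrac{s}{\mu_{11}+\mu_{22}+1}\Big)^{1/2}G_2(\mu_{12},\mu_{22})|\mu_{12},\mu_{22}{+}1;\mu_{11}),$$ $$c_1^-|\mu)=\Big(\tfrac{s-1}{s}\Big)^{\theta/2}G_1(\mu_{12}{-}1,\mu_{22})|\mu_{12}{-}1,\mu_{22};\mu_{11}{-}1)-(1-\theta)\Big(\tfrac1s\Big)^{1/2}G_2(\mu_{12},\mu_{22}{-}1)|\mu_{12},\mu_{22}{-}1;\mu_{11}{-}1),$$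 $$c_2^-|\mu)=\theta\Big(\tfrac1s\Big)^{1/2}G_1(\mu_{12}{-}1,\mu_{22})|\mu_{12}{-}1,\mu_{22};\mu_{11})+(-1)^\theta\Big(\tfrac{s-1}{\mu_{11}+\mu_{22}}\Big)^{1/2}G_2(\mu_{12},\mu_{22}{-}1)|\mu_{12},\mu_{22}{-}1;\mu_{11}),$$ where, with $\mathcal E_j=1$ for even $j$ and $0$ otherwise, $\mathcal O_j=1-\mathcal E_j$, $$G_1(k,l)=\sqrt{\frac{k(k+l+1)(p-k)}{k+l+1-\mathcal O_{l+1}}}\ \ (G_1(0,0):=\sqrt p),\qquad G_2(k,l)=\sqrt{\frac{(\mathcal O_l\,l+1)(\mathcal E_{l+1}(p+l)+1)(\mathcal O_{l+1}(k+l)+1)}{\mathcal E_{l+1}(k+l-1)+1}}.$$ (b) For every such basis and every $\mu$, $$H|\mu)=\frac{\hbar\omega}2\{c_2^+,c_2^-\}|\mu)=\frac{\hbar\omega}2\,(p+2\mu_{22}+2\theta)\,|\mu).$$ (c) The set of eigenvalues of $H$ on $V(p)$, and also the spectrum of the closure of $H$ in $W$, is exactly $\{E_n=\hbar\omega(n+\frac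 p2):n=0,1,2,\dots\}$. (d) For $p=1$ the set of eigenvalues of $H$ equals that of the canonical one-dimensional oscillator $\frac1{2m}\hat p^2+\frac{m\omega^2}2x^2$, $\hat p=-i\hbar\frac{d}{dx}$, acting on the Schwartz space $\mathcal S(\mathbb R)$ (as sets, without multiplicities). -/

import Mathlib

open scoped InnerProductSpace

universe u

noncomputable section

/-! ### The Lie superalgebra `osp(3|2)` -/

/-- The general matrix of the defining five-dimensional representation of `osp(3|2)`. -/
def ospMatrix (a b c d e f x y z u v w : ℂ) : Matrix (Fin 5) (Fin 5) ℂ :=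
  !![ a,  0,  b, x,  u;
      0, -a,  c, y,  v;
     -c, -b,  0, z,  w;
      v,  u,  w, d,  e;
     -y, -x, -z, f, -d]

/-- `osp(3|2)`, as a space of `5 × 5` complex matrices. -/
def osp32 : Submodule ℂ (Matrix (Fin 5) (Fin 5) ℂ) where
  carrier := {A | ∃ a b c d e f x y z u v w : ℂ, A = ospMatrix a b c d e f x y z u v w}
  zero_mem' := ⟨0, 0, 0, 0, 0, 0, 0, 0, 0, 0, 0, 0, by
    ext i j; fin_cases i <;> fin_cases j <;> simp [ospMatrix]⟩
  add_mem' := by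
    rintro _ _ ⟨a, b, c, d, e, f, x, y, z, u, v, w, rfl⟩
      ⟨a', b', c', d', e', f', x', y', z', u', v', w', rfl⟩
    refine ⟨a + a', b + b', c + c', d + d', e + e', f + f', x + x', y + y', z + z', u + u',
      v + v', w + w', ?_⟩
    ext i j; fin_cases i <;> fin_cases j <;> simp [ospMatrix] <;> ring
  smul_mem' := by
    rintro r _ ⟨a, b, c, d, e, f, x, y, z, u, v, w, rfl⟩
    refine ⟨r * a, r * b, r * c, r * d, r * e, r * f, r * x, r * y, r * z, r * u,
      r * v, r * w, ?_⟩
    ext i j; fin_cases i <;> fin_cases j <;> simp [ospMatrix]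

/-- The even subalgebra `so(3) ⊕ sp(2)`. -/
def ospEven : Submodule ℂ (Matrix (Fin 5) (Fin 5) ℂ) where
  carrier := {A | ∃ a b c d e f : ℂ, A = ospMatrix a b c d e f 0 0 0 0 0 0}
  zero_mem' := ⟨0, 0, 0, 0, 0, 0, by
    ext i j; fin_cases i <;> fin_cases j <;> simp [ospMatrix]⟩
  add_mem' := by
    rintro _ _ ⟨a, b, c, d, e, f, rfl⟩ ⟨a', b', c', d', e', f', rfl⟩
    refine ⟨a + a', b + b', c + c', d + d', e + e', f + f', ?_⟩
    ext i j; fin_cases i <;> fin_cases j <;> simp [ospMatrix] <;> ring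
  smul_mem' := by
    rintro r _ ⟨a, b, c, d, e, f, rfl⟩
    refine ⟨r * a, r * b, r * c, r * d, r * e, r * f, ?_⟩
    ext i j; fin_cases i <;> fin_cases j <;> simp [ospMatrix]

/-- The odd subspace. -/
def ospOdd : Submodule ℂ (Matrix (Fin 5) (Fin 5) ℂ) where
  carrier := {A | ∃ x y z u v w : ℂ, A = ospMatrix 0 0 0 0 0 0 x y z u v w}
  zero_mem' := ⟨0, 0, 0, 0, 0, 0, by
    ext i j; fin_cases i <;> fin_cases j <;> simp [ospMatrix]⟩
  add_mem' := by
    rintro _ _ ⟨a, b, c, d, e, f, rfl⟩ ⟨a', b', c', d', e', f', rfl⟩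
    refine ⟨a + a', b + b', c + c', d + d', e + e', f + f', ?_⟩
    ext i j; fin_cases i <;> fin_cases j <;> simp [ospMatrix] <;> ring
  smul_mem' := by
    rintro r _ ⟨a, b, c, d, e, f, rfl⟩
    refine ⟨r * a, r * b, r * c, r * d, r * e, r * f, ?_⟩
    ext i j; fin_cases i <;> fin_cases j <;> simp [ospMatrix]

/-- The homogeneous component of degree `i`. -/
def ospPart (i : ZMod 2) : Submodule ℂ (Matrix (Fin 5) (Fin 5) ℂ) :=
  if i = 0 then ospEven else ospOdd

/-- The bracket `⟦a, b⟧ = a b - (-1)^{deg a deg b} b a` of elements of degrees `i`, `j`. -/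
def superComm {R : Type*} [Ring R] (i j : ZMod 2) (a b : R) : R :=
  a * b - (-1) ^ (i.val * j.val) * (b * a)

theorem ospPart_le (i : ZMod 2) : ospPart i ≤ osp32 := by
  unfold ospPart
  split_ifs
  · rintro _ ⟨a, b, c, d, e, f, rfl⟩
    exact ⟨a, b, c, d, e, f, 0, 0, 0, 0, 0, 0, rfl⟩
  · rintro _ ⟨x, y, z, u, v, w, rfl⟩
    exact ⟨0, 0, 0, 0, 0, 0, x, y, z, u, v, w, rfl⟩

theorem osp_closed_1 {A B : Matrix (Fin 5) (Fin 5) ℂ} (hA : A ∈ ospEven) (hB : B ∈ ospEven) :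
    A * B - B * A ∈ ospEven := by
  obtain ⟨a, b, c, d, e, f, rfl⟩ := hA
  obtain ⟨a', b', c', d', e', f', rfl⟩ := hB
  refine ⟨b' * c - b * c', a * b' - a' * b, a' * c - a * c', e * f' - e' * f,
    2 * (d * e' - d' * e), 2 * (f * d' - f' * d), ?_⟩
  simp only [ospMatrix, ← Matrix.ext_iff, Fin.forall_fin_succ]
  simp [Matrix.vecHead, Matrix.vecTail]
  split_ands <;> ring

theorem osp_closed_2 {A B : Matrix (Fin 5) (Fin 5) ℂ} (hA : A ∈ ospEven) (hB : B ∈ ospOdd) :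
    A * B - B * A ∈ ospOdd := by
  obtain ⟨a, b, c, d, e, f, rfl⟩ := hA
  obtain ⟨x, y, z, u, v, w, rfl⟩ := hB
  refine ⟨a * x + b * z - x * d - u * f, -a * y + c * z - y * d - v * f,
    -c * x - b * y - z * d - w * f, a * u + b * w - x * e + u * d,
    -a * v + c * w - y * e + v * d, -c * u - b * v - z * e + w * d, ?_⟩
  simp only [ospMatrix, ← Matrix.ext_iff, Fin.forall_fin_succ]
  simp [Matrix.vecHead, Matrix.vecTail]
  split_ands <;> ring

theorem osp_closed_3 {A B : Matrix (Fin 5) (Fin 5) ℂ} (hA : A ∈ ospOdd) (hB : B ∈ ospOdd) :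
    A * B + B * A ∈ ospEven := by
  obtain ⟨x, y, z, u, v, w, rfl⟩ := hA
  obtain ⟨x', y', z', u', v', w', rfl⟩ := hB
  refine ⟨x * v' - u * y' + x' * v - u' * y, x * w' - u * z' + x' * w - u' * z,
    y * w' - v * z' + y' * w - v' * z,
    v * x' + u * y' + w * z' + v' * x + u' * y + w' * z,
    2 * (v * u' + u * v' + w * w'), -2 * (y * x' + x * y' + z * z'), ?_⟩
  simp only [ospMatrix, ← Matrix.ext_iff, Fin.forall_fin_succ]
  simp [Matrix.vecHead, Matrix.vecTail]
  split_ands <;> ring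

/-- `osp(3|2)` is closed under the superbracket, which respects the degrees. -/
theorem superComm_mem {i j : ZMod 2} {A B : Matrix (Fin 5) (Fin 5) ℂ}
    (hA : A ∈ ospPart i) (hB : B ∈ ospPart j) : superComm i j A B ∈ ospPart (i + j) := by
  have h2 : ((1 : ZMod 2) + 1) = 0 := by decide
  have hv : (1 : ZMod 2).val = 1 := by decide
  have h01 : ∀ i : ZMod 2, i = 0 ∨ i = 1 := by decide
  rcases h01 i with rfl | rfl <;> rcases h01 j with rfl | rfl
  · simpa [ospPart, superComm] using osp_closed_1 (by simpa [ospPart] using hA) (by simpa [ospPart] using hB)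
  · simpa [ospPart, superComm] using osp_closed_2 (by simpa [ospPart] using hA) (by simpa [ospPart] using hB)
  · have := ospOdd.neg_mem (osp_closed_2 (A := B) (B := A) (by simpa [ospPart] using hB)
      (by simpa [ospPart] using hA))
    simpa [ospPart, superComm] using this
  · simpa [ospPart, superComm, h2, hv] using
      osp_closed_3 (by simpa [ospPart] using hA) (by simpa [ospPart] using hB)

/-- The parafermion (index `0`) and paraboson (index `1`) creation generators. -/
def cPlusMatrix : Fin 2 → Matrix (Fin 5) (Fin 5) ℂ :=
  ![((√2 : ℝ) : ℂ) • (Matrix.single 0 2 1 - Matrix.single 2 1 1),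
    ((√2 : ℝ) : ℂ) • (Matrix.single 2 4 1 + Matrix.single 3 2 1)]

/-- The parafermion (index `0`) and paraboson (index `1`) annihilation generators. -/
def cMinusMatrix : Fin 2 → Matrix (Fin 5) (Fin 5) ℂ :=
  ![((√2 : ℝ) : ℂ) • (Matrix.single 2 0 1 - Matrix.single 1 2 1),
    ((√2 : ℝ) : ℂ) • (Matrix.single 2 3 1 - Matrix.single 4 2 1)]

/-- The degree of `c_j^±`: the parafermion is even, the paraboson is odd. -/
def cDeg : Fin 2 → ZMod 2 := ![0, 1]

/-- The basis `h₁ = e₁₁ - e₂₂`, `h₂ = e₄₄ - e₅₅` of the Cartan subalgebra. -/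
def hMatrix : Fin 2 → Matrix (Fin 5) (Fin 5) ℂ :=
  ![Matrix.single 0 0 1 - Matrix.single 1 1 1, Matrix.single 3 3 1 - Matrix.single 4 4 1]

theorem cPlusMatrix_mem (j : Fin 2) : cPlusMatrix j ∈ osp32 := by
  fin_cases j
  · refine ⟨0, (√2 : ℝ), 0, 0, 0, 0, 0, 0, 0, 0, 0, 0, ?_⟩
    ext i j; fin_cases i <;> fin_cases j <;> simp [cPlusMatrix, ospMatrix]
  · refine ⟨0, 0, 0, 0, 0, 0, 0, 0, 0, 0, 0, (√2 : ℝ), ?_⟩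
    ext i j; fin_cases i <;> fin_cases j <;> simp [cPlusMatrix, ospMatrix]

theorem cMinusMatrix_mem (j : Fin 2) : cMinusMatrix j ∈ osp32 := by
  fin_cases j
  · refine ⟨0, 0, -(√2 : ℝ), 0, 0, 0, 0, 0, 0, 0, 0, 0, ?_⟩
    ext i j; fin_cases i <;> fin_cases j <;> simp [cMinusMatrix, ospMatrix]
  · refine ⟨0, 0, 0, 0, 0, 0, 0, 0, (√2 : ℝ), 0, 0, 0, ?_⟩
    ext i j; fin_cases i <;> fin_cases j <;> simp [cMinusMatrix, ospMatrix]

theorem hMatrix_mem (j : Fin 2) : hMatrix j ∈ osp32 := by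
  fin_cases j
  · refine ⟨1, 0, 0, 0, 0, 0, 0, 0, 0, 0, 0, 0, ?_⟩
    ext i j; fin_cases i <;> fin_cases j <;> simp [hMatrix, ospMatrix]
  · refine ⟨0, 0, 0, 1, 0, 0, 0, 0, 0, 0, 0, 0, ?_⟩
    ext i j; fin_cases i <;> fin_cases j <;> simp [hMatrix, ospMatrix]

/-! ### Representations and the parastatistics Fock space `V(p)` -/

/-- `ρ` is a representation of the Lie superalgebra `osp(3|2)` on some `ℤ/2`-grading of `V`. -/
structure IsOspRep {V : Type*} [AddCommGroup V] [Module ℂ V]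
    (ρ : osp32 →ₗ[ℂ] Module.End ℂ V) : Prop where
  grading : ∃ 𝒱 : ZMod 2 → Submodule ℂ V, IsCompl (𝒱 0) (𝒱 1) ∧
    ∀ (i j : ZMod 2) (A : osp32), (A : Matrix (Fin 5) (Fin 5) ℂ) ∈ ospPart i →
      ∀ v ∈ 𝒱 j, ρ A v ∈ 𝒱 (i + j)
  bracket : ∀ (i j : ZMod 2) (A B : Matrix (Fin 5) (Fin 5) ℂ)
    (hA : A ∈ ospPart i) (hB : B ∈ ospPart j),
    ρ ⟨superComm i j A B, ospPart_le _ (superComm_mem hA hB)⟩ =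
      superComm i j (ρ ⟨A, ospPart_le _ hA⟩) (ρ ⟨B, ospPart_le _ hB⟩)

section Operators

variable {V : Type*} [AddCommGroup V] [Module ℂ V] (ρ : osp32 →ₗ[ℂ] Module.End ℂ V)

/-- The operator `c_j^+`. -/
def cPlus (j : Fin 2) : Module.End ℂ V := ρ ⟨cPlusMatrix j, cPlusMatrix_mem j⟩

/-- The operator `c_j^-`. -/
def cMinus (j : Fin 2) : Module.End ℂ V := ρ ⟨cMinusMatrix j, cMinusMatrix_mem j⟩

/-- The operator `h_j`. -/
def hOp (j : Fin 2) : Module.End ℂ V := ρ ⟨hMatrix j, hMatrix_mem j⟩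

/-- The oscillator operators `a_k^+`, `k = 1, 2, 3`. -/
def aPlus : Fin 3 → Module.End ℂ V :=
  ![(1 / (2 * (√3 : ℝ)) : ℂ) • ⁅cMinus ρ 0 - cPlus ρ 0, cPlus ρ 1⁆,
    (Complex.I / (2 * (√3 : ℝ)) : ℂ) • ⁅cMinus ρ 0 + cPlus ρ 0, cPlus ρ 1⁆,
    (1 / (√3 : ℝ) : ℂ) • cPlus ρ 1]

/-- The oscillator operators `a_k^-`, `k = 1, 2, 3`. -/
def aMinus : Fin 3 → Module.End ℂ V :=
  ![(1 / (2 * (√3 : ℝ)) : ℂ) • ⁅cMinus ρ 0 - cPlus ρ 0, cMinus ρ 1⁆,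
    (Complex.I / (2 * (√3 : ℝ)) : ℂ) • ⁅cMinus ρ 0 + cPlus ρ 0, cMinus ρ 1⁆,
    (1 / (√3 : ℝ) : ℂ) • cMinus ρ 1]

/-- The position operators `r_k`, obtained by solving
`a_k^± = √(mω / 2ħ) r_k ∓ (i / √(2mωħ)) p_k`. -/
def positionOp (m ω ħ : ℝ) (k : Fin 3) : Module.End ℂ V :=
  (√(ħ / (2 * m * ω)) : ℂ) • (aPlus ρ k + aMinus ρ k)

/-- The momentum operators `p_k`, obtained by solving the same equations. -/
def momentumOp (m ω ħ : ℝ) (k : Fin 3) : Module.End ℂ V :=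
  (Complex.I * √(m * ω * ħ / 2) : ℂ) • (aPlus ρ k - aMinus ρ k)

/-- The Hamiltonian `H = 𝐩² / 2m + (m ω² / 2) 𝐫²` of the three-dimensional oscillator. -/
def hamiltonian (m ω ħ : ℝ) : Module.End ℂ V :=
  (1 / (2 * m) : ℂ) • ∑ k, momentumOp ρ m ω ħ k ^ 2 +
    (m * ω ^ 2 / 2 : ℂ) • ∑ k, positionOp ρ m ω ħ k ^ 2

end Operators

/-- `(V, ρ)`, with vacuum `vac`, is the parastatistics Fock space `V(p)`: the `osp(3|2)`-module
generated by a unit vector `vac` with `c_j^- vac = 0` and `⟦c_j^-, c_k^+⟧ vac = p δ_{jk} vac`, with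
an inner product (positive definite) for which `c_j^+` and `c_j^-` are adjoint to each other. -/
structure IsParaFock {V : Type*} [NormedAddCommGroup V] [InnerProductSpace ℂ V] (p : ℕ)
    (ρ : osp32 →ₗ[ℂ] Module.End ℂ V) (vac : V) : Prop where
  rep : IsOspRep ρ
  adjoint : ∀ (j : Fin 2) (v w : V), ⟪cPlus ρ j v, w⟫_ℂ = ⟪v, cMinus ρ j w⟫_ℂ
  vac_norm : ⟪vac, vac⟫_ℂ = 1
  annihilate : ∀ j, cMinus ρ j vac = 0
  vac_bracket : ∀ j k, superComm (cDeg j) (cDeg k) (cMinus ρ j) (cPlus ρ k) vac =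
    if j = k then (p : ℂ) • vac else 0
  generated : ∀ U : Submodule ℂ V, vac ∈ U → (∀ (A : osp32), ∀ v ∈ U, ρ A v ∈ U) → U = ⊤

/-! ### The basis `|μ)` -/

/-- The conditions on the labels `(μ₁₂, μ₂₂; μ₁₁)`; here `θ = μ₁₂ - μ₁₁`. -/
structure IsPattern (p : ℕ) (μ₁₂ μ₂₂ μ₁₁ : ℤ) : Prop where
  top_nonneg : 0 ≤ μ₁₂
  top_le : μ₁₂ ≤ p
  right_nonneg : 0 ≤ μ₂₂
  top_pos : 1 ≤ μ₂₂ → 1 ≤ μ₁₂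
  theta : μ₁₂ - μ₁₁ = 0 ∨ μ₁₂ - μ₁₁ = 1
  theta_zero : μ₁₂ = 0 → μ₁₂ - μ₁₁ = 0

/-- The index set of the basis `|μ)`. -/
@[ext]
structure Pattern (p : ℕ) where
  μ₁₂ : ℤ
  μ₂₂ : ℤ
  μ₁₁ : ℤ
  isPattern : IsPattern p μ₁₂ μ₂₂ μ₁₁

/-- `θ = μ₁₂ - μ₁₁`. -/
def Pattern.θ {p : ℕ} (μ : Pattern p) : ℤ := μ.μ₁₂ - μ.μ₁₁

/-- `1` if `j` is even, `0` otherwise. -/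
def evenInd (j : ℤ) : ℝ := if Even j then 1 else 0

/-- `1` if `j` is odd, `0` otherwise. -/
def oddInd (j : ℤ) : ℝ := if Odd j then 1 else 0

/-- The reduced matrix element `G₁`; at `(0, 0)` the factor `μ₁₂ / (μ₁₂ + μ₂₂)` of the general
expression is read as `1`. -/
def G₁ (p : ℕ) (a b : ℤ) : ℝ :=
  if a = 0 ∧ b = 0 then √p
  else √((a * (a + b + 1) * (p - a)) / (a + b + 1 - oddInd (b + 1)))

/-- The reduced matrix element `G₂`. -/
def G₂ (p : ℕ) (a b : ℤ) : ℝ :=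
  √(((oddInd b * b + 1) * (evenInd (b + 1) * (p + b) + 1) * (oddInd (b + 1) * (a + b) + 1)) /
    (evenInd (b + 1) * (a + b - 1) + 1))

open Classical in
/-- The vector `|μ)` with the given labels; zero if the labels are not admissible. -/
def ket {V : Type*} [AddCommGroup V] [Module ℂ V] {p : ℕ} (e : Module.Basis (Pattern p) ℂ V)
    (a b c : ℤ) : V :=
  if h : IsPattern p a b c then e ⟨a, b, c, h⟩ else 0

/-- `e` is the orthonormal basis `|μ)` of `V(p)`: the vacuum is the vector with all labels zero,
and `h_j`, `c_j^±` act by the stated matrix elements. -/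
structure IsKetBasis {V : Type*} [NormedAddCommGroup V] [InnerProductSpace ℂ V] (p : ℕ)
    (ρ : osp32 →ₗ[ℂ] Module.End ℂ V) (vac : V) (e : Module.Basis (Pattern p) ℂ V) : Prop where
  orthonormal : Orthonormal ℂ e
  vacuum : ket e 0 0 0 = vac
  h₁ : ∀ μ : Pattern p, hOp ρ 0 (e μ) = (-p / 2 + μ.μ₁₁ : ℂ) • e μ
  h₂ : ∀ μ : Pattern p, hOp ρ 1 (e μ) = (p / 2 + μ.μ₁₂ + μ.μ₂₂ - μ.μ₁₁ : ℂ) • e μ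
  c₁_plus : ∀ μ : Pattern p, cPlus ρ 0 (e μ) =
    (((((μ.μ₁₂ + μ.μ₂₂) / (μ.μ₁₂ + μ.μ₂₂ + 1) : ℝ) ^ (μ.θ / 2 : ℝ) *
        G₁ p μ.μ₁₂ μ.μ₂₂ : ℝ)) : ℂ) • ket e (μ.μ₁₂ + 1) μ.μ₂₂ (μ.μ₁₁ + 1)
    - ((μ.θ * √(1 / (μ.μ₁₂ + μ.μ₂₂ + 1)) * G₂ p μ.μ₁₂ μ.μ₂₂ : ℝ) : ℂ) •
        ket e μ.μ₁₂ (μ.μ₂₂ + 1) (μ.μ₁₁ + 1)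
  c₂_plus : ∀ μ : Pattern p, cPlus ρ 1 (e μ) =
    (((1 - μ.θ) * √(1 / (μ.μ₁₂ + μ.μ₂₂ + 1)) * G₁ p μ.μ₁₂ μ.μ₂₂ : ℝ) : ℂ) •
        ket e (μ.μ₁₂ + 1) μ.μ₂₂ μ.μ₁₁
    + (((-1) ^ μ.θ * √((μ.μ₁₂ + μ.μ₂₂) / (μ.μ₁₁ + μ.μ₂₂ + 1)) *
        G₂ p μ.μ₁₂ μ.μ₂₂ : ℝ) : ℂ) • ket e μ.μ₁₂ (μ.μ₂₂ + 1) μ.μ₁₁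
  c₁_minus : ∀ μ : Pattern p, cMinus ρ 0 (e μ) =
    (((((μ.μ₁₂ + μ.μ₂₂ - 1) / (μ.μ₁₂ + μ.μ₂₂) : ℝ) ^ (μ.θ / 2 : ℝ) *
        G₁ p (μ.μ₁₂ - 1) μ.μ₂₂ : ℝ)) : ℂ) • ket e (μ.μ₁₂ - 1) μ.μ₂₂ (μ.μ₁₁ - 1)
    - (((1 - μ.θ) * √(1 / (μ.μ₁₂ + μ.μ₂₂)) * G₂ p μ.μ₁₂ (μ.μ₂₂ - 1) : ℝ) : ℂ) •
        ket e μ.μ₁₂ (μ.μ₂₂ - 1) (μ.μ₁₁ - 1)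
  c₂_minus : ∀ μ : Pattern p, cMinus ρ 1 (e μ) =
    ((μ.θ * √(1 / (μ.μ₁₂ + μ.μ₂₂)) * G₁ p (μ.μ₁₂ - 1) μ.μ₂₂ : ℝ) : ℂ) •
        ket e (μ.μ₁₂ - 1) μ.μ₂₂ μ.μ₁₁
    + (((-1) ^ μ.θ * √((μ.μ₁₂ + μ.μ₂₂ - 1) / (μ.μ₁₁ + μ.μ₂₂)) *
        G₂ p μ.μ₁₂ (μ.μ₂₂ - 1) : ℝ) : ℂ) • ket e μ.μ₁₂ (μ.μ₂₂ - 1) μ.μ₁₁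

/-! ### Spectra -/

/-- The set of eigenvalues of an operator. -/
def eigenvalueSet {V : Type*} [AddCommGroup V] [Module ℂ V] (T : Module.End ℂ V) : Set ℂ :=
  {E | T.HasEigenvalue E}

/-- The closure of `T : V → V`, as an unbounded operator with core `V` in the Hilbert space
completion of `V`. -/
def hilbertClosure {V : Type*} [NormedAddCommGroup V] [InnerProductSpace ℂ V]
    (T : Module.End ℂ V) : UniformSpace.Completion V →ₗ.[ℂ] UniformSpace.Completion V :=
  LinearPMap.closure
    { domain := LinearMap.range (UniformSpace.Completion.toComplₗᵢ (𝕜 := ℂ) (E := V)).toLinearMap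
      toFun := (UniformSpace.Completion.toComplₗᵢ (𝕜 := ℂ) (E := V)).toLinearMap ∘ₗ T ∘ₗ
        (LinearEquiv.ofInjective (UniformSpace.Completion.toComplₗᵢ (𝕜 := ℂ) (E := V)).toLinearMap
          UniformSpace.Completion.toComplₗᵢ.injective).symm.toLinearMap }

/-- The spectrum of an unbounded operator: the complement of the set of `z` for which `T - z` has
an everywhere defined bounded two-sided inverse. -/
def unboundedSpectrum {W : Type*} [NormedAddCommGroup W] [NormedSpace ℂ W]
    (T : W →ₗ.[ℂ] W) : Set ℂ :=
  {z | ¬ ∃ R : W →L[ℂ] W,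
    (∀ w : W, ∃ h : R w ∈ T.domain, T ⟨R w, h⟩ - z • R w = w) ∧
    ∀ x : T.domain, R (T x - z • (x : W)) = x}

/-! ### The canonical one-dimensional oscillator -/

/-- The position operator `x` of the canonical one-dimensional oscillator (Schrödinger
representation), on the Schwartz space. -/
def canonicalPosition : Module.End ℂ (SchwartzMap ℝ ℂ) :=
  (SchwartzMap.smulLeftCLM ℂ (fun x : ℝ => (x : ℂ))).toLinearMap

/-- The momentum operator `-iħ d/dx`, on the Schwartz space. -/
def canonicalMomentum (ħ : ℝ) : Module.End ℂ (SchwartzMap ℝ ℂ) :=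
  (-Complex.I * ħ : ℂ) • (SchwartzMap.derivCLM ℂ ℂ).toLinearMap

/-- The Hamiltonian `p² / 2m + (m ω² / 2) x²` of the canonical one-dimensional oscillator. -/
def canonicalHamiltonian (m ω ħ : ℝ) : Module.End ℂ (SchwartzMap ℝ ℂ) :=
  (1 / (2 * m) : ℂ) • canonicalMomentum ħ ^ 2 + (m * ω ^ 2 / 2 : ℂ) • canonicalPosition ^ 2

end

set_option linter.unusedSimpArgs false
set_option linter.unusedTactic false
set_option linter.unreachableTactic false
set_option linter.unnecessarySeqFocus false

/-! ### Representations of `osp(3|2)` from triple relations -/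

/-! The four elements `c_j^±` generate `osp(3|2)`, and a representation is obtained from four
operators satisfying the triple relations `OspTriple`, together with an involution that provides the
grading. By the graded Jacobi identity, the elements whose brackets with everything are respected by
a linear map are closed under brackets, so only brackets with the generators have to be compared.

Existence. On a space with an orthonormal basis indexed by the patterns, the operators are defined
by the stated matrix elements. Sorting the kets by the parity of `μ₂₂` and by `θ`, and rescaling
them (`vecA`, `vecB`, `vecC`, `vecD`), removes all radicals except `g_k` and `y_j`, with `g_k² = k(p
- k)` and `y_j² = 2j(p + 2j)`. The relations become rational identities in `k`, `j`, `p` modulo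
these two equations (`model_relations`); the others follow by taking adjoints and from the Jacobi
identity.

Uniqueness. In the direct sum of two realizations, the vectors created from the pair of vacua span
an invariant subspace (`creationSpan_invariant`). Inner products of created vectors are determined
by adjointness and the vacuum conditions, so this subspace is the graph of an isometry
(`IsParaFock.exists_equiv`). Every realization therefore inherits the basis of the model.

Hamiltonian. The squares of `a_k^±` cancel in `H`, which is `ħω/2` times the sum of the
anticommutators `{a_k^+, a_k^-}`. Each of the three equals `(2/3) h₂`, so `H = ħω h₂` already holds
in any representation (`IsOspRep.hamiltonian_eq`), and `H` is diagonal on the kets with level `n =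
μ₂₂ + θ`.

Spectra. A diagonal operator has its diagonal entries as eigenvalues. If they are real and form a
closed set, the closure in the completion has no further spectrum, because away from this set the
inverse is diagonal and bounded (`unboundedSpectrum_diagonal`). The canonical oscillator is treated
by the ladder argument on the Schwartz space (`eigenvalueSet_ladder`). -/

theorem superComm_zero_left {R : Type*} [Ring R] (j : ZMod 2) (a b : R) :
    superComm 0 j a b = a * b - b * a := by
  simp [superComm]

theorem superComm_zero_right {R : Type*} [Ring R] (i : ZMod 2) (a b : R) :
    superComm i 0 a b = a * b - b * a := by
  simp [superComm]

theorem superComm_one_one {R : Type*} [Ring R] (a b : R) :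
    superComm 1 1 a b = a * b + b * a := by
  have hv : (1 : ZMod 2).val = 1 := by decide
  simp [superComm, hv]

theorem zmod_two_cases (i : ZMod 2) : i = 0 ∨ i = 1 := by
  revert i; decide

/-- It reduces compatibility with all brackets to compatibility with brackets against generators. -/
theorem superComm_jacobi {R : Type*} [Ring R] (i j k : ZMod 2) (a b c : R) :
    superComm (i + j) k (superComm i j a b) c =
      superComm i (j + k) a (superComm j k b c) -
        (-1) ^ (i.val * j.val) * superComm j (i + k) b (superComm i k a c) := by
  have hv : (1 : ZMod 2).val = 1 := by decide
  have h2 : (1 : ZMod 2) + 1 = 0 := by decide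
  rcases zmod_two_cases i with rfl | rfl <;> rcases zmod_two_cases j with rfl | rfl <;>
    rcases zmod_two_cases k with rfl | rfl <;>
    simp only [add_zero, zero_add, h2, hv, ZMod.val_zero, mul_zero, mul_one, pow_zero,
      pow_one, superComm_zero_left, superComm_zero_right, superComm_one_one] <;>
    noncomm_ring

theorem superComm_add_left {R : Type*} [Ring R] (i j : ZMod 2) (a a' b : R) :
    superComm i j (a + a') b = superComm i j a b + superComm i j a' b := by
  unfold superComm; noncomm_ring

theorem superComm_smul_left {R : Type*} [Ring R] [Algebra ℂ R] (i j : ZMod 2) (r : ℂ) (a b : R) :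
    superComm i j (r • a) b = r • superComm i j a b := by
  simp [superComm, smul_sub]

theorem superComm_zero_arg {R : Type*} [Ring R] (i j : ZMod 2) (b : R) :
    superComm i j 0 b = 0 := by
  simp [superComm]

section Triple

variable {R : Type*} [Ring R] {P M Q N : R}

/-- The triple relations of one parafermion `P`, `M` and one paraboson `Q`, `N`. -/
structure OspTriple (P M Q N : R) : Prop where
  h₁P : (P * M - M * P) * P - P * (P * M - M * P) = P
  h₁M : (P * M - M * P) * M - M * (P * M - M * P) = -M
  h₁Q : (P * M - M * P) * Q - Q * (P * M - M * P) = 0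
  h₁N : (P * M - M * P) * N - N * (P * M - M * P) = 0
  h₂P : (Q * N + N * Q) * P - P * (Q * N + N * Q) = 0
  h₂M : (Q * N + N * Q) * M - M * (Q * N + N * Q) = 0
  h₂Q : (Q * N + N * Q) * Q - Q * (Q * N + N * Q) = Q
  h₂N : (Q * N + N * Q) * N - N * (Q * N + N * Q) = -N
  PQQ : P * (Q * Q) - (Q * Q) * P = 0
  MQQ : M * (Q * Q) - (Q * Q) * M = 0
  PNN : P * (N * N) - (N * N) * P = 0
  MNN : M * (N * N) - (N * N) * M = 0
  PPQ : P * (P * Q - Q * P) - (P * Q - Q * P) * P = 0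
  PPN : P * (P * N - N * P) - (P * N - N * P) * P = 0
  MMQ : M * (M * Q - Q * M) - (M * Q - Q * M) * M = 0
  MMN : M * (M * N - N * M) - (M * N - N * M) * M = 0
  MPQ : M * (P * Q - Q * P) - (P * Q - Q * P) * M = Q
  PMN : P * (M * N - N * M) - (M * N - N * M) * P = N
  NPQ : N * (P * Q - Q * P) + (P * Q - Q * P) * N = -P
  QMN : Q * (M * N - N * M) + (M * N - N * M) * Q = M

namespace OspTriple

/-- Each of the four generators has to be bracketed with eight quadratic elements. Twenty of these
32 brackets are fields of `OspTriple`, two vanish trivially (`Q` with `Q * Q` and `N` with `N * N`),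
and the remaining ten, proved from here on, follow from the Jacobi identity. -/
theorem MPN (h : OspTriple P M Q N) : M * (P * N - N * P) - (P * N - N * P) * M = N := by
  have h1 := h.PMN
  have h2 := h.h₁N
  have : M * (P * N - N * P) - (P * N - N * P) * M = (P * (M * N - N * M) - (M * N - N * M) * P) -
    ((P * M - M * P) * N - N * (P * M - M * P)) := by noncomm_ring
  rw [this, h1, h2, sub_zero]

theorem PMQ (h : OspTriple P M Q N) : P * (M * Q - Q * M) - (M * Q - Q * M) * P = Q := by
  have : P * (M * Q - Q * M) - (M * Q - Q * M) * P = (M * (P * Q - Q * P) - (P * Q - Q * P) * M) +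
    ((P * M - M * P) * Q - Q * (P * M - M * P)) := by noncomm_ring
  rw [this, h.MPQ, h.h₁Q, add_zero]

theorem QPN (h : OspTriple P M Q N) : Q * (P * N - N * P) + (P * N - N * P) * Q = P := by
  have : Q * (P * N - N * P) + (P * N - N * P) * Q = -(N * (P * Q - Q * P) + (P * Q - Q * P) * N) -
    ((Q * N + N * Q) * P - P * (Q * N + N * Q)) := by noncomm_ring
  rw [this, h.NPQ, h.h₂P, sub_zero, neg_neg]

theorem NMQ (h : OspTriple P M Q N) : N * (M * Q - Q * M) + (M * Q - Q * M) * N = -M := by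
  have : N * (M * Q - Q * M) + (M * Q - Q * M) * N = -(Q * (M * N - N * M) + (M * N - N * M) * Q) -
    ((Q * N + N * Q) * M - M * (Q * N + N * Q)) := by noncomm_ring
  rw [this, h.QMN, h.h₂M, sub_zero]

theorem NQQ (h : OspTriple P M Q N) : N * (Q * Q) - (Q * Q) * N = Q := by
  have : N * (Q * Q) - (Q * Q) * N = (Q * N + N * Q) * Q - Q * (Q * N + N * Q) := by noncomm_ring
  rw [this, h.h₂Q]

theorem QNN (h : OspTriple P M Q N) : Q * (N * N) - (N * N) * Q = -N := by
  have : Q * (N * N) - (N * N) * Q = (Q * N + N * Q) * N - N * (Q * N + N * Q) := by noncomm_ring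
  rw [this, h.h₂N]

theorem QPQ (h : OspTriple P M Q N) : Q * (P * Q - Q * P) + (P * Q - Q * P) * Q = 0 := by
  have : Q * (P * Q - Q * P) + (P * Q - Q * P) * Q = P * (Q * Q) - (Q * Q) * P := by noncomm_ring
  rw [this, h.PQQ]

theorem QMQ (h : OspTriple P M Q N) : Q * (M * Q - Q * M) + (M * Q - Q * M) * Q = 0 := by
  have : Q * (M * Q - Q * M) + (M * Q - Q * M) * Q = M * (Q * Q) - (Q * Q) * M := by noncomm_ring
  rw [this, h.MQQ]

theorem NPN (h : OspTriple P M Q N) : N * (P * N - N * P) + (P * N - N * P) * N = 0 := by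
  have : N * (P * N - N * P) + (P * N - N * P) * N = P * (N * N) - (N * N) * P := by noncomm_ring
  rw [this, h.PNN]

theorem NMN (h : OspTriple P M Q N) : N * (M * N - N * M) + (M * N - N * M) * N = 0 := by
  have : N * (M * N - N * M) + (M * N - N * M) * N = M * (N * N) - (N * N) * M := by noncomm_ring
  rw [this, h.MNN]

end OspTriple

end Triple

/-! ### Triple relations determine all brackets -/

section Action

variable {R : Type*} [Ring R] [Algebra ℂ R]

/-- The elements of degree `i` whose superbracket with everything is respected by `f`. -/
def bracketRespecting (f : Matrix (Fin 5) (Fin 5) ℂ →ₗ[ℂ] R) (i : ZMod 2) :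
    Submodule ℂ (Matrix (Fin 5) (Fin 5) ℂ) where
  carrier := {A | A ∈ ospPart i ∧ ∀ j, ∀ B ∈ ospPart j,
    f (superComm i j A B) = superComm i j (f A) (f B)}
  zero_mem' := ⟨zero_mem _, fun j B _ => by simp [superComm_zero_arg]⟩
  add_mem' := fun hA hB => ⟨add_mem hA.1 hB.1, fun j C hC => by
    rw [superComm_add_left, map_add, map_add, superComm_add_left, hA.2 j C hC, hB.2 j C hC]⟩
  smul_mem' := fun r A hA => ⟨Submodule.smul_mem _ _ hA.1, fun j C hC => by
    rw [superComm_smul_left, map_smul, map_smul, superComm_smul_left, hA.2 j C hC]⟩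

/-- The Jacobi identity rewrites a bracket with `⟦A, B⟧` as iterated brackets with `A` and `B`; it
is applied once among matrices and once, backwards, in `R`. -/
theorem superComm_mem_bracketRespecting {f : Matrix (Fin 5) (Fin 5) ℂ →ₗ[ℂ] R} {i j : ZMod 2}
    {A B : Matrix (Fin 5) (Fin 5) ℂ} (hA : A ∈ bracketRespecting f i)
    (hB : B ∈ bracketRespecting f j) : superComm i j A B ∈ bracketRespecting f (i + j) := by
  refine ⟨superComm_mem hA.1 hB.1, fun k C hC => ?_⟩
  -- The map `f` is only linear; the sign in the Jacobi identity is a ring element and must be moved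
  -- through `f` by its two possible values.
  have hf : ∀ (n : ℕ) X, f ((-1) ^ n * X) = (-1) ^ n * f X := fun n X => by
    rcases neg_one_pow_eq_or (Matrix (Fin 5) (Fin 5) ℂ) n with h | h <;>
      rcases Nat.even_or_odd n with h' | h' <;> simp [h'.neg_one_pow]
  rw [superComm_jacobi, map_sub, hf, hA.2 _ _ (superComm_mem hB.1 hC), hB.2 _ _ hC,
    hB.2 _ _ (superComm_mem hA.1 hC), hA.2 _ _ hC, hA.2 _ _ hB.1, superComm_jacobi]

/-- The linear extension of the assignment of the ring elements `[P, M]`, … to the basis of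
`osp(3|2)`, if `P`, `M`, `Q`, `N` are assigned to `c₁^+`, `c₁^-`, `c₂^+`, `c₂^-` (divided
by `√2`). -/
noncomputable def ospExtend (P M Q N : R) : Matrix (Fin 5) (Fin 5) ℂ →ₗ[ℂ] R where
  toFun A := A 0 0 • (P * M - M * P) + A 0 2 • P - A 1 2 • M + A 3 3 • (Q * N + N * Q) +
    A 3 4 • (Q * Q) - A 4 3 • (N * N) + A 0 3 • (P * N - N * P) - A 1 3 • (M * N - N * M) +
    A 2 3 • N + A 0 4 • (P * Q - Q * P) - A 1 4 • (M * Q - Q * M) + A 2 4 • Q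
  map_add' A B := by simp only [Matrix.add_apply]; module
  map_smul' r A := by simp only [Matrix.smul_apply, smul_eq_mul, RingHom.id_apply]; module

variable {P M Q N : R}

theorem ospExtend_ospMatrix (a b c d e f x y z u v w : ℂ) :
    ospExtend P M Q N (ospMatrix a b c d e f x y z u v w) =
    a • (P * M - M * P) + b • P - c • M + d • (Q * N + N * Q) +
    e • (Q * Q) - f • (N * N) + x • (P * N - N * P) - y • (M * N - N * M) +
    z • N + u • (P * Q - Q * P) - v • (M * Q - Q * M) + w • Q := by
  simp [ospExtend, ospMatrix]

/-- This and the next two lemmas record the structure constants in the coordinates of `ospMatrix`,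
against which the brackets of operators are matched. -/
theorem even_comm_even (a b c d e f a' b' c' d' e' f' : ℂ) :
    superComm 0 0 (ospMatrix a b c d e f 0 0 0 0 0 0) (ospMatrix a' b' c' d' e' f' 0 0 0 0 0 0) =
    ospMatrix (b' * c - b * c') (a * b' - a' * b) (a' * c - a * c') (e * f' - e' * f)
      (2 * (d * e' - d' * e)) (2 * (f * d' - f' * d)) 0 0 0 0 0 0 := by
  rw [superComm_zero_left]
  simp only [ospMatrix, ← Matrix.ext_iff, Fin.forall_fin_succ]
  simp [Matrix.vecHead, Matrix.vecTail]
  split_ands <;> ring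

theorem even_comm_odd (a b c d e f x y z u v w : ℂ) :
    superComm 0 1 (ospMatrix a b c d e f 0 0 0 0 0 0) (ospMatrix 0 0 0 0 0 0 x y z u v w) =
    ospMatrix 0 0 0 0 0 0 (a * x + b * z - x * d - u * f) (-a * y + c * z - y * d - v * f)
      (-c * x - b * y - z * d - w * f) (a * u + b * w - x * e + u * d)
      (-a * v + c * w - y * e + v * d) (-c * u - b * v - z * e + w * d) := by
  rw [superComm_zero_left]
  simp only [ospMatrix, ← Matrix.ext_iff, Fin.forall_fin_succ]
  simp [Matrix.vecHead, Matrix.vecTail]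
  split_ands <;> ring

theorem odd_comm_odd (x y z u v w x' y' z' u' v' w' : ℂ) :
    superComm 1 1 (ospMatrix 0 0 0 0 0 0 x y z u v w) (ospMatrix 0 0 0 0 0 0 x' y' z' u' v' w') =
    ospMatrix (x * v' - u * y' + x' * v - u' * y) (x * w' - u * z' + x' * w - u' * z)
      (y * w' - v * z' + y' * w - v' * z)
      (v * x' + u * y' + w * z' + v' * x + u' * y + w' * z)
      (2 * (v * u' + u * v' + w * w')) (-2 * (y * x' + x * y' + z * z')) 0 0 0 0 0 0 := by
  rw [superComm_one_one]
  simp only [ospMatrix, ← Matrix.ext_iff, Fin.forall_fin_succ]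
  simp [Matrix.vecHead, Matrix.vecTail]
  split_ands <;> ring

theorem superComm_one_zero_eq_neg {R : Type*} [Ring R] (a b : R) :
    superComm 1 0 a b = - superComm 0 1 b a := by
  rw [superComm_zero_left, superComm_zero_right]; noncomm_ring

theorem even_mem_bracketRespecting {f : Matrix (Fin 5) (Fin 5) ℂ →ₗ[ℂ] R}
    {G : Matrix (Fin 5) (Fin 5) ℂ} (hG : G ∈ ospEven)
    (h0 : ∀ B ∈ ospEven, f (superComm 0 0 G B) = f G * f B - f B * f G)
    (h1 : ∀ B ∈ ospOdd, f (superComm 0 1 G B) = f G * f B - f B * f G) :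
    G ∈ bracketRespecting f 0 := by
  refine ⟨by simpa [ospPart] using hG, fun j B hB => ?_⟩
  rw [superComm_zero_left _ (f G)]
  rcases zmod_two_cases j with rfl | rfl
  · exact h0 B (by simpa [ospPart] using hB)
  · exact h1 B (by simpa [ospPart] using hB)

theorem odd_mem_bracketRespecting {f : Matrix (Fin 5) (Fin 5) ℂ →ₗ[ℂ] R}
    {G : Matrix (Fin 5) (Fin 5) ℂ} (hG : G ∈ ospOdd)
    (h0 : ∀ B ∈ ospEven, f (superComm 0 1 B G) = f B * f G - f G * f B)
    (h1 : ∀ B ∈ ospOdd, f (superComm 1 1 G B) = f G * f B + f B * f G) :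
    G ∈ bracketRespecting f 1 := by
  refine ⟨by simpa [ospPart] using hG, fun j B hB => ?_⟩
  rcases zmod_two_cases j with rfl | rfl
  · rw [superComm_one_zero_eq_neg, map_neg, h0 B (by simpa [ospPart] using hB),
      superComm_zero_right, neg_sub]
  · rw [superComm_one_one (f G)]; exact h1 B (by simpa [ospPart] using hB)

theorem comm_neg {R : Type*} [Ring R] {a b c : R} (h : a * b - b * a = c) : b * a - a * b = -c := by
  rw [← h, neg_sub]

theorem comm_ospExtend_even {G H₁ H₂ X₁ X₂ X₃ X₄ : R} (a b c d e f : ℂ) {P M Q N : R}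
    (ha : G * (P * M - M * P) - (P * M - M * P) * G = H₁) (hb : G * P - P * G = X₁)
    (hc : G * M - M * G = X₂) (hd : G * (Q * N + N * Q) - (Q * N + N * Q) * G = H₂)
    (he : G * (Q * Q) - (Q * Q) * G = X₃) (hf : G * (N * N) - (N * N) * G = X₄) :
    G * ospExtend P M Q N (ospMatrix a b c d e f 0 0 0 0 0 0) -
      ospExtend P M Q N (ospMatrix a b c d e f 0 0 0 0 0 0) * G =
    a • H₁ + b • X₁ - c • X₂ + d • H₂ + e • X₃ - f • X₄ := by
  rw [← ha, ← hb, ← hc, ← hd, ← he, ← hf]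
  simp only [ospExtend_ospMatrix, zero_smul, add_zero, sub_zero]
  -- The quadratic elements are kept opaque, so that distributivity only expands the products with
  -- `G`.
  generalize P * M - M * P = T₁
  generalize Q * N + N * Q = T₂
  simp only [mul_add, add_mul, mul_sub, sub_mul, smul_mul_assoc, mul_smul_comm, smul_sub]
  abel

theorem superComm_ospExtend_odd {G X₁ X₂ X₃ X₄ Y₁ Y₂ : R} (x y z u v w : ℂ) {P M Q N : R}
    (i : ZMod 2)
    (hx : superComm i 1 G (P * N - N * P) = X₁) (hy : superComm i 1 G (M * N - N * M) = X₂)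
    (hz : superComm i 1 G N = Y₁) (hu : superComm i 1 G (P * Q - Q * P) = X₃)
    (hv : superComm i 1 G (M * Q - Q * M) = X₄) (hw : superComm i 1 G Q = Y₂) :
    superComm i 1 G (ospExtend P M Q N (ospMatrix 0 0 0 0 0 0 x y z u v w)) =
    x • X₁ - y • X₂ + z • Y₁ + u • X₃ - v • X₄ + w • Y₂ := by
  rw [← hx, ← hy, ← hz, ← hu, ← hv, ← hw]
  simp only [ospExtend_ospMatrix, zero_smul, add_zero, sub_zero, zero_add]
  generalize P * N - N * P = T₁
  generalize M * N - N * M = T₂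
  generalize P * Q - Q * P = T₃
  generalize M * Q - Q * M = T₄
  unfold superComm
  generalize ((-1 : R) ^ (i.val * (1 : ZMod 2).val)) = σ
  simp only [mul_add, add_mul, mul_sub, sub_mul, smul_mul_assoc, mul_smul_comm, smul_sub]
  abel

namespace OspTriple

variable {P M Q N : R}

theorem P_mem (h : OspTriple P M Q N) :
    ospMatrix 0 1 0 0 0 0 0 0 0 0 0 0 ∈ bracketRespecting (ospExtend P M Q N) 0 := by
  have hG : ospExtend P M Q N (ospMatrix 0 1 0 0 0 0 0 0 0 0 0 0) = P := by
    rw [ospExtend_ospMatrix]; simp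
  refine even_mem_bracketRespecting ⟨0, 1, 0, 0, 0, 0, rfl⟩ ?_ ?_
  · rintro _ ⟨a, b, c, d, e, f, rfl⟩
    rw [hG, comm_ospExtend_even a b c d e f (comm_neg h.h₁P) rfl rfl (comm_neg h.h₂P) h.PQQ h.PNN,
      even_comm_even, ospExtend_ospMatrix]
    module
  · rintro _ ⟨x, y, z, u, v, w, rfl⟩
    rw [hG, ← superComm_zero_left 1, superComm_ospExtend_odd x y z u v w 0
      ((superComm_zero_left _ _ _).trans h.PPN) ((superComm_zero_left _ _ _).trans h.PMN) (superComm_zero_left _ _ _) ((superComm_zero_left _ _ _).trans h.PPQ) ((superComm_zero_left _ _ _).trans h.PMQ) (superComm_zero_left _ _ _), even_comm_odd, ospExtend_ospMatrix]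
    module

theorem M_mem (h : OspTriple P M Q N) :
    ospMatrix 0 0 (-1) 0 0 0 0 0 0 0 0 0 ∈ bracketRespecting (ospExtend P M Q N) 0 := by
  have hG : ospExtend P M Q N (ospMatrix 0 0 (-1) 0 0 0 0 0 0 0 0 0) = M := by
    rw [ospExtend_ospMatrix]; simp
  refine even_mem_bracketRespecting ⟨0, 0, -1, 0, 0, 0, rfl⟩ ?_ ?_
  · rintro _ ⟨a, b, c, d, e, f, rfl⟩
    rw [hG, comm_ospExtend_even a b c d e f (comm_neg h.h₁M) rfl rfl (comm_neg h.h₂M) h.MQQ h.MNN,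
      even_comm_even, ospExtend_ospMatrix]
    module
  · rintro _ ⟨x, y, z, u, v, w, rfl⟩
    rw [hG, ← superComm_zero_left 1, superComm_ospExtend_odd x y z u v w 0
      ((superComm_zero_left _ _ _).trans h.MPN) ((superComm_zero_left _ _ _).trans h.MMN) (superComm_zero_left _ _ _) ((superComm_zero_left _ _ _).trans h.MPQ) ((superComm_zero_left _ _ _).trans h.MMQ) (superComm_zero_left _ _ _), even_comm_odd, ospExtend_ospMatrix]
    module

theorem Q_mem (h : OspTriple P M Q N) :
    ospMatrix 0 0 0 0 0 0 0 0 0 0 0 1 ∈ bracketRespecting (ospExtend P M Q N) 1 := by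
  have hG : ospExtend P M Q N (ospMatrix 0 0 0 0 0 0 0 0 0 0 0 1) = Q := by
    rw [ospExtend_ospMatrix]; simp
  refine odd_mem_bracketRespecting ⟨0, 0, 0, 0, 0, 1, rfl⟩ ?_ ?_
  · rintro _ ⟨a, b, c, d, e, f, rfl⟩
    rw [hG, ← neg_sub,
      comm_ospExtend_even a b c d e f (comm_neg h.h₁Q) rfl rfl (comm_neg h.h₂Q) (by noncomm_ring : Q * (Q * Q) - (Q * Q) * Q = 0) h.QNN, even_comm_odd, ospExtend_ospMatrix]
    module
  · rintro _ ⟨x, y, z, u, v, w, rfl⟩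
    rw [hG, ← superComm_one_one, superComm_ospExtend_odd x y z u v w 1
      ((superComm_one_one _ _).trans h.QPN) ((superComm_one_one _ _).trans h.QMN) (superComm_one_one _ _) ((superComm_one_one _ _).trans h.QPQ) ((superComm_one_one _ _).trans h.QMQ) (superComm_one_one _ _), odd_comm_odd, ospExtend_ospMatrix]
    module

theorem N_mem (h : OspTriple P M Q N) :
    ospMatrix 0 0 0 0 0 0 0 0 1 0 0 0 ∈ bracketRespecting (ospExtend P M Q N) 1 := by
  have hG : ospExtend P M Q N (ospMatrix 0 0 0 0 0 0 0 0 1 0 0 0) = N := by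
    rw [ospExtend_ospMatrix]; simp
  refine odd_mem_bracketRespecting ⟨0, 0, 1, 0, 0, 0, rfl⟩ ?_ ?_
  · rintro _ ⟨a, b, c, d, e, f, rfl⟩
    rw [hG, ← neg_sub,
      comm_ospExtend_even a b c d e f (comm_neg h.h₁N) rfl rfl (comm_neg h.h₂N) h.NQQ (by noncomm_ring : N * (N * N) - (N * N) * N = 0), even_comm_odd, ospExtend_ospMatrix]
    module
  · rintro _ ⟨x, y, z, u, v, w, rfl⟩
    rw [hG, ← superComm_one_one, superComm_ospExtend_odd x y z u v w 1
      ((superComm_one_one _ _).trans h.NPN) ((superComm_one_one _ _).trans h.NMN) (superComm_one_one _ _) ((superComm_one_one _ _).trans h.NPQ) ((superComm_one_one _ _).trans h.NMQ) (superComm_one_one _ _), odd_comm_odd, ospExtend_ospMatrix]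
    module

end OspTriple

end Action

theorem ospMatrix_add (a b c d e f x y z u v w a' b' c' d' e' f' x' y' z' u' v' w' : ℂ) :
    ospMatrix a b c d e f x y z u v w + ospMatrix a' b' c' d' e' f' x' y' z' u' v' w' =
    ospMatrix (a + a') (b + b') (c + c') (d + d') (e + e') (f + f') (x + x') (y + y') (z + z')
      (u + u') (v + v') (w + w') := by
  ext i j; fin_cases i <;> fin_cases j <;> simp [ospMatrix] <;> ring

theorem ospMatrix_smul (r a b c d e f x y z u v w : ℂ) :
    r • ospMatrix a b c d e f x y z u v w =
    ospMatrix (r * a) (r * b) (r * c) (r * d) (r * e) (r * f) (r * x) (r * y) (r * z) (r * u)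
      (r * v) (r * w) := by
  ext i j; fin_cases i <;> fin_cases j <;> simp [ospMatrix]

/-- The generators `c_j^±` (divided by `√2`) generate `osp(3|2)`. -/
theorem ospPart_le_of_generators (S : ZMod 2 → Submodule ℂ (Matrix (Fin 5) (Fin 5) ℂ))
    (hP : ospMatrix 0 1 0 0 0 0 0 0 0 0 0 0 ∈ S 0) (hM : ospMatrix 0 0 (-1) 0 0 0 0 0 0 0 0 0 ∈ S 0)
    (hQ : ospMatrix 0 0 0 0 0 0 0 0 0 0 0 1 ∈ S 1) (hN : ospMatrix 0 0 0 0 0 0 0 0 1 0 0 0 ∈ S 1)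
    (hS : ∀ i j, ∀ A ∈ S i, ∀ B ∈ S j, superComm i j A B ∈ S (i + j)) (i : ZMod 2) :
    ospPart i ≤ S i := by
  have h2 : (1 : ZMod 2) + 1 = 0 := by decide
  rcases zmod_two_cases i with rfl | rfl
  · have h₁ := hS _ _ _ hP _ hM
    have h₂ := hS _ _ _ hQ _ hN
    have hQQ := hS _ _ _ hQ _ hQ
    have hNN := hS _ _ _ hN _ hN
    rw [even_comm_even] at h₁
    rw [odd_comm_odd] at h₂ hQQ hNN
    rw [add_zero] at h₁
    rw [h2] at h₂ hQQ hNN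
    rintro A hA
    obtain ⟨a, b, c, d, e, f, rfl⟩ : A ∈ ospEven := by simpa [ospPart] using hA
    -- The brackets `⟦Q, Q⟧` and `⟦N, N⟧` are `2` and `-2` times the basis elements with coordinates
    -- `e` and `f`, whence the factors `e / 2` and `-f / 2`.
    have := add_mem (add_mem (add_mem (Submodule.smul_mem _ a h₁) (Submodule.smul_mem _ b hP))
      (add_mem (Submodule.smul_mem _ (-c) hM) (Submodule.smul_mem _ d h₂)))
      (add_mem (Submodule.smul_mem _ (e / 2) hQQ) (Submodule.smul_mem _ (-f / 2) hNN))
    convert this using 1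
    simp only [ospMatrix_smul, ospMatrix_add]
    congr 1 <;> ring
  · have hPQ := hS _ _ _ hP _ hQ
    have hPN := hS _ _ _ hP _ hN
    have hMQ := hS _ _ _ hM _ hQ
    have hMN := hS _ _ _ hM _ hN
    rw [even_comm_odd, zero_add] at hPQ hPN hMQ hMN
    rintro A hA
    obtain ⟨x, y, z, u, v, w, rfl⟩ : A ∈ ospOdd := by simpa [ospPart] using hA
    have := add_mem (add_mem (add_mem (Submodule.smul_mem _ x hPN) (Submodule.smul_mem _ (-y) hMN))
      (add_mem (Submodule.smul_mem _ z hN) (Submodule.smul_mem _ u hPQ)))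
      (add_mem (Submodule.smul_mem _ (-v) hMQ) (Submodule.smul_mem _ w hQ))
    convert this using 1
    simp only [ospMatrix_smul, ospMatrix_add]
    congr 1 <;> ring

theorem ospPart_iSup {A : Matrix (Fin 5) (Fin 5) ℂ} (hA : A ∈ osp32) :
    ∃ B ∈ ospPart 0, ∃ C ∈ ospPart 1, A = B + C := by
  obtain ⟨a, b, c, d, e, f, x, y, z, u, v, w, rfl⟩ := hA
  refine ⟨ospMatrix a b c d e f 0 0 0 0 0 0, by simpa [ospPart] using ⟨a, b, c, d, e, f, rfl⟩,
    ospMatrix 0 0 0 0 0 0 x y z u v w, by simpa [ospPart] using ⟨x, y, z, u, v, w, rfl⟩, ?_⟩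
  rw [ospMatrix_add]
  simp

namespace OspTriple

variable {R : Type*} [Ring R] [Algebra ℂ R] {P M Q N : R}

theorem ospPart_le_bracketRespecting (h : OspTriple P M Q N) (i : ZMod 2) :
    ospPart i ≤ bracketRespecting (ospExtend P M Q N) i :=
  ospPart_le_of_generators _ h.P_mem h.M_mem h.Q_mem h.N_mem
    (fun _ _ _ hA _ hB => superComm_mem_bracketRespecting hA hB) i

theorem map_superComm (h : OspTriple P M Q N) {i j : ZMod 2} {A B : Matrix (Fin 5) (Fin 5) ℂ}
    (hA : A ∈ ospPart i) (hB : B ∈ ospPart j) :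
    ospExtend P M Q N (superComm i j A B) =
      superComm i j (ospExtend P M Q N A) (ospExtend P M Q N B) :=
  (h.ospPart_le_bracketRespecting i hA).2 j B hB

end OspTriple

/-! ### The grading of the representation -/

section Module

variable {V : Type*} [AddCommGroup V] [Module ℂ V]

/-- The operators of `osp(3|2)` obtained from those of the generators. -/
noncomputable def ospOperators (P M Q N : Module.End ℂ V) : osp32 →ₗ[ℂ] Module.End ℂ V :=
  ospExtend P M Q N ∘ₗ osp32.subtype

/-- An involution which commutes with the parafermion and anticommutes with the paraboson
provides the grading. -/
theorem OspTriple.isOspRep {P M Q N Z : Module.End ℂ V} (h : OspTriple P M Q N)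
    (hZ : Z * Z = 1) (hP : Z * P = P * Z) (hM : Z * M = M * Z) (hQ : Z * Q = -(Q * Z))
    (hN : Z * N = -(N * Z)) : IsOspRep (ospOperators P M Q N) := by
  refine ⟨?_, fun i j A B hA hB => h.map_superComm hA hB⟩
  have hZ' : ∀ v, Z (Z v) = v := fun v => congrArg (fun T : Module.End ℂ V => T v) hZ
  have app : ∀ {S T : Module.End ℂ V}, S = T → ∀ v, S v = T v := fun h v => by rw [h]
  have hP' : ∀ v, Z (P v) = P (Z v) := app hP
  have hM' : ∀ v, Z (M v) = M (Z v) := app hM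
  have hQ' : ∀ v, Z (Q v) = -Q (Z v) := app hQ
  have hN' : ∀ v, Z (N v) = -N (Z v) := app hN
  -- The homogeneous parts are the eigenspaces of `Z` for `1` and `-1`; since `Z² = 1`, the
  -- projections onto them are `(1 ± Z) / 2`.
  refine ⟨fun i => LinearMap.ker (Z - ((-1 : ℂ) ^ i.val) • (1 : Module.End ℂ V)), ?_, ?_⟩
  · have hv : (1 : ZMod 2).val = 1 := by decide
    simp only [ZMod.val_zero, hv, pow_zero, pow_one]
    refine ⟨?_, ?_⟩
    · rw [Submodule.disjoint_def]
      intro v h0 h1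
      simp only [LinearMap.mem_ker, LinearMap.sub_apply, LinearMap.smul_apply,
        Module.End.one_apply] at h0 h1
      have : (2 : ℂ) • v = 0 := by
        rw [show (2 : ℂ) • v = (Z v - (-1 : ℂ) • v) - (Z v - (1 : ℂ) • v) by module, h0, h1,
          sub_zero]
      simpa using this
    · rw [codisjoint_iff, eq_top_iff]
      rintro v -
      rw [Submodule.mem_sup]
      refine ⟨(1 / 2 : ℂ) • (v + Z v), ?_, (1 / 2 : ℂ) • (v - Z v), ?_, by module⟩ <;>
      · simp only [LinearMap.mem_ker, LinearMap.sub_apply, LinearMap.smul_apply,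
          Module.End.one_apply, map_smul, map_add, map_sub, hZ']
        module
  · intro i j A hA v hv
    -- Even basis elements contain an even number of factors `Q`, `N` and odd ones an odd number, so
    -- `Z` commutes or anticommutes with the operators accordingly.
    have key : ∀ w, Z (ospOperators P M Q N A w) =
        (-1 : ℂ) ^ i.val • ospOperators P M Q N A (Z w) := by
      intro w
      have h1 : (1 : ZMod 2).val = 1 := by decide
      obtain ⟨A, hA'⟩ := A
      rcases zmod_two_cases i with rfl | rfl
      · obtain ⟨a, b, c, d, e, f, rfl⟩ : A ∈ ospEven := by simpa [ospPart] using hA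
        simp only [ospOperators, LinearMap.comp_apply, Submodule.subtype_apply,
          ospExtend_ospMatrix]
        simp [hP', hM', hQ', hN']
      · obtain ⟨x, y, z, u, v, w, rfl⟩ : A ∈ ospOdd := by simpa [ospPart] using hA
        simp only [ospOperators, LinearMap.comp_apply, Submodule.subtype_apply,
          ospExtend_ospMatrix, h1]
        simp [hP', hM', hQ', hN']
        module
    have hpow : ((-1 : ℂ)) ^ (i + j).val = (-1) ^ i.val * (-1) ^ j.val := by
      rcases zmod_two_cases i with rfl | rfl <;> rcases zmod_two_cases j with rfl | rfl <;>
        simp [show (1 : ZMod 2).val = 1 by decide, show (1 : ZMod 2) + 1 = 0 by decide]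
    simp only [LinearMap.mem_ker, LinearMap.sub_apply, LinearMap.smul_apply,
      Module.End.one_apply, sub_eq_zero] at hv ⊢
    rw [key, hv, map_smul, smul_smul, hpow]

end Module

/-! ### Uniqueness of the Fock space -/

section Uniqueness

theorem cPlusMatrix_zero :
    cPlusMatrix 0 = ((√2 : ℝ) : ℂ) • ospMatrix 0 1 0 0 0 0 0 0 0 0 0 0 := by
  ext i j; fin_cases i <;> fin_cases j <;> simp [cPlusMatrix, ospMatrix]

theorem cPlusMatrix_one :
    cPlusMatrix 1 = ((√2 : ℝ) : ℂ) • ospMatrix 0 0 0 0 0 0 0 0 0 0 0 1 := by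
  ext i j; fin_cases i <;> fin_cases j <;> simp [cPlusMatrix, ospMatrix]

theorem cMinusMatrix_zero :
    cMinusMatrix 0 = ((√2 : ℝ) : ℂ) • ospMatrix 0 0 (-1) 0 0 0 0 0 0 0 0 0 := by
  ext i j; fin_cases i <;> fin_cases j <;> simp [cMinusMatrix, ospMatrix]

theorem cMinusMatrix_one :
    cMinusMatrix 1 = ((√2 : ℝ) : ℂ) • ospMatrix 0 0 0 0 0 0 0 0 1 0 0 0 := by
  ext i j; fin_cases i <;> fin_cases j <;> simp [cMinusMatrix, ospMatrix]

theorem cPlusMatrix_mem_ospPart (j : Fin 2) : cPlusMatrix j ∈ ospPart (cDeg j) := by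
  fin_cases j
  · simp only [Fin.zero_eta, cPlusMatrix_zero]
    exact Submodule.smul_mem _ _ ⟨0, 1, 0, 0, 0, 0, rfl⟩
  · simp only [Fin.mk_one, cPlusMatrix_one]
    exact Submodule.smul_mem _ _ ⟨0, 0, 0, 0, 0, 1, rfl⟩

theorem cMinusMatrix_mem_ospPart (j : Fin 2) : cMinusMatrix j ∈ ospPart (cDeg j) := by
  fin_cases j
  · simp only [Fin.zero_eta, cMinusMatrix_zero]
    exact Submodule.smul_mem _ _ ⟨0, 0, -1, 0, 0, 0, rfl⟩
  · simp only [Fin.mk_one, cMinusMatrix_one]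
    exact Submodule.smul_mem _ _ ⟨0, 0, 1, 0, 0, 0, rfl⟩

theorem ospMatrix_neg (a b c d e f x y z u v w : ℂ) :
    -ospMatrix a b c d e f x y z u v w =
    ospMatrix (-a) (-b) (-c) (-d) (-e) (-f) (-x) (-y) (-z) (-u) (-v) (-w) := by
  rw [← neg_one_smul ℂ, ospMatrix_smul]
  simp only [neg_mul, one_mul]

/-- In the ℤ-grading with `c_j^+` in degree `1` and `c_j^-` in degree `-1`, the triple bracket has
degree `1`, and that component is spanned by the two creation generators. -/
theorem superComm_triple_creation (j k l : Fin 2) : ∃ r s : ℂ,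
    superComm (cDeg j + cDeg k) (cDeg l)
      (superComm (cDeg j) (cDeg k) (cMinusMatrix j) (cPlusMatrix k)) (cPlusMatrix l) =
    r • cPlusMatrix 0 + s • cPlusMatrix 1 := by
  have h2 : (1 : ZMod 2) + 1 = 0 := by decide
  have h0 : cDeg 0 = 0 := rfl
  have h1 : cDeg 1 = 1 := rfl
  have aux : ∀ (b w : ℂ), ospMatrix 0 b 0 0 0 0 0 0 0 0 0 w =
    (b / (√2 : ℝ) : ℂ) • cPlusMatrix 0 + (w / (√2 : ℝ) : ℂ) • cPlusMatrix 1 := fun b w => by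
    have : ((√2 : ℝ) : ℂ) ≠ 0 := by simp
    rw [cPlusMatrix_zero, cPlusMatrix_one, smul_smul, smul_smul, div_mul_cancel₀ _ this,
      div_mul_cancel₀ _ this, ospMatrix_smul, ospMatrix_smul, ospMatrix_add]
    simp
  have key : ∀ X, (∃ b w, X = ospMatrix 0 b 0 0 0 0 0 0 0 0 0 w) →
      ∃ r s : ℂ, X = r • cPlusMatrix 0 + s • cPlusMatrix 1 := by
    rintro _ ⟨b, w, rfl⟩
    exact ⟨_, _, aux b w⟩
  apply key
  fin_cases j <;> fin_cases k <;> fin_cases l <;>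
    simp only [Fin.zero_eta, Fin.mk_one, cPlusMatrix_zero, cPlusMatrix_one, cMinusMatrix_zero,
      cMinusMatrix_one, h0, h1, h2, zero_add, add_zero,
      superComm_one_zero_eq_neg, even_comm_even, even_comm_odd, odd_comm_odd, ospMatrix_neg,
      ospMatrix_smul, mul_zero, mul_one, zero_mul, neg_zero, sub_zero, mul_neg, neg_neg,
      zero_sub] <;>
    exact ⟨_, _, rfl⟩

variable {W : Type*} [AddCommGroup W] [Module ℂ W]

/-- The vectors obtained from `w` by applying creation operators. -/
inductive CreationWord (f : Matrix (Fin 5) (Fin 5) ℂ →ₗ[ℂ] Module.End ℂ W) (w : W) : W → Prop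
  | vacuum : CreationWord f w w
  | create (j : Fin 2) {x : W} : CreationWord f w x → CreationWord f w (f (cPlusMatrix j) x)

/-- The span of the vectors obtained from `w` by applying creation operators. -/
def creationSpan (f : Matrix (Fin 5) (Fin 5) ℂ →ₗ[ℂ] Module.End ℂ W) (w : W) : Submodule ℂ W :=
  Submodule.span ℂ {x | CreationWord f w x}

variable {f : Matrix (Fin 5) (Fin 5) ℂ →ₗ[ℂ] Module.End ℂ W} {w : W}

theorem creationSpan_map {T : Module.End ℂ W} (h : ∀ x, CreationWord f w x → T x ∈ creationSpan f w)
    {x : W} (hx : x ∈ creationSpan f w) : T x ∈ creationSpan f w := by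
  induction hx using Submodule.span_induction with
  | mem x hx => exact h x hx
  | zero => simp
  | add x y _ _ hx hy => rw [map_add]; exact add_mem hx hy
  | smul r x _ hx => rw [map_smul]; exact Submodule.smul_mem _ _ hx

theorem cPlus_mem_creationSpan (j : Fin 2) {x : W} (hx : x ∈ creationSpan f w) :
    f (cPlusMatrix j) x ∈ creationSpan f w :=
  creationSpan_map (fun _ hx => Submodule.subset_span (hx.create j)) hx

theorem superComm_apply_mem {E : Submodule ℂ W} {i j : ZMod 2} {S T : Module.End ℂ W} {x : W}
    (h1 : S (T x) ∈ E) (h2 : T (S x) ∈ E) : superComm i j S T x ∈ E := by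
  rcases neg_one_pow_eq_or (Module.End ℂ W) (i.val * j.val) with h | h
  · simpa [superComm, h] using sub_mem h1 h2
  · simpa [superComm, h] using add_mem h1 h2

theorem apply_apply_mem_of_superComm {E : Submodule ℂ W} {i j : ZMod 2} {S T : Module.End ℂ W}
    {x : W} (h1 : superComm i j S T x ∈ E) (h2 : T (S x) ∈ E) : S (T x) ∈ E := by
  rcases neg_one_pow_eq_or (Module.End ℂ W) (i.val * j.val) with h | h
  · simpa [superComm, h] using add_mem h1 h2
  · simpa [superComm, h] using sub_mem h1 h2

/-- A lowest weight argument: an annihilation operator can be moved to the right through a creation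
word until it meets `w`, and the brackets produced on the way are moved to the right in turn by
`superComm_triple_creation`. -/
theorem creationSpan_invariant
    (hf : ∀ (i j : ZMod 2), ∀ A ∈ ospPart i, ∀ B ∈ ospPart j,
      f (superComm i j A B) = superComm i j (f A) (f B))
    (h0 : ∀ j, f (cMinusMatrix j) w = 0)
    (hB : ∀ j k, superComm (cDeg j) (cDeg k) (f (cMinusMatrix j)) (f (cPlusMatrix k)) w ∈
      creationSpan f w)
    {A : Matrix (Fin 5) (Fin 5) ℂ} (hA : A ∈ osp32) {x : W} (hx : x ∈ creationSpan f w) :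
    f A x ∈ creationSpan f w := by
  -- Annihilation operators and brackets `⟦c_j^-, c_k^+⟧` must be treated in one induction: passing
  -- `c_j^-` through `c_l^+` produces such a bracket on the shorter word.
  have main : ∀ x, CreationWord f w x → (∀ j, f (cMinusMatrix j) x ∈ creationSpan f w) ∧
      ∀ j k, superComm (cDeg j) (cDeg k) (f (cMinusMatrix j)) (f (cPlusMatrix k)) x ∈
        creationSpan f w := by
    intro x hx
    induction hx with
    | vacuum => exact ⟨fun j => by rw [h0]; exact zero_mem _, hB⟩
    | @create l y hy ih =>
      refine ⟨fun j => ?_, fun j k => ?_⟩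
      · exact apply_apply_mem_of_superComm (ih.2 j l) (cPlus_mem_creationSpan l (ih.1 j))
      · refine apply_apply_mem_of_superComm (i := cDeg j + cDeg k) (j := cDeg l) ?_
          (cPlus_mem_creationSpan l (ih.2 j k))
        have hjk := superComm_mem (cMinusMatrix_mem_ospPart j) (cPlusMatrix_mem_ospPart k)
        rw [← hf _ _ _ (cMinusMatrix_mem_ospPart j) _ (cPlusMatrix_mem_ospPart k),
          ← hf _ _ _ hjk _ (cPlusMatrix_mem_ospPart l)]
        obtain ⟨r, s, hrs⟩ := superComm_triple_creation j k l
        rw [hrs, map_add, map_smul, map_smul]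
        have hy' := Submodule.subset_span (R := ℂ) hy
        exact add_mem (Submodule.smul_mem _ _ (cPlus_mem_creationSpan 0 hy'))
          (Submodule.smul_mem _ _ (cPlus_mem_creationSpan 1 hy'))
  -- The elements preserving the span contain the generators and are closed under brackets, hence
  -- are everything.
  let S : ZMod 2 → Submodule ℂ (Matrix (Fin 5) (Fin 5) ℂ) := fun i =>
    { carrier := {A | A ∈ ospPart i ∧ ∀ x ∈ creationSpan f w, f A x ∈ creationSpan f w}
      zero_mem' := ⟨zero_mem _, fun x _ => by simp⟩
      add_mem' := fun ha hb => ⟨add_mem ha.1 hb.1, fun x hx => by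
        rw [map_add]; exact add_mem (ha.2 x hx) (hb.2 x hx)⟩
      smul_mem' := fun r a ha => ⟨Submodule.smul_mem _ _ ha.1, fun x hx => by
        rw [map_smul]; exact Submodule.smul_mem _ _ (ha.2 x hx)⟩ }
  have h2 : ((√2 : ℝ) : ℂ) ≠ 0 := by simp
  have hplus : ∀ j, cPlusMatrix j ∈ S (cDeg j) := fun j =>
    ⟨cPlusMatrix_mem_ospPart j, fun x hx => cPlus_mem_creationSpan j hx⟩
  have hminus : ∀ j, cMinusMatrix j ∈ S (cDeg j) := fun j =>
    ⟨cMinusMatrix_mem_ospPart j, fun x hx => creationSpan_map (fun y hy => (main y hy).1 j) hx⟩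
  have hS : ∀ i, ospPart i ≤ S i := by
    refine ospPart_le_of_generators S ?_ ?_ ?_ ?_ ?_
    · rw [← Submodule.smul_mem_iff _ h2, ← cPlusMatrix_zero]; exact hplus 0
    · rw [← Submodule.smul_mem_iff _ h2, ← cMinusMatrix_zero]; exact hminus 0
    · rw [← Submodule.smul_mem_iff _ h2, ← cPlusMatrix_one]; exact hplus 1
    · rw [← Submodule.smul_mem_iff _ h2, ← cMinusMatrix_one]; exact hminus 1
    · intro i j A hA B hB
      refine ⟨superComm_mem hA.1 hB.1, fun x hx => ?_⟩
      rw [hf _ _ _ hA.1 _ hB.1]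
      exact superComm_apply_mem (hA.2 _ (hB.2 _ hx)) (hB.2 _ (hA.2 _ hx))
  obtain ⟨B, hB, C, hC, rfl⟩ := ospPart_iSup hA
  rw [map_add]
  exact add_mem ((hS 0 hB).2 x hx) ((hS 1 hC).2 x hx)

end Uniqueness

/-- The values of `f` off `osp(3|2)` are arbitrary; the extension only removes membership proofs
from the bracket identities. -/
theorem IsOspRep.exists_extend {V : Type*} [AddCommGroup V] [Module ℂ V]
    {ρ : osp32 →ₗ[ℂ] Module.End ℂ V} (h : IsOspRep ρ) :
    ∃ f : Matrix (Fin 5) (Fin 5) ℂ →ₗ[ℂ] Module.End ℂ V, (∀ A : osp32, f A = ρ A) ∧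
      ∀ (i j : ZMod 2), ∀ A ∈ ospPart i, ∀ B ∈ ospPart j,
        f (superComm i j A B) = superComm i j (f A) (f B) := by
  obtain ⟨f, hf⟩ := ρ.exists_extend
  have hf' : ∀ A : osp32, f A = ρ A := fun A => by rw [← hf]; rfl
  refine ⟨f, hf', fun i j A hA B hB => ?_⟩
  have := h.bracket i j A B hA hB
  rwa [← hf', ← hf', ← hf'] at this

/-! ### Isometry of any two realizations -/

section Isometry

variable {V V' : Type*} [NormedAddCommGroup V] [InnerProductSpace ℂ V] [NormedAddCommGroup V']
  [InnerProductSpace ℂ V'] {p : ℕ} {ρ : osp32 →ₗ[ℂ] Module.End ℂ V} {vac : V}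
  {ρ' : osp32 →ₗ[ℂ] Module.End ℂ V'} {vac' : V'}

theorem superComm_prodMap (i j : ZMod 2) (S T : Module.End ℂ V) (S' T' : Module.End ℂ V') :
    superComm (R := Module.End ℂ (V × V')) i j (LinearMap.prodMap S S') (LinearMap.prodMap T T') =
      LinearMap.prodMap (superComm i j S T) (superComm i j S' T') := by
  rcases zmod_two_cases i with rfl | rfl
  · rw [superComm_zero_left, superComm_zero_left, superComm_zero_left]; ext <;> simp
  rcases zmod_two_cases j with rfl | rfl
  · rw [superComm_zero_right, superComm_zero_right, superComm_zero_right]; ext <;> simp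
  · rw [superComm_one_one, superComm_one_one, superComm_one_one]; ext <;> simp

/-- Two realizations of `V(p)` are isometrically isomorphic. -/
theorem IsParaFock.exists_equiv (h : IsParaFock p ρ vac) (h' : IsParaFock p ρ' vac') :
    ∃ Φ : V ≃ₗᵢ[ℂ] V', Φ vac = vac' ∧ ∀ A v, Φ (ρ A v) = ρ' A (Φ v) := by
  obtain ⟨f, hfρ, hf⟩ := h.rep.exists_extend
  obtain ⟨f', hfρ', hf'⟩ := h'.rep.exists_extend
  -- The diagonal action on `V × V'`. Only the linear structure of the product is used; inner
  -- products are always taken in the two factors separately.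
  let F : Matrix (Fin 5) (Fin 5) ℂ →ₗ[ℂ] Module.End ℂ (V × V') :=
    { toFun := fun A => LinearMap.prodMap (f A) (f' A)
      map_add' := fun A B => by ext <;> simp
      map_smul' := fun r A => by ext <;> simp }
  have hFapp : ∀ A z, F A z = (f A z.1, f' A z.2) := fun A z => rfl
  have hp : ∀ j, f (cPlusMatrix j) = cPlus ρ j := fun j => hfρ ⟨_, cPlusMatrix_mem j⟩
  have hm : ∀ j, f (cMinusMatrix j) = cMinus ρ j := fun j => hfρ ⟨_, cMinusMatrix_mem j⟩
  have hp' : ∀ j, f' (cPlusMatrix j) = cPlus ρ' j := fun j => hfρ' ⟨_, cPlusMatrix_mem j⟩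
  have hm' : ∀ j, f' (cMinusMatrix j) = cMinus ρ' j := fun j => hfρ' ⟨_, cMinusMatrix_mem j⟩
  set E := creationSpan F (vac, vac') with hE
  have hvac : (vac, vac') ∈ E := Submodule.subset_span .vacuum
  have hinv : ∀ A ∈ osp32, ∀ z ∈ E, F A z ∈ E := fun A hA z hz => by
    refine creationSpan_invariant (fun i j A hA B hB => ?_) (fun j => ?_) (fun j k => ?_) hA hz
    · change LinearMap.prodMap (f _) (f' _) = superComm i j (LinearMap.prodMap _ _) _
      rw [hf i j A hA B hB, hf' i j A hA B hB]
      exact (superComm_prodMap _ _ _ _ _ _).symm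
    · rw [hFapp, hm, hm', h.annihilate, h'.annihilate]; rfl
    -- The same `p` occurs for both vacua, so the bracket acts on the pair by a scalar.
    · have : superComm (cDeg j) (cDeg k) (F (cMinusMatrix j)) (F (cPlusMatrix k)) (vac, vac') =
          (if j = k then (p : ℂ) else 0) • (vac, vac') := by
        refine (congrArg (fun T : Module.End ℂ (V × V') => T (vac, vac'))
          (superComm_prodMap (cDeg j) (cDeg k) _ _ _ _)).trans ?_
        rw [LinearMap.prodMap_apply, hm, hm', hp, hp', h.vac_bracket, h'.vac_bracket]
        split_ifs <;> simp
      rw [this]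
      exact Submodule.smul_mem _ _ hvac
  have adj : ∀ j x y, ⟪x, cPlus ρ j y⟫_ℂ = ⟪cMinus ρ j x, y⟫_ℂ := fun j x y => by
    rw [← inner_conj_symm, h.adjoint, inner_conj_symm]
  have adj' : ∀ j x y, ⟪x, cPlus ρ' j y⟫_ℂ = ⟪cMinus ρ' j x, y⟫_ℂ := fun j x y => by
    rw [← inner_conj_symm, h'.adjoint, inner_conj_symm]
  -- A nonempty creation word is orthogonal to the vacuum, since the adjoint of its leftmost factor
  -- annihilates the vacuum.
  have hvacin : ∀ z ∈ E, ⟪vac, z.1⟫_ℂ = ⟪vac', z.2⟫_ℂ := by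
    intro z hz
    induction hz using Submodule.span_induction with
    | mem z hz =>
      cases hz with
      | vacuum => exact h.vac_norm.trans h'.vac_norm.symm
      | create j hx => rw [hFapp, hp, hp', adj, adj', h.annihilate, h'.annihilate]; simp
    | zero => simp
    | add x y _ _ hx hy => simp [hx, hy]
    | smul r x _ hx => simp [hx]
  -- Creation operators are moved to the other side one at a time; this stays inside `E` because `E`
  -- is invariant.
  have hword : ∀ z, CreationWord F (vac, vac') z → ∀ z' ∈ E, ⟪z.1, z'.1⟫_ℂ = ⟪z.2, z'.2⟫_ℂ := by
    intro z hz
    induction hz with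
    | vacuum => exact hvacin
    | @create j x hx ih =>
      intro z' hz'
      have := ih _ (hinv _ (cMinusMatrix_mem j) z' hz')
      rw [hFapp, hm, hm'] at this
      rw [hFapp, hp, hp', h.adjoint, h'.adjoint]
      exact this
  have hiso : ∀ z ∈ E, ∀ z' ∈ E, ⟪z.1, z'.1⟫_ℂ = ⟪z.2, z'.2⟫_ℂ := by
    intro z hz z' hz'
    induction hz using Submodule.span_induction with
    | mem z hz => exact hword z hz z' hz'
    | zero => simp
    | add x y _ _ hx hy => simp [hx, hy]
    | smul r x _ hx => simp [hx]
  let π : E →ₗ[ℂ] V := LinearMap.fst ℂ V V' ∘ₗ E.subtype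
  let π' : E →ₗ[ℂ] V' := LinearMap.snd ℂ V V' ∘ₗ E.subtype
  -- Equality of the two inner products on `E` and positive definiteness give injectivity. The image
  -- contains the vacuum and is invariant, so cyclicity gives surjectivity.
  have hπ : Function.Bijective π := by
    constructor
    · rw [← LinearMap.ker_eq_bot, LinearMap.ker_eq_bot']
      rintro ⟨⟨x, y⟩, hz⟩ (hx : x = 0)
      subst hx
      have := hiso _ hz _ hz
      simp only [inner_zero_left] at this
      have hy : y = 0 := inner_self_eq_zero.mp this.symm
      subst hy; rfl
    · rw [← LinearMap.range_eq_top]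
      refine h.generated _ ⟨⟨_, hvac⟩, rfl⟩ ?_
      rintro A _ ⟨⟨z, hz⟩, rfl⟩
      exact ⟨⟨_, hinv A A.2 z hz⟩, by rw [← hfρ]; rfl⟩
  have hπ' : Function.Bijective π' := by
    constructor
    · rw [← LinearMap.ker_eq_bot, LinearMap.ker_eq_bot']
      rintro ⟨⟨x, y⟩, hz⟩ (hy : y = 0)
      subst hy
      have := hiso _ hz _ hz
      simp only [inner_zero_left] at this
      have hx : x = 0 := inner_self_eq_zero.mp this
      subst hx; rfl
    · rw [← LinearMap.range_eq_top]
      refine h'.generated _ ⟨⟨_, hvac⟩, rfl⟩ ?_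
      rintro A _ ⟨⟨z, hz⟩, rfl⟩
      exact ⟨⟨_, hinv A A.2 z hz⟩, by rw [← hfρ']; rfl⟩
  let e := LinearEquiv.ofBijective π hπ
  let e' := LinearEquiv.ofBijective π' hπ'
  have hΦ : ∀ z (hz : z ∈ E), (e.symm ≪≫ₗ e') z.1 = z.2 := fun z hz => by
    have : e.symm z.1 = ⟨z, hz⟩ := by rw [LinearEquiv.symm_apply_eq]; rfl
    rw [LinearEquiv.trans_apply, this]; rfl
  have hmem : ∀ v, (v, (e.symm ≪≫ₗ e') v) ∈ E := fun v => by
    have h1 : (e.symm v : V × V').1 = v := e.apply_symm_apply v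
    have : (v, (e.symm ≪≫ₗ e') v) = (e.symm v : V × V') := Prod.ext h1.symm rfl
    rw [this]; exact (e.symm v).2
  refine ⟨(e.symm ≪≫ₗ e').isometryOfInner fun x y => (hiso _ (hmem x) _ (hmem y)).symm,
    hΦ _ hvac, fun A v => ?_⟩
  have := hΦ _ (hinv A A.2 _ (hmem v))
  rw [hFapp, hfρ, hfρ'] at this
  exact this

theorem ket_map {e : Module.Basis (Pattern p) ℂ V} (Φ : V ≃ₗ[ℂ] V') (a b c : ℤ) :
    ket (e.map Φ) a b c = Φ (ket e a b c) := by
  unfold ket; split_ifs <;> simp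

theorem IsKetBasis.map {e : Module.Basis (Pattern p) ℂ V} (he : IsKetBasis p ρ vac e)
    (Φ : V ≃ₗᵢ[ℂ] V') (hvac : Φ vac = vac') (hΦ : ∀ A v, Φ (ρ A v) = ρ' A (Φ v)) :
    IsKetBasis p ρ' vac' (e.map Φ.toLinearEquiv) := by
  have hp : ∀ j v, cPlus ρ' j (Φ v) = Φ (cPlus ρ j v) := fun j v => (hΦ _ _).symm
  have hm : ∀ j v, cMinus ρ' j (Φ v) = Φ (cMinus ρ j v) := fun j v => (hΦ _ _).symm
  have hh : ∀ j v, hOp ρ' j (Φ v) = Φ (hOp ρ j v) := fun j v => (hΦ _ _).symm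
  constructor
  · have := he.orthonormal.comp_linearIsometryEquiv Φ
    convert this using 1
    ext μ; simp
  · rw [ket_map, he.vacuum]; exact hvac
  all_goals
    intro μ
    simp only [Module.Basis.map_apply, ket_map, LinearIsometryEquiv.coe_toLinearEquiv, hp, hm, hh]
  · rw [he.h₁, map_smul]
  · rw [he.h₂, map_smul]
  · rw [he.c₁_plus, map_sub, map_smul, map_smul]
  · rw [he.c₂_plus, map_add, map_smul, map_smul]
  · rw [he.c₁_minus, map_sub, map_smul, map_smul]
  · rw [he.c₂_minus, map_add, map_smul, map_smul]

end Isometry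

/-! ### The explicit model -/

section Coefficients

variable (p : ℕ)

/-- A square root of `k (p - k)`. -/
noncomputable def gCoeff (k : ℤ) : ℂ :=
  if k ≤ p then ((√(k * (p - k)) : ℝ) : ℂ) else Complex.I * ((√(k * (k - p)) : ℝ) : ℂ)

/-- A square root of `2 j (p + 2 j)`. -/
noncomputable def yCoeff (j : ℤ) : ℂ := ((√(2 * j * (p + 2 * j)) : ℝ) : ℂ)

variable {p}

theorem gCoeff_of_le {k : ℤ} (h : k ≤ p) : gCoeff p k = ((√(k * (p - k)) : ℝ) : ℂ) := if_pos h

@[simp] theorem gCoeff_zero : gCoeff p 0 = 0 := by simp [gCoeff]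

@[simp] theorem gCoeff_self : gCoeff p p = 0 := by simp [gCoeff]

@[simp] theorem yCoeff_zero : yCoeff p 0 = 0 := by simp [yCoeff]

/-- The imaginary branch in the definition makes this hold also beyond `p`. The vectors concerned
vanish there, but a uniform identity allows the relations to be checked without assuming `k ≤ p`. -/
theorem gCoeff_sq {k : ℤ} (hk : 0 ≤ k) : gCoeff p k ^ 2 = k * (p - k) := by
  have hk' : (0 : ℝ) ≤ k := by exact_mod_cast hk
  unfold gCoeff
  split_ifs with h
  · have h' : (k : ℝ) ≤ p := by exact_mod_cast h
    rw [← Complex.ofReal_pow, Real.sq_sqrt (mul_nonneg hk' (by linarith))]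
    push_cast; ring
  · have h' : (p : ℝ) ≤ k := by exact_mod_cast (not_le.mp h).le
    rw [mul_pow, ← Complex.ofReal_pow, Real.sq_sqrt (mul_nonneg hk' (by linarith)), Complex.I_sq]
    push_cast; ring

theorem yCoeff_sq {j : ℤ} (hj : 0 ≤ j) : yCoeff p j ^ 2 = 2 * j * (p + 2 * j) := by
  have hj' : (0 : ℝ) ≤ j := by exact_mod_cast hj
  rw [yCoeff, ← Complex.ofReal_pow, Real.sq_sqrt (by positivity)]
  push_cast; ring

/-- Once the parity of the second label is fixed, the parity indicators are constants, and `G₁`,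
`G₂` factor into `gCoeff` or `yCoeff` and roots of `k + 2j + i`. -/
theorem G₁_even {k j : ℤ} (hkp : k ≤ p) (h : 1 ≤ k + 2 * j) :
    (G₁ p k (2 * j) : ℂ) =
      ((√(k + 2 * j + 1) : ℝ) : ℂ) / ((√(k + 2 * j) : ℝ) : ℂ) * gCoeff p k := by
  have hs : (1 : ℝ) ≤ k + 2 * j := by exact_mod_cast h
  have ho : oddInd (2 * j + 1) = 1 := if_pos (by simp)
  rw [G₁, if_neg (by omega), ho, gCoeff_of_le hkp, ← Complex.ofReal_div, ← Complex.ofReal_mul,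
    ← Real.sqrt_div (by linarith), ← Real.sqrt_mul (by apply div_nonneg <;> linarith)]
  congr 2
  push_cast
  rw [add_sub_cancel_right]
  ring

theorem G₁_odd {k j : ℤ} (hk : 0 ≤ k) (hkp : k ≤ p) (hj : 0 ≤ j) :
    (G₁ p k (2 * j + 1) : ℂ) = gCoeff p k := by
  have hk' : (0 : ℝ) ≤ k := by exact_mod_cast hk
  have hj' : (0 : ℝ) ≤ j := by exact_mod_cast hj
  have ho : oddInd (2 * j + 1 + 1) = 0 := if_neg (by
    rw [Int.not_odd_iff_even, show 2 * j + 1 + 1 = 2 * (j + 1) by ring]; simp)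
  rw [G₁, if_neg (by omega), ho, gCoeff_of_le hkp]
  congr 2
  push_cast
  have : (k : ℝ) + (2 * j + 1) + 1 ≠ 0 := by positivity
  rw [sub_zero]
  field_simp

theorem G₂_even {k j : ℤ} : (G₂ p k (2 * j) : ℂ) = ((√(k + 2 * j + 1) : ℝ) : ℂ) := by
  have ho : oddInd (2 * j + 1) = 1 := if_pos (by simp)
  have ho' : oddInd (2 * j) = 0 := if_neg (by simp)
  have he : evenInd (2 * j + 1) = 0 := if_neg (by simp)
  rw [G₂, ho, ho', he]
  simp

/-- The value `j = -1` is included: `G₂(k, -1) = 0` since `yCoeff p 0 = 0`, as needed for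
annihilation from `μ₂₂ = 0`. -/
theorem G₂_odd {k j : ℤ} (hj : -1 ≤ j) : (G₂ p k (2 * j + 1) : ℂ) =
    yCoeff p (j + 1) / ((√(k + 2 * j + 1) : ℝ) : ℂ) := by
  have ev : Even (2 * j + 1 + 1) := by
    rw [show 2 * j + 1 + 1 = 2 * (j + 1) by ring]; simp
  have ho : oddInd (2 * j + 1 + 1) = 0 := if_neg (by rwa [Int.not_odd_iff_even])
  have ho' : oddInd (2 * j + 1) = 1 := if_pos (by simp)
  have he : evenInd (2 * j + 1 + 1) = 1 := if_pos ev
  rw [G₂, ho, ho', he, yCoeff, ← Complex.ofReal_div]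
  congr 1
  have h1 : ((1 * ((2 * j + 1 : ℤ) : ℝ) + 1) * (1 * (p + ((2 * j + 1 : ℤ) : ℝ)) + 1) *
      (0 * (k + ((2 * j + 1 : ℤ) : ℝ)) + 1)) = 2 * ((j + 1 : ℤ) : ℝ) * (p + 2 * ((j + 1 : ℤ) : ℝ)) := by
    push_cast; ring
  have h2 : (1 * ((k : ℝ) + ((2 * j + 1 : ℤ) : ℝ) - 1) + 1) = k + 2 * j + 1 := by push_cast; ring
  rw [h1, h2]
  have h3 : (0 : ℝ) ≤ ((j + 1 : ℤ) : ℝ) := by exact_mod_cast (by omega : 0 ≤ j + 1)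
  exact Real.sqrt_div (by positivity) _

end Coefficients

/-- There are inner product spaces with an orthonormal algebraic basis of any cardinality. -/
theorem exists_orthonormal_basis (ι : Type) : ∃ (V : Type) (_ : NormedAddCommGroup V)
    (_ : InnerProductSpace ℂ V) (e : Module.Basis ι ℂ V), Orthonormal ℂ e := by
  classical
  let b : HilbertBasis ι ℂ (lp (fun _ : ι => ℂ) 2) := ⟨LinearIsometryEquiv.refl ℂ _⟩
  have hb := b.orthonormal
  refine ⟨Submodule.span ℂ (Set.range b), inferInstance, inferInstance,
    Module.Basis.span hb.linearIndependent, ?_⟩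
  have he : ∀ i, ((Module.Basis.span hb.linearIndependent i : Submodule.span ℂ (Set.range b)) :
      lp (fun _ : ι => ℂ) 2) = b i := fun i =>
    congrArg Subtype.val (Module.Basis.span_apply hb.linearIndependent i)
  refine ⟨fun i => ?_, fun i j hij => ?_⟩
  · rw [Submodule.coe_norm, he]; exact hb.1 i
  · change ⟪_, _⟫_ℂ = 0
    rw [Submodule.coe_inner, he, he]; exact hb.2 hij

/-! ### Model operators on rescaled kets -/

section Model

variable {p : ℕ} {V : Type*} [AddCommGroup V] [Module ℂ V] (e : Module.Basis (Pattern p) ℂ V)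

/-- The operator `c₁^+` of the model. -/
noncomputable def modelCre₁ : Module.End ℂ V := e.constr ℂ fun μ =>
    (((((μ.μ₁₂ + μ.μ₂₂) / (μ.μ₁₂ + μ.μ₂₂ + 1) : ℝ) ^ (μ.θ / 2 : ℝ) *
        G₁ p μ.μ₁₂ μ.μ₂₂ : ℝ)) : ℂ) • ket e (μ.μ₁₂ + 1) μ.μ₂₂ (μ.μ₁₁ + 1)
    - ((μ.θ * √(1 / (μ.μ₁₂ + μ.μ₂₂ + 1)) * G₂ p μ.μ₁₂ μ.μ₂₂ : ℝ) : ℂ) •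
        ket e μ.μ₁₂ (μ.μ₂₂ + 1) (μ.μ₁₁ + 1)

/-- The operator `c₂^+` of the model. -/
noncomputable def modelCre₂ : Module.End ℂ V := e.constr ℂ fun μ =>
    (((1 - μ.θ) * √(1 / (μ.μ₁₂ + μ.μ₂₂ + 1)) * G₁ p μ.μ₁₂ μ.μ₂₂ : ℝ) : ℂ) •
        ket e (μ.μ₁₂ + 1) μ.μ₂₂ μ.μ₁₁
    + (((-1) ^ μ.θ * √((μ.μ₁₂ + μ.μ₂₂) / (μ.μ₁₁ + μ.μ₂₂ + 1)) *
        G₂ p μ.μ₁₂ μ.μ₂₂ : ℝ) : ℂ) • ket e μ.μ₁₂ (μ.μ₂₂ + 1) μ.μ₁₁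

/-- The operator `c₁^-` of the model. -/
noncomputable def modelAnn₁ : Module.End ℂ V := e.constr ℂ fun μ =>
    (((((μ.μ₁₂ + μ.μ₂₂ - 1) / (μ.μ₁₂ + μ.μ₂₂) : ℝ) ^ (μ.θ / 2 : ℝ) *
        G₁ p (μ.μ₁₂ - 1) μ.μ₂₂ : ℝ)) : ℂ) • ket e (μ.μ₁₂ - 1) μ.μ₂₂ (μ.μ₁₁ - 1)
    - (((1 - μ.θ) * √(1 / (μ.μ₁₂ + μ.μ₂₂)) * G₂ p μ.μ₁₂ (μ.μ₂₂ - 1) : ℝ) : ℂ) •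
        ket e μ.μ₁₂ (μ.μ₂₂ - 1) (μ.μ₁₁ - 1)

/-- The operator `c₂^-` of the model. -/
noncomputable def modelAnn₂ : Module.End ℂ V := e.constr ℂ fun μ =>
    ((μ.θ * √(1 / (μ.μ₁₂ + μ.μ₂₂)) * G₁ p (μ.μ₁₂ - 1) μ.μ₂₂ : ℝ) : ℂ) •
        ket e (μ.μ₁₂ - 1) μ.μ₂₂ μ.μ₁₁
    + (((-1) ^ μ.θ * √((μ.μ₁₂ + μ.μ₂₂ - 1) / (μ.μ₁₁ + μ.μ₂₂)) *
        G₂ p μ.μ₁₂ (μ.μ₂₂ - 1) : ℝ) : ℂ) • ket e μ.μ₁₂ (μ.μ₂₂ - 1) μ.μ₁₁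

/-- The operator `h₁` of the model. -/
noncomputable def modelH₁ : Module.End ℂ V := e.constr ℂ fun μ =>
  (-p / 2 + μ.μ₁₁ : ℂ) • e μ

/-- The operator `h₂` of the model. -/
noncomputable def modelH₂ : Module.End ℂ V := e.constr ℂ fun μ =>
  (p / 2 + μ.μ₁₂ + μ.μ₂₂ - μ.μ₁₁ : ℂ) • e μ

/-- The parity of the number of parabosons. -/
noncomputable def modelParity : Module.End ℂ V := e.constr ℂ fun μ =>
  ((-1) ^ (μ.μ₁₂ + μ.μ₂₂ - μ.μ₁₁) : ℂ) • e μ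

/-- The vacuum of the model. -/
noncomputable def modelVac : V := ket e 0 0 0

/-- The rescaled vectors with `μ₂₂` even and `θ = 0`. -/
noncomputable def vecA (k j : ℤ) : V := ((√(k + 2 * j) : ℝ) : ℂ) • ket e k (2 * j) k

/-- The rescaled vectors with `μ₂₂` odd and `θ = 0`. -/
noncomputable def vecB (k j : ℤ) : V := ket e k (2 * j + 1) k

/-- The rescaled vectors with `μ₂₂` even and `θ = 1`. -/
noncomputable def vecC (k j : ℤ) : V := ket e k (2 * j) (k - 1)

/-- The rescaled vectors with `μ₂₂` odd and `θ = 1`. -/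
noncomputable def vecD (k j : ℤ) : V :=
  (((√(k + 2 * j + 1) : ℝ) : ℂ))⁻¹ • ket e k (2 * j + 1) (k - 1)

variable {e}

theorem ket_of {a b c : ℤ} (h : IsPattern p a b c) : ket e a b c = e ⟨a, b, c, h⟩ := dif_pos h

theorem ket_of_not {a b c : ℤ} (h : ¬ IsPattern p a b c) : ket e a b c = 0 := dif_neg h

/-- The label `(0, 0; 0)` is admissible, but its scaling factor is `√0`. The vacuum is thus not
among the rescaled vectors and is always treated separately. -/
theorem vecA_eq_zero {k j : ℤ} (h : k ≤ 0 ∨ (p : ℤ) < k ∨ j < 0) : vecA e k j = 0 := by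
  by_cases hk : k = 0 ∧ j = 0
  · simp [vecA, hk.1, hk.2]
  · rw [vecA, ket_of_not, smul_zero]
    rintro ⟨h1, h2, h3, h4, h5, h6⟩
    omega

theorem vecB_eq_zero {k j : ℤ} (h : k ≤ 0 ∨ (p : ℤ) < k ∨ j < 0) : vecB e k j = 0 := by
  rw [vecB, ket_of_not]
  rintro ⟨h1, h2, h3, h4, h5, h6⟩
  omega

theorem vecC_eq_zero {k j : ℤ} (h : k ≤ 0 ∨ (p : ℤ) < k ∨ j < 0) : vecC e k j = 0 := by
  rw [vecC, ket_of_not]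
  rintro ⟨h1, h2, h3, h4, h5, h6⟩
  omega

theorem vecD_eq_zero {k j : ℤ} (h : k ≤ 0 ∨ (p : ℤ) < k ∨ j < 0) : vecD e k j = 0 := by
  rw [vecD, ket_of_not, smul_zero]
  rintro ⟨h1, h2, h3, h4, h5, h6⟩
  omega

theorem isPattern_A {k j : ℤ} (hk : 1 ≤ k) (hkp : k ≤ p) (hj : 0 ≤ j) :
    IsPattern p k (2 * j) k := by constructor <;> omega

theorem isPattern_B {k j : ℤ} (hk : 1 ≤ k) (hkp : k ≤ p) (hj : 0 ≤ j) :
    IsPattern p k (2 * j + 1) k := by constructor <;> omega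

theorem isPattern_C {k j : ℤ} (hk : 1 ≤ k) (hkp : k ≤ p) (hj : 0 ≤ j) :
    IsPattern p k (2 * j) (k - 1) := by constructor <;> omega

theorem isPattern_D {k j : ℤ} (hk : 1 ≤ k) (hkp : k ≤ p) (hj : 0 ≤ j) :
    IsPattern p k (2 * j + 1) (k - 1) := by constructor <;> omega

theorem isPattern_zero : IsPattern p 0 0 0 := by constructor <;> omega

section Sqrt

theorem ofReal_sqrt_sq {x : ℝ} (hx : 0 ≤ x) : ((√x : ℝ) : ℂ) ^ 2 = x := by
  rw [← Complex.ofReal_pow, Real.sq_sqrt hx]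

theorem ofReal_sqrt_ne {x : ℝ} (hx : 0 < x) : ((√x : ℝ) : ℂ) ≠ 0 := by
  exact_mod_cast (Real.sqrt_pos.mpr hx).ne'

/-- Normal forms `k + 2j + i` of the radicands, so that equal roots become syntactically equal. -/
theorem radical_arguments (k j : ℝ) :
    k + (2 * j + 1) = k + 2 * j + 1 ∧ k + (2 * j + 1) + 1 = k + 2 * j + 2 ∧
    k + 2 * j + 1 + 1 = k + 2 * j + 2 ∧
    k + 2 * (j + 1) = k + 2 * j + 2 ∧ k + 1 + 2 * j = k + 2 * j + 1 ∧
    k + 1 + 2 * j + 1 = k + 2 * j + 2 ∧ k - 1 + 2 * j + 1 = k + 2 * j ∧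
    k - 1 + 2 * j = k + 2 * j - 1 ∧ k - 1 + (2 * j + 1) + 1 = k + 2 * j + 1 ∧
    k - 1 + (2 * j + 1) = k + 2 * j ∧ k + 2 * (j - 1) + 1 = k + 2 * j - 1 ∧
    k + (2 * (j - 1) + 1) = k + 2 * j - 1 ∧ k + (2 * j + 1) - 1 = k + 2 * j := by
  refine ⟨?_, ?_, ?_, ?_, ?_, ?_, ?_, ?_, ?_, ?_, ?_, ?_, ?_⟩ <;> ring

end Sqrt

/-! The action of the creation operators on the rescaled vectors. -/

theorem add_smul_eq_sub_smul {a b a' b' : ℂ} {x y : V} (h : a = a') (h' : b = -b') :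
    a • x + b • y = a' • x - b' • y := by
  rw [h, h', neg_smul, sub_eq_add_neg]

/-- In the first three cases the vectors being acted on vanish. Including `k = 0`, `k > p` and `j =
-1` allows the formulas for the operators to be iterated without case distinctions. -/
theorem boundary_cases {k j : ℤ} (hk : 0 ≤ k) (hj : -1 ≤ j) :
    k = 0 ∨ (p : ℤ) < k ∨ j = -1 ∨ (1 ≤ k ∧ k ≤ p ∧ 0 ≤ j) := by omega

/-- The radicals in `G₁_even` are exactly the ratio of the scalings of source and target, so only
`gCoeff` survives. The other formulas arise in the same manner: boundary labels are dealt with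
first, then the radicals are split into roots of `k + 2j + i` and cancelled. -/
theorem modelCre₁_vecA {k j : ℤ} (hk : 0 ≤ k) (hj : -1 ≤ j) :
    modelCre₁ e (vecA e k j) = gCoeff p k • vecA e (k + 1) j := by
  rcases boundary_cases (p := p) hk hj with rfl | h | rfl | ⟨h1, h2, h3⟩
  · simp [vecA_eq_zero]
  · simp (disch := omega) [vecA_eq_zero]
  · simp [vecA_eq_zero]
  have hkR : (1 : ℝ) ≤ k := by exact_mod_cast h1
  have hjR : (0 : ℝ) ≤ j := by exact_mod_cast h3
  have e0 := ofReal_sqrt_ne (by linarith : (0 : ℝ) < k + 2 * j)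
  have s0 := ofReal_sqrt_sq (by linarith : (0 : ℝ) ≤ k + 2 * j)
  have e1 := ofReal_sqrt_ne (by linarith : (0 : ℝ) < k + 2 * j + 1)
  have s1 := ofReal_sqrt_sq (by linarith : (0 : ℝ) ≤ k + 2 * j + 1)
  push_cast at s0 s1
  simp only [vecA]
  rw [map_smul, ket_of (isPattern_A h1 h2 h3), modelCre₁, Module.Basis.constr_basis]
  simp only [Pattern.θ, sub_self, sub_sub_cancel, sub_add_cancel, add_sub_cancel_right,
    Int.cast_zero,
    Int.cast_one, zero_div, Real.rpow_zero, zpow_zero, zpow_one, ← Real.sqrt_eq_rpow, one_mul,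
      zero_mul,
    sub_zero, Complex.ofReal_zero, zero_smul, zero_add, smul_sub, smul_add, smul_smul,
    Complex.ofReal_mul]
  simp only [G₁_even h2 (show 1 ≤ k + 2 * j by omega), smul_smul, sub_add_cancel,
    add_sub_cancel_right]
  push_cast
  simp only [radical_arguments (k : ℝ) (j : ℝ), one_div, Real.sqrt_inv, sub_add_cancel,
    add_sub_cancel_right, Real.sqrt_div' _ (by linarith : (0 : ℝ) ≤ k + 2 * j),
      Real.sqrt_div' _ (by linarith : (0 : ℝ) ≤ k + 2 * j + 1),
    Complex.ofReal_inv, Complex.ofReal_div]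
  congr 1
  field_simp

theorem modelCre₁_vecB {k j : ℤ} (hk : 0 ≤ k) (hj : -1 ≤ j) :
    modelCre₁ e (vecB e k j) = gCoeff p k • vecB e (k + 1) j := by
  rcases boundary_cases (p := p) hk hj with rfl | h | rfl | ⟨h1, h2, h3⟩
  · simp [vecB_eq_zero]
  · simp (disch := omega) [vecB_eq_zero]
  · simp [vecB_eq_zero]
  simp only [vecB]
  rw [ket_of (isPattern_B h1 h2 h3), modelCre₁, Module.Basis.constr_basis]
  simp only [Pattern.θ, sub_self, sub_sub_cancel, sub_add_cancel, add_sub_cancel_right,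
    Int.cast_zero,
    Int.cast_one, zero_div, Real.rpow_zero, zpow_zero, zpow_one, ← Real.sqrt_eq_rpow, one_mul,
      zero_mul,
    sub_zero, Complex.ofReal_zero, zero_smul, zero_add, smul_sub, smul_add, smul_smul,
    Complex.ofReal_mul]
  simp only [G₁_odd (by omega) h2 h3, smul_smul, sub_add_cancel, add_sub_cancel_right]

theorem modelCre₁_vecC {k j : ℤ} (hk : 0 ≤ k) (hj : -1 ≤ j) :
    modelCre₁ e (vecC e k j) = gCoeff p k • vecC e (k + 1) j - vecB e k j := by
  rcases boundary_cases (p := p) hk hj with rfl | h | rfl | ⟨h1, h2, h3⟩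
  · simp [vecC_eq_zero, vecB_eq_zero]
  · simp (disch := omega) [vecC_eq_zero, vecB_eq_zero]
  · simp [vecC_eq_zero, vecB_eq_zero]
  have hkR : (1 : ℝ) ≤ k := by exact_mod_cast h1
  have hjR : (0 : ℝ) ≤ j := by exact_mod_cast h3
  have e0 := ofReal_sqrt_ne (by linarith : (0 : ℝ) < k + 2 * j)
  have s0 := ofReal_sqrt_sq (by linarith : (0 : ℝ) ≤ k + 2 * j)
  have e1 := ofReal_sqrt_ne (by linarith : (0 : ℝ) < k + 2 * j + 1)
  have s1 := ofReal_sqrt_sq (by linarith : (0 : ℝ) ≤ k + 2 * j + 1)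
  push_cast at s0 s1
  simp only [vecC, vecB]
  rw [ket_of (isPattern_C h1 h2 h3), modelCre₁, Module.Basis.constr_basis]
  simp only [Pattern.θ, sub_self, sub_sub_cancel, sub_add_cancel, add_sub_cancel_right,
    Int.cast_zero,
    Int.cast_one, zero_div, Real.rpow_zero, zpow_zero, zpow_one, ← Real.sqrt_eq_rpow, one_mul,
      zero_mul,
    sub_zero, Complex.ofReal_zero, zero_smul, zero_add, smul_sub, smul_add, smul_smul,
    Complex.ofReal_mul]
  simp only [G₁_even h2 (show 1 ≤ k + 2 * j by omega), G₂_even, smul_smul, sub_add_cancel,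
    add_sub_cancel_right]
  push_cast
  simp only [radical_arguments (k : ℝ) (j : ℝ), one_div, Real.sqrt_inv, sub_add_cancel,
    add_sub_cancel_right, Real.sqrt_div' _ (by linarith : (0 : ℝ) ≤ k + 2 * j),
      Real.sqrt_div' _ (by linarith : (0 : ℝ) ≤ k + 2 * j + 1),
    Complex.ofReal_inv, Complex.ofReal_div]
  congr 1
  · congr 1
    field_simp
  -- The coefficient is `√(1 / (k + 2j + 1))` times `G₂ = √(k + 2j + 1)`.
  · convert one_smul ℂ _ using 2
    field_simp

theorem modelCre₁_vecD {k j : ℤ} (hk : 0 ≤ k) (hj : -1 ≤ j) :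
    modelCre₁ e (vecD e k j) = gCoeff p k • vecD e (k + 1) j -
      (yCoeff p (j + 1) / (k + 2 * j + 1) / (k + 2 * j + 2)) • vecA e k (j + 1) := by
  rcases boundary_cases (p := p) hk hj with rfl | h | rfl | ⟨h1, h2, h3⟩
  · simp [vecD_eq_zero, vecA_eq_zero]
  · simp (disch := omega) [vecD_eq_zero, vecA_eq_zero]
  · simp [vecD_eq_zero, vecA_eq_zero]
  have hkR : (1 : ℝ) ≤ k := by exact_mod_cast h1
  have hjR : (0 : ℝ) ≤ j := by exact_mod_cast h3
  have e1 := ofReal_sqrt_ne (by linarith : (0 : ℝ) < k + 2 * j + 1)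
  have s1 := ofReal_sqrt_sq (by linarith : (0 : ℝ) ≤ k + 2 * j + 1)
  have e2 := ofReal_sqrt_ne (by linarith : (0 : ℝ) < k + 2 * j + 2)
  have s2 := ofReal_sqrt_sq (by linarith : (0 : ℝ) ≤ k + 2 * j + 2)
  push_cast at s1 s2
  simp only [vecD, vecA]
  rw [map_smul, ket_of (isPattern_D h1 h2 h3), modelCre₁, Module.Basis.constr_basis]
  simp only [Pattern.θ, sub_self, sub_sub_cancel, sub_add_cancel, add_sub_cancel_right,
    Int.cast_zero,
    Int.cast_one, zero_div, Real.rpow_zero, zpow_zero, zpow_one, ← Real.sqrt_eq_rpow, one_mul,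
      zero_mul,
    sub_zero, Complex.ofReal_zero, zero_smul, zero_add, smul_sub, smul_add, smul_smul,
    Complex.ofReal_mul]
  rw [show 2 * j + 1 + 1 = 2 * (j + 1) by ring]
  simp only [G₁_odd (by omega) h2 h3, G₂_odd hj, smul_smul, sub_add_cancel, add_sub_cancel_right]
  push_cast
  simp only [radical_arguments (k : ℝ) (j : ℝ), one_div, Real.sqrt_inv, sub_add_cancel,
    add_sub_cancel_right, Real.sqrt_div' _ (by linarith : (0 : ℝ) ≤ k + 2 * j + 1),
      Real.sqrt_div' _ (by linarith : (0 : ℝ) ≤ k + 2 * j + 2),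
    Complex.ofReal_inv, Complex.ofReal_div]
  rw [← s1, ← s2]
  congr 2
  · field_simp
  · field_simp

theorem modelCre₂_vecA {k j : ℤ} (hk : 0 ≤ k) (hj : -1 ≤ j) :
    modelCre₂ e (vecA e k j) = gCoeff p k • vecC e (k + 1) j + (k + 2 * j : ℂ) • vecB e k j := by
  rcases boundary_cases (p := p) hk hj with rfl | h | rfl | ⟨h1, h2, h3⟩
  · simp [vecA_eq_zero, vecC_eq_zero, vecB_eq_zero]
  · simp (disch := omega) [vecA_eq_zero, vecC_eq_zero, vecB_eq_zero]
  · simp [vecA_eq_zero, vecC_eq_zero, vecB_eq_zero]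
  have hkR : (1 : ℝ) ≤ k := by exact_mod_cast h1
  have hjR : (0 : ℝ) ≤ j := by exact_mod_cast h3
  have e0 := ofReal_sqrt_ne (by linarith : (0 : ℝ) < k + 2 * j)
  have s0 := ofReal_sqrt_sq (by linarith : (0 : ℝ) ≤ k + 2 * j)
  have e1 := ofReal_sqrt_ne (by linarith : (0 : ℝ) < k + 2 * j + 1)
  have s1 := ofReal_sqrt_sq (by linarith : (0 : ℝ) ≤ k + 2 * j + 1)
  push_cast at s0 s1
  simp only [vecA, vecC, vecB]
  rw [map_smul, ket_of (isPattern_A h1 h2 h3), modelCre₂, Module.Basis.constr_basis]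
  simp only [Pattern.θ, sub_self, sub_sub_cancel, sub_add_cancel, add_sub_cancel_right,
    Int.cast_zero,
    Int.cast_one, zero_div, Real.rpow_zero, zpow_zero, zpow_one, ← Real.sqrt_eq_rpow, one_mul,
      zero_mul,
    sub_zero, Complex.ofReal_zero, zero_smul, zero_add, smul_sub, smul_add, smul_smul,
    Complex.ofReal_mul]
  simp only [G₁_even h2 (show 1 ≤ k + 2 * j by omega), G₂_even, smul_smul, sub_add_cancel,
    add_sub_cancel_right]
  push_cast
  simp only [radical_arguments (k : ℝ) (j : ℝ), one_div, Real.sqrt_inv, sub_add_cancel,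
    add_sub_cancel_right, Real.sqrt_div' _ (by linarith : (0 : ℝ) ≤ k + 2 * j),
      Real.sqrt_div' _ (by linarith : (0 : ℝ) ≤ k + 2 * j + 1),
    Complex.ofReal_inv, Complex.ofReal_div]
  rw [← s0]
  congr 2
  · field_simp
  · field_simp

theorem modelCre₂_vecB {k j : ℤ} (hk : 0 ≤ k) (hj : -1 ≤ j) :
    modelCre₂ e (vecB e k j) = gCoeff p k • vecD e (k + 1) j + (yCoeff p (j + 1) / (k + 2 * j + 2)) • vecA e k (j + 1) := by
  rcases boundary_cases (p := p) hk hj with rfl | h | rfl | ⟨h1, h2, h3⟩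
  · simp [vecB_eq_zero, vecD_eq_zero, vecA_eq_zero]
  · simp (disch := omega) [vecB_eq_zero, vecD_eq_zero, vecA_eq_zero]
  · simp [vecB_eq_zero, vecD_eq_zero, vecA_eq_zero]
  have hkR : (1 : ℝ) ≤ k := by exact_mod_cast h1
  have hjR : (0 : ℝ) ≤ j := by exact_mod_cast h3
  have e1 := ofReal_sqrt_ne (by linarith : (0 : ℝ) < k + 2 * j + 1)
  have s1 := ofReal_sqrt_sq (by linarith : (0 : ℝ) ≤ k + 2 * j + 1)
  have e2 := ofReal_sqrt_ne (by linarith : (0 : ℝ) < k + 2 * j + 2)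
  have s2 := ofReal_sqrt_sq (by linarith : (0 : ℝ) ≤ k + 2 * j + 2)
  push_cast at s1 s2
  simp only [vecB, vecD, vecA]
  rw [ket_of (isPattern_B h1 h2 h3), modelCre₂, Module.Basis.constr_basis]
  simp only [Pattern.θ, sub_self, sub_sub_cancel, sub_add_cancel, add_sub_cancel_right,
    Int.cast_zero,
    Int.cast_one, zero_div, Real.rpow_zero, zpow_zero, zpow_one, ← Real.sqrt_eq_rpow, one_mul,
      zero_mul,
    sub_zero, Complex.ofReal_zero, zero_smul, zero_add, smul_sub, smul_add, smul_smul,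
    Complex.ofReal_mul]
  rw [show 2 * j + 1 + 1 = 2 * (j + 1) by ring]
  simp only [G₁_odd (by omega) h2 h3, G₂_odd hj, smul_smul, sub_add_cancel, add_sub_cancel_right]
  push_cast
  simp only [radical_arguments (k : ℝ) (j : ℝ), one_div, Real.sqrt_inv, sub_add_cancel,
    add_sub_cancel_right, Real.sqrt_div' _ (by linarith : (0 : ℝ) ≤ k + 2 * j + 1),
      Real.sqrt_div' _ (by linarith : (0 : ℝ) ≤ k + 2 * j + 2),
    Complex.ofReal_inv, Complex.ofReal_div]
  rw [← s2]
  congr 2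
  · field_simp
  · field_simp

theorem modelCre₂_vecC {k j : ℤ} (hk : 0 ≤ k) (hj : -1 ≤ j) :
    modelCre₂ e (vecC e k j) = -(k + 2 * j + 1 : ℂ) • vecD e k j := by
  rcases boundary_cases (p := p) hk hj with rfl | h | rfl | ⟨h1, h2, h3⟩
  · simp [vecC_eq_zero, vecD_eq_zero]
  · simp (disch := omega) [vecC_eq_zero, vecD_eq_zero]
  · simp [vecC_eq_zero, vecD_eq_zero]
  have hkR : (1 : ℝ) ≤ k := by exact_mod_cast h1
  have hjR : (0 : ℝ) ≤ j := by exact_mod_cast h3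
  have e0 := ofReal_sqrt_ne (by linarith : (0 : ℝ) < k + 2 * j)
  have s0 := ofReal_sqrt_sq (by linarith : (0 : ℝ) ≤ k + 2 * j)
  have e1 := ofReal_sqrt_ne (by linarith : (0 : ℝ) < k + 2 * j + 1)
  have s1 := ofReal_sqrt_sq (by linarith : (0 : ℝ) ≤ k + 2 * j + 1)
  push_cast at s0 s1
  simp only [vecC, vecD]
  rw [ket_of (isPattern_C h1 h2 h3), modelCre₂, Module.Basis.constr_basis]
  simp only [Pattern.θ, sub_self, sub_sub_cancel, sub_add_cancel, add_sub_cancel_right,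
    Int.cast_zero,
    Int.cast_one, zero_div, Real.rpow_zero, zpow_zero, zpow_one, ← Real.sqrt_eq_rpow, one_mul,
      zero_mul,
    sub_zero, Complex.ofReal_zero, zero_smul, zero_add, smul_sub, smul_add, smul_smul,
    Complex.ofReal_mul]
  simp only [G₂_even, smul_smul, sub_add_cancel, add_sub_cancel_right]
  push_cast
  simp only [radical_arguments (k : ℝ) (j : ℝ), one_div, Real.sqrt_inv, sub_add_cancel,
    add_sub_cancel_right, Real.sqrt_div' _ (by linarith : (0 : ℝ) ≤ k + 2 * j),
      Real.sqrt_div' _ (by linarith : (0 : ℝ) ≤ k + 2 * j + 1),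
    Complex.ofReal_inv, Complex.ofReal_div]
  rw [← s1]
  congr 1
  field_simp

theorem modelCre₂_vecD {k j : ℤ} (hk : 0 ≤ k) (hj : -1 ≤ j) :
    modelCre₂ e (vecD e k j) = -(yCoeff p (j + 1) / (k + 2 * j + 1)) • vecC e k (j + 1) := by
  rcases boundary_cases (p := p) hk hj with rfl | h | rfl | ⟨h1, h2, h3⟩
  · simp [vecD_eq_zero, vecC_eq_zero]
  · simp (disch := omega) [vecD_eq_zero, vecC_eq_zero]
  · simp [vecD_eq_zero, vecC_eq_zero]
  have hkR : (1 : ℝ) ≤ k := by exact_mod_cast h1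
  have hjR : (0 : ℝ) ≤ j := by exact_mod_cast h3
  have e1 := ofReal_sqrt_ne (by linarith : (0 : ℝ) < k + 2 * j + 1)
  have s1 := ofReal_sqrt_sq (by linarith : (0 : ℝ) ≤ k + 2 * j + 1)
  have e2 := ofReal_sqrt_ne (by linarith : (0 : ℝ) < k + 2 * j + 2)
  have s2 := ofReal_sqrt_sq (by linarith : (0 : ℝ) ≤ k + 2 * j + 2)
  push_cast at s1 s2
  simp only [vecD, vecC]
  rw [map_smul, ket_of (isPattern_D h1 h2 h3), modelCre₂, Module.Basis.constr_basis]
  simp only [Pattern.θ, sub_self, sub_sub_cancel, sub_add_cancel, add_sub_cancel_right,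
    Int.cast_zero,
    Int.cast_one, zero_div, Real.rpow_zero, zpow_zero, zpow_one, ← Real.sqrt_eq_rpow, one_mul,
      zero_mul,
    sub_zero, Complex.ofReal_zero, zero_smul, zero_add, smul_sub, smul_add, smul_smul,
    Complex.ofReal_mul]
  rw [show 2 * j + 1 + 1 = 2 * (j + 1) by ring]
  simp only [G₂_odd hj, smul_smul, sub_add_cancel, add_sub_cancel_right]
  push_cast
  simp only [radical_arguments (k : ℝ) (j : ℝ), one_div, Real.sqrt_inv, sub_add_cancel,
    add_sub_cancel_right, Real.sqrt_div' _ (by linarith : (0 : ℝ) ≤ k + 2 * j + 1),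
      Real.sqrt_div' _ (by linarith : (0 : ℝ) ≤ k + 2 * j + 2),
    Complex.ofReal_inv, Complex.ofReal_div]
  rw [← s1]
  congr 1
  field_simp

/-- The condition `2 ≤ k + 2 * j` excludes the label `k = 1`, `j = 0`, where annihilation can lead
to the vacuum and the denominator `k + 2j - 1` vanishes. -/
theorem modelAnn₁_vecA {k j : ℤ} (h1 : 1 ≤ k) (h3 : 0 ≤ j) (hkj : 2 ≤ k + 2 * j) :
    modelAnn₁ e (vecA e k j) = (gCoeff p (k - 1) * ((k + 2 * j) / (k + 2 * j - 1))) • vecA e (k - 1) j -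
      yCoeff p j • vecD e k (j - 1) := by
  -- At `k = p + 1` the source is zero but vectors with label `k - 1` need not be; their coefficient
  -- contains `gCoeff p p = 0`.
  rcases lt_trichotomy k (p + 1) with h2 | rfl | h
  rotate_left
  · simp [vecA_eq_zero, vecD_eq_zero]
  · simp (disch := omega) [vecA_eq_zero, vecD_eq_zero]
  replace h2 : k ≤ p := by omega
  have hkR : (1 : ℝ) ≤ k := by exact_mod_cast h1
  have hjR : (0 : ℝ) ≤ j := by exact_mod_cast h3
  have hkjR : (2 : ℝ) ≤ k + 2 * j := by exact_mod_cast hkj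
  have em := ofReal_sqrt_ne (by linarith : (0 : ℝ) < k + 2 * j - 1)
  have sm := ofReal_sqrt_sq (by linarith : (0 : ℝ) ≤ k + 2 * j - 1)
  have e0 := ofReal_sqrt_ne (by linarith : (0 : ℝ) < k + 2 * j)
  have s0 := ofReal_sqrt_sq (by linarith : (0 : ℝ) ≤ k + 2 * j)
  push_cast at sm s0
  simp only [vecA, vecD]
  rw [map_smul, ket_of (isPattern_A h1 h2 h3), modelAnn₁, Module.Basis.constr_basis]
  simp only [Pattern.θ, sub_self, sub_sub_cancel, sub_add_cancel, add_sub_cancel_right,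
    Int.cast_zero,
    Int.cast_one, zero_div, Real.rpow_zero, zpow_zero, zpow_one, ← Real.sqrt_eq_rpow, one_mul,
      zero_mul,
    sub_zero, Complex.ofReal_zero, zero_smul, zero_add, smul_sub, smul_add, smul_smul,
    Complex.ofReal_mul]
  rw [show 2 * j - 1 = 2 * (j - 1) + 1 by ring]
  simp only [G₁_even (show k - 1 ≤ p by omega) (show 1 ≤ k - 1 + 2 * j by omega),
    G₂_odd (show -1 ≤ j - 1 by omega), smul_smul, sub_add_cancel, add_sub_cancel_right]
  push_cast
  simp only [radical_arguments (k : ℝ) (j : ℝ), one_div, Real.sqrt_inv, sub_add_cancel,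
    add_sub_cancel_right, Real.sqrt_div' _ (by linarith : (0 : ℝ) ≤ k + 2 * j - 1),
      Real.sqrt_div' _ (by linarith : (0 : ℝ) ≤ k + 2 * j),
    Complex.ofReal_inv, Complex.ofReal_div]
  rw [← sm, ← s0]
  congr 2
  · field_simp
  · field_simp

theorem modelAnn₁_vecB {k j : ℤ} (h1 : 1 ≤ k) (h3 : 0 ≤ j) :
    modelAnn₁ e (vecB e k j) = gCoeff p (k - 1) • vecB e (k - 1) j - vecC e k j := by
  rcases lt_trichotomy k (p + 1) with h2 | rfl | h
  rotate_left
  · simp [vecB_eq_zero, vecC_eq_zero]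
  · simp (disch := omega) [vecB_eq_zero, vecC_eq_zero]
  replace h2 : k ≤ p := by omega
  have hkR : (1 : ℝ) ≤ k := by exact_mod_cast h1
  have hjR : (0 : ℝ) ≤ j := by exact_mod_cast h3
  have e0 := ofReal_sqrt_ne (by linarith : (0 : ℝ) < k + 2 * j)
  have s0 := ofReal_sqrt_sq (by linarith : (0 : ℝ) ≤ k + 2 * j)
  have e1 := ofReal_sqrt_ne (by linarith : (0 : ℝ) < k + 2 * j + 1)
  have s1 := ofReal_sqrt_sq (by linarith : (0 : ℝ) ≤ k + 2 * j + 1)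
  push_cast at s0 s1
  simp only [vecB, vecC]
  rw [ket_of (isPattern_B h1 h2 h3), modelAnn₁, Module.Basis.constr_basis]
  simp only [Pattern.θ, sub_self, sub_sub_cancel, sub_add_cancel, add_sub_cancel_right,
    Int.cast_zero,
    Int.cast_one, zero_div, Real.rpow_zero, zpow_zero, zpow_one, ← Real.sqrt_eq_rpow, one_mul,
      zero_mul,
    sub_zero, Complex.ofReal_zero, zero_smul, zero_add, smul_sub, smul_add, smul_smul,
    Complex.ofReal_mul]
  simp only [G₁_odd (show 0 ≤ k - 1 by omega) (show k - 1 ≤ p by omega) h3, G₂_even, smul_smul,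
    sub_add_cancel, add_sub_cancel_right]
  push_cast
  simp only [radical_arguments (k : ℝ) (j : ℝ), one_div, Real.sqrt_inv, sub_add_cancel,
    add_sub_cancel_right, Real.sqrt_div' _ (by linarith : (0 : ℝ) ≤ k + 2 * j),
      Real.sqrt_div' _ (by linarith : (0 : ℝ) ≤ k + 2 * j + 1),
    Complex.ofReal_inv, Complex.ofReal_div]
  congr 1
  convert one_smul ℂ _ using 2
  field_simp

theorem modelAnn₁_vecC {k j : ℤ} (h1 : 1 ≤ k) (h3 : 0 ≤ j) (hkj : 2 ≤ k + 2 * j) :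
    modelAnn₁ e (vecC e k j) = gCoeff p (k - 1) • vecC e (k - 1) j := by
  rcases lt_trichotomy k (p + 1) with h2 | rfl | h
  rotate_left
  · simp [vecC_eq_zero]
  · simp (disch := omega) [vecC_eq_zero]
  replace h2 : k ≤ p := by omega
  have hkR : (1 : ℝ) ≤ k := by exact_mod_cast h1
  have hjR : (0 : ℝ) ≤ j := by exact_mod_cast h3
  have hkjR : (2 : ℝ) ≤ k + 2 * j := by exact_mod_cast hkj
  have em := ofReal_sqrt_ne (by linarith : (0 : ℝ) < k + 2 * j - 1)
  have sm := ofReal_sqrt_sq (by linarith : (0 : ℝ) ≤ k + 2 * j - 1)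
  have e0 := ofReal_sqrt_ne (by linarith : (0 : ℝ) < k + 2 * j)
  have s0 := ofReal_sqrt_sq (by linarith : (0 : ℝ) ≤ k + 2 * j)
  push_cast at sm s0
  simp only [vecC]
  rw [ket_of (isPattern_C h1 h2 h3), modelAnn₁, Module.Basis.constr_basis]
  simp only [Pattern.θ, sub_self, sub_sub_cancel, sub_add_cancel, add_sub_cancel_right,
    Int.cast_zero,
    Int.cast_one, zero_div, Real.rpow_zero, zpow_zero, zpow_one, ← Real.sqrt_eq_rpow, one_mul,
      zero_mul,
    sub_zero, Complex.ofReal_zero, zero_smul, zero_add, smul_sub, smul_add, smul_smul,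
    Complex.ofReal_mul]
  simp only [G₁_even (show k - 1 ≤ p by omega) (show 1 ≤ k - 1 + 2 * j by omega), smul_smul,
    sub_add_cancel, add_sub_cancel_right]
  push_cast
  simp only [radical_arguments (k : ℝ) (j : ℝ), one_div, Real.sqrt_inv, sub_add_cancel,
    add_sub_cancel_right, Real.sqrt_div' _ (by linarith : (0 : ℝ) ≤ k + 2 * j - 1),
      Real.sqrt_div' _ (by linarith : (0 : ℝ) ≤ k + 2 * j),
    Complex.ofReal_inv, Complex.ofReal_div]
  congr 1
  field_simp

theorem modelAnn₁_vecD {k j : ℤ} (h1 : 1 ≤ k) (h3 : 0 ≤ j) :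
    modelAnn₁ e (vecD e k j) = (gCoeff p (k - 1) * ((k + 2 * j) / (k + 2 * j + 1))) • vecD e (k - 1) j := by
  rcases lt_trichotomy k (p + 1) with h2 | rfl | h
  rotate_left
  · simp [vecD_eq_zero]
  · simp (disch := omega) [vecD_eq_zero]
  replace h2 : k ≤ p := by omega
  have hkR : (1 : ℝ) ≤ k := by exact_mod_cast h1
  have hjR : (0 : ℝ) ≤ j := by exact_mod_cast h3
  have e0 := ofReal_sqrt_ne (by linarith : (0 : ℝ) < k + 2 * j)
  have s0 := ofReal_sqrt_sq (by linarith : (0 : ℝ) ≤ k + 2 * j)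
  have e1 := ofReal_sqrt_ne (by linarith : (0 : ℝ) < k + 2 * j + 1)
  have s1 := ofReal_sqrt_sq (by linarith : (0 : ℝ) ≤ k + 2 * j + 1)
  push_cast at s0 s1
  simp only [vecD]
  rw [map_smul, ket_of (isPattern_D h1 h2 h3), modelAnn₁, Module.Basis.constr_basis]
  simp only [Pattern.θ, sub_self, sub_sub_cancel, sub_add_cancel, add_sub_cancel_right,
    Int.cast_zero,
    Int.cast_one, zero_div, Real.rpow_zero, zpow_zero, zpow_one, ← Real.sqrt_eq_rpow, one_mul,
      zero_mul,
    sub_zero, Complex.ofReal_zero, zero_smul, zero_add, smul_sub, smul_add, smul_smul,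
    Complex.ofReal_mul]
  simp only [G₁_odd (show 0 ≤ k - 1 by omega) (show k - 1 ≤ p by omega) h3, smul_smul,
    sub_add_cancel, add_sub_cancel_right]
  push_cast
  simp only [radical_arguments (k : ℝ) (j : ℝ), one_div, Real.sqrt_inv, sub_add_cancel,
    add_sub_cancel_right, Real.sqrt_div' _ (by linarith : (0 : ℝ) ≤ k + 2 * j),
      Real.sqrt_div' _ (by linarith : (0 : ℝ) ≤ k + 2 * j + 1),
    Complex.ofReal_inv, Complex.ofReal_div]
  rw [← s1, ← s0]
  congr 1
  field_simp

theorem modelAnn₂_vecA {k j : ℤ} (h1 : 1 ≤ k) (h3 : 0 ≤ j) (hkj : 2 ≤ k + 2 * j) :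
    modelAnn₂ e (vecA e k j) = yCoeff p j • vecB e k (j - 1) := by
  rcases lt_trichotomy k (p + 1) with h2 | rfl | h
  rotate_left
  · simp [vecA_eq_zero, vecB_eq_zero]
  · simp (disch := omega) [vecA_eq_zero, vecB_eq_zero]
  replace h2 : k ≤ p := by omega
  have hkR : (1 : ℝ) ≤ k := by exact_mod_cast h1
  have hjR : (0 : ℝ) ≤ j := by exact_mod_cast h3
  have hkjR : (2 : ℝ) ≤ k + 2 * j := by exact_mod_cast hkj
  have em := ofReal_sqrt_ne (by linarith : (0 : ℝ) < k + 2 * j - 1)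
  have sm := ofReal_sqrt_sq (by linarith : (0 : ℝ) ≤ k + 2 * j - 1)
  have e0 := ofReal_sqrt_ne (by linarith : (0 : ℝ) < k + 2 * j)
  have s0 := ofReal_sqrt_sq (by linarith : (0 : ℝ) ≤ k + 2 * j)
  push_cast at sm s0
  simp only [vecA, vecB]
  rw [map_smul, ket_of (isPattern_A h1 h2 h3), modelAnn₂, Module.Basis.constr_basis]
  simp only [Pattern.θ, sub_self, sub_sub_cancel, sub_add_cancel, add_sub_cancel_right,
    Int.cast_zero,
    Int.cast_one, zero_div, Real.rpow_zero, zpow_zero, zpow_one, ← Real.sqrt_eq_rpow, one_mul,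
      zero_mul,
    sub_zero, Complex.ofReal_zero, zero_smul, zero_add, smul_sub, smul_add, smul_smul,
    Complex.ofReal_mul]
  rw [show 2 * j - 1 = 2 * (j - 1) + 1 by ring]
  simp only [G₂_odd (show -1 ≤ j - 1 by omega), smul_smul, sub_add_cancel, add_sub_cancel_right]
  push_cast
  simp only [radical_arguments (k : ℝ) (j : ℝ), one_div, Real.sqrt_inv, sub_add_cancel,
    add_sub_cancel_right, Real.sqrt_div' _ (by linarith : (0 : ℝ) ≤ k + 2 * j - 1),
      Real.sqrt_div' _ (by linarith : (0 : ℝ) ≤ k + 2 * j),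
    Complex.ofReal_inv, Complex.ofReal_div]
  congr 1
  field_simp

theorem modelAnn₂_vecB {k j : ℤ} (h1 : 1 ≤ k) (h3 : 0 ≤ j) :
    modelAnn₂ e (vecB e k j) = vecA e k j := by
  rcases lt_trichotomy k (p + 1) with h2 | rfl | h
  rotate_left
  · simp [vecB_eq_zero, vecA_eq_zero]
  · simp (disch := omega) [vecB_eq_zero, vecA_eq_zero]
  replace h2 : k ≤ p := by omega
  have hkR : (1 : ℝ) ≤ k := by exact_mod_cast h1
  have hjR : (0 : ℝ) ≤ j := by exact_mod_cast h3
  have e0 := ofReal_sqrt_ne (by linarith : (0 : ℝ) < k + 2 * j)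
  have s0 := ofReal_sqrt_sq (by linarith : (0 : ℝ) ≤ k + 2 * j)
  have e1 := ofReal_sqrt_ne (by linarith : (0 : ℝ) < k + 2 * j + 1)
  have s1 := ofReal_sqrt_sq (by linarith : (0 : ℝ) ≤ k + 2 * j + 1)
  push_cast at s0 s1
  simp only [vecB, vecA]
  rw [ket_of (isPattern_B h1 h2 h3), modelAnn₂, Module.Basis.constr_basis]
  simp only [Pattern.θ, sub_self, sub_sub_cancel, sub_add_cancel, add_sub_cancel_right,
    Int.cast_zero,
    Int.cast_one, zero_div, Real.rpow_zero, zpow_zero, zpow_one, ← Real.sqrt_eq_rpow, one_mul,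
      zero_mul,
    sub_zero, Complex.ofReal_zero, zero_smul, zero_add, smul_sub, smul_add, smul_smul,
    Complex.ofReal_mul]
  simp only [G₂_even, smul_smul, sub_add_cancel, add_sub_cancel_right]
  push_cast
  simp only [radical_arguments (k : ℝ) (j : ℝ), one_div, Real.sqrt_inv, sub_add_cancel,
    add_sub_cancel_right, Real.sqrt_div' _ (by linarith : (0 : ℝ) ≤ k + 2 * j),
      Real.sqrt_div' _ (by linarith : (0 : ℝ) ≤ k + 2 * j + 1),
    Complex.ofReal_inv, Complex.ofReal_div]
  congr 1
  field_simp

theorem modelAnn₂_vecC {k j : ℤ} (h1 : 1 ≤ k) (h3 : 0 ≤ j) (hkj : 2 ≤ k + 2 * j) :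
    modelAnn₂ e (vecC e k j) = (gCoeff p (k - 1) / (k + 2 * j - 1)) • vecA e (k - 1) j - yCoeff p j • vecD e k (j - 1) := by
  rcases lt_trichotomy k (p + 1) with h2 | rfl | h
  rotate_left
  · simp [vecC_eq_zero, vecA_eq_zero, vecD_eq_zero]
  · simp (disch := omega) [vecC_eq_zero, vecA_eq_zero, vecD_eq_zero]
  replace h2 : k ≤ p := by omega
  have hkR : (1 : ℝ) ≤ k := by exact_mod_cast h1
  have hjR : (0 : ℝ) ≤ j := by exact_mod_cast h3
  have hkjR : (2 : ℝ) ≤ k + 2 * j := by exact_mod_cast hkj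
  have em := ofReal_sqrt_ne (by linarith : (0 : ℝ) < k + 2 * j - 1)
  have sm := ofReal_sqrt_sq (by linarith : (0 : ℝ) ≤ k + 2 * j - 1)
  have e0 := ofReal_sqrt_ne (by linarith : (0 : ℝ) < k + 2 * j)
  have s0 := ofReal_sqrt_sq (by linarith : (0 : ℝ) ≤ k + 2 * j)
  push_cast at sm s0
  simp only [vecC, vecA, vecD]
  rw [ket_of (isPattern_C h1 h2 h3), modelAnn₂, Module.Basis.constr_basis]
  simp only [Pattern.θ, sub_self, sub_sub_cancel, sub_add_cancel, add_sub_cancel_right,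
    Int.cast_zero,
    Int.cast_one, zero_div, Real.rpow_zero, zpow_zero, zpow_one, ← Real.sqrt_eq_rpow, one_mul,
      zero_mul,
    sub_zero, Complex.ofReal_zero, zero_smul, zero_add, smul_sub, smul_add, smul_smul,
    Complex.ofReal_mul]
  rw [show 2 * j - 1 = 2 * (j - 1) + 1 by ring]
  simp only [G₁_even (show k - 1 ≤ p by omega) (show 1 ≤ k - 1 + 2 * j by omega),
    G₂_odd (show -1 ≤ j - 1 by omega), smul_smul, sub_add_cancel, add_sub_cancel_right]
  push_cast
  simp only [radical_arguments (k : ℝ) (j : ℝ), one_div, Real.sqrt_inv, sub_add_cancel,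
    add_sub_cancel_right, Real.sqrt_div' _ (by linarith : (0 : ℝ) ≤ k + 2 * j - 1),
      Real.sqrt_div' _ (by linarith : (0 : ℝ) ≤ k + 2 * j),
    Complex.ofReal_inv, Complex.ofReal_div]
  rw [← sm]
  refine add_smul_eq_sub_smul ?_ ?_
  · field_simp
  · field_simp

theorem modelAnn₂_vecD {k j : ℤ} (h1 : 1 ≤ k) (h3 : 0 ≤ j) :
    modelAnn₂ e (vecD e k j) = (gCoeff p (k - 1) / (k + 2 * j + 1)) • vecB e (k - 1) j - vecC e k j := by
  rcases lt_trichotomy k (p + 1) with h2 | rfl | h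
  rotate_left
  · simp [vecD_eq_zero, vecB_eq_zero, vecC_eq_zero]
  · simp (disch := omega) [vecD_eq_zero, vecB_eq_zero, vecC_eq_zero]
  replace h2 : k ≤ p := by omega
  have hkR : (1 : ℝ) ≤ k := by exact_mod_cast h1
  have hjR : (0 : ℝ) ≤ j := by exact_mod_cast h3
  have e0 := ofReal_sqrt_ne (by linarith : (0 : ℝ) < k + 2 * j)
  have s0 := ofReal_sqrt_sq (by linarith : (0 : ℝ) ≤ k + 2 * j)
  have e1 := ofReal_sqrt_ne (by linarith : (0 : ℝ) < k + 2 * j + 1)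
  have s1 := ofReal_sqrt_sq (by linarith : (0 : ℝ) ≤ k + 2 * j + 1)
  push_cast at s0 s1
  simp only [vecD, vecB, vecC]
  rw [map_smul, ket_of (isPattern_D h1 h2 h3), modelAnn₂, Module.Basis.constr_basis]
  simp only [Pattern.θ, sub_self, sub_sub_cancel, sub_add_cancel, add_sub_cancel_right,
    Int.cast_zero,
    Int.cast_one, zero_div, Real.rpow_zero, zpow_zero, zpow_one, ← Real.sqrt_eq_rpow, one_mul,
      zero_mul,
    sub_zero, Complex.ofReal_zero, zero_smul, zero_add, smul_sub, smul_add, smul_smul,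
    Complex.ofReal_mul]
  simp only [G₁_odd (show 0 ≤ k - 1 by omega) (show k - 1 ≤ p by omega) h3, G₂_even, smul_smul,
    sub_add_cancel, add_sub_cancel_right]
  push_cast
  simp only [radical_arguments (k : ℝ) (j : ℝ), one_div, Real.sqrt_inv, sub_add_cancel,
    add_sub_cancel_right, Real.sqrt_div' _ (by linarith : (0 : ℝ) ≤ k + 2 * j),
      Real.sqrt_div' _ (by linarith : (0 : ℝ) ≤ k + 2 * j + 1),
    Complex.ofReal_inv, Complex.ofReal_div]
  rw [← s1, ← one_smul ℂ (ket e k (2 * j) (k - 1)), smul_smul]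
  refine add_smul_eq_sub_smul ?_ ?_
  · field_simp
  · field_simp

end Model

/-! ### Verification of the relations in the model -/

section Model

variable {p : ℕ} {V : Type*} [AddCommGroup V] [Module ℂ V] {e : Module.Basis (Pattern p) ℂ V}

theorem ket_of_neg {a b c : ℤ} (h : a < 0 ∨ b < 0) : ket e a b c = 0 := by
  refine ket_of_not fun h' => ?_
  have := h'.top_nonneg
  have := h'.right_nonneg
  omega

theorem modelCre₁_vac : modelCre₁ e (modelVac e) = ((√p : ℝ) : ℂ) • vecA e 1 0 := by
  rw [modelVac, ket_of isPattern_zero, modelCre₁, Module.Basis.constr_basis]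
  simp [Pattern.θ, G₁, vecA]

theorem modelCre₂_vac : modelCre₂ e (modelVac e) = ((√p : ℝ) : ℂ) • vecC e 1 0 := by
  rw [modelVac, ket_of isPattern_zero, modelCre₂, Module.Basis.constr_basis]
  simp [Pattern.θ, G₁, vecC]

theorem modelAnn₁_vac : modelAnn₁ e (modelVac e) = 0 := by
  rw [modelVac, ket_of isPattern_zero, modelAnn₁, Module.Basis.constr_basis]
  simp [ket_of_neg]

theorem modelAnn₂_vac : modelAnn₂ e (modelVac e) = 0 := by
  rw [modelVac, ket_of isPattern_zero, modelAnn₂, Module.Basis.constr_basis]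
  simp [ket_of_neg]

/-- The transitions from the label `(1, 0)` down to the vacuum; the factor `√p` is the conventional
value of `G₁` at `(0, 0)`. -/
theorem modelAnn₁_vecA_one (hp : 1 ≤ p) : modelAnn₁ e (vecA e 1 0) = ((√p : ℝ) : ℂ) • modelVac e := by
  rw [vecA, map_smul, ket_of (isPattern_A le_rfl (by omega) le_rfl), modelAnn₁,
    Module.Basis.constr_basis]
  simp [ket_of_neg, Pattern.θ, G₁, modelVac]

theorem modelAnn₁_vecC_one (hp : 1 ≤ p) : modelAnn₁ e (vecC e 1 0) = 0 := by
  rw [vecC, ket_of (isPattern_C le_rfl (by omega) le_rfl), modelAnn₁,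
    Module.Basis.constr_basis]
  simp [ket_of_neg, Pattern.θ]

theorem modelAnn₂_vecA_one (hp : 1 ≤ p) : modelAnn₂ e (vecA e 1 0) = 0 := by
  rw [vecA, map_smul, ket_of (isPattern_A le_rfl (by omega) le_rfl), modelAnn₂,
    Module.Basis.constr_basis]
  simp [ket_of_neg, Pattern.θ]

theorem modelAnn₂_vecC_one (hp : 1 ≤ p) : modelAnn₂ e (vecC e 1 0) = ((√p : ℝ) : ℂ) • modelVac e := by
  rw [vecC, ket_of (isPattern_C le_rfl (by omega) le_rfl), modelAnn₂,
    Module.Basis.constr_basis]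
  simp [ket_of_neg, Pattern.θ, G₁, modelVac]

theorem modelH₁_ket (a b c : ℤ) : modelH₁ e (ket e a b c) = (-p / 2 + c : ℂ) • ket e a b c := by
  by_cases h : IsPattern p a b c
  · rw [ket_of h, modelH₁, Module.Basis.constr_basis]
  · simp [ket_of_not h]

theorem modelH₂_ket (a b c : ℤ) :
    modelH₂ e (ket e a b c) = (p / 2 + a + b - c : ℂ) • ket e a b c := by
  by_cases h : IsPattern p a b c
  · rw [ket_of h, modelH₂, Module.Basis.constr_basis]
  · simp [ket_of_not h]

theorem modelH₁_vac : modelH₁ e (modelVac e) = (-p / 2 : ℂ) • modelVac e := by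
  simp [modelVac, modelH₁_ket]

theorem modelH₂_vac : modelH₂ e (modelVac e) = (p / 2 : ℂ) • modelVac e := by
  simp [modelVac, modelH₂_ket]

theorem modelH₁_vecA (k j : ℤ) :
    modelH₁ e (vecA e k j) = (-p / 2 + k : ℂ) • vecA e k j := by
  simp only [vecA, map_smul, modelH₁_ket, smul_smul]
  congr 1; push_cast; ring

theorem modelH₂_vecA (k j : ℤ) :
    modelH₂ e (vecA e k j) = (p / 2 + (2 * j) : ℂ) • vecA e k j := by
  simp only [vecA, map_smul, modelH₂_ket, smul_smul]
  congr 1; push_cast; ring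

theorem modelH₁_vecB (k j : ℤ) :
    modelH₁ e (vecB e k j) = (-p / 2 + k : ℂ) • vecB e k j := by
  simp only [vecB, map_smul, modelH₁_ket, smul_smul]

theorem modelH₂_vecB (k j : ℤ) :
    modelH₂ e (vecB e k j) = (p / 2 + (2 * j + 1) : ℂ) • vecB e k j := by
  simp only [vecB, map_smul, modelH₂_ket, smul_smul]
  congr 1; push_cast; ring

theorem modelH₁_vecC (k j : ℤ) :
    modelH₁ e (vecC e k j) = (-p / 2 + (k - 1) : ℂ) • vecC e k j := by
  simp only [vecC, map_smul, modelH₁_ket, smul_smul]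
  congr 1; push_cast; ring

theorem modelH₂_vecC (k j : ℤ) :
    modelH₂ e (vecC e k j) = (p / 2 + (2 * j + 1) : ℂ) • vecC e k j := by
  simp only [vecC, map_smul, modelH₂_ket, smul_smul]
  congr 1; push_cast; ring

theorem modelH₁_vecD (k j : ℤ) :
    modelH₁ e (vecD e k j) = (-p / 2 + (k - 1) : ℂ) • vecD e k j := by
  simp only [vecD, map_smul, modelH₁_ket, smul_smul]
  congr 1; push_cast; ring

theorem modelH₂_vecD (k j : ℤ) :
    modelH₂ e (vecD e k j) = (p / 2 + (2 * j + 2) : ℂ) • vecD e k j := by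
  simp only [vecD, map_smul, modelH₂_ket, smul_smul]
  congr 1; push_cast; ring

theorem modelParity_ket (a b c : ℤ) :
    modelParity e (ket e a b c) = ((-1) ^ (a + b - c) : ℂ) • ket e a b c := by
  by_cases h : IsPattern p a b c
  · rw [ket_of h, modelParity, Module.Basis.constr_basis]
  · simp [ket_of_not h]

theorem modelH₁_basis (μ : Pattern p) : modelH₁ e (e μ) = (-p / 2 + μ.μ₁₁ : ℂ) • e μ := by
  rw [modelH₁, Module.Basis.constr_basis]

theorem modelH₂_basis (μ : Pattern p) :
    modelH₂ e (e μ) = (p / 2 + μ.μ₁₂ + μ.μ₂₂ - μ.μ₁₁ : ℂ) • e μ := by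
  rw [modelH₂, Module.Basis.constr_basis]

theorem modelParity_basis (μ : Pattern p) :
    modelParity e (e μ) = ((-1) ^ (μ.μ₁₂ + μ.μ₂₂ - μ.μ₁₁) : ℂ) • e μ := by
  rw [modelParity, Module.Basis.constr_basis]

theorem modelParity_mul_self : modelParity e * modelParity e = 1 := by
  refine e.ext fun μ => ?_
  rw [Module.End.mul_apply, modelParity_basis, map_smul, modelParity_basis, smul_smul,
    ← mul_zpow]
  simp

/-- Both terms of `modelCre₁` raise `μ₁₁` by one and preserve `μ₁₂ + μ₂₂ - μ₁₁`. The commutation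
rules with `h₁`, `h₂` and the parity all come from such label counts. -/
theorem modelH₁_comm_modelCre₁ : modelH₁ e * modelCre₁ e - modelCre₁ e * modelH₁ e = modelCre₁ e := by
  refine e.ext fun μ => ?_
  simp only [LinearMap.sub_apply, LinearMap.neg_apply, LinearMap.zero_apply, Module.End.mul_apply,
    modelH₁_basis, map_smul]
  simp only [modelCre₁, Module.Basis.constr_basis, map_add, map_sub, map_smul, modelH₁_ket]
  match_scalars <;> push_cast <;> ring

theorem modelH₂_comm_modelCre₁ : modelH₂ e * modelCre₁ e - modelCre₁ e * modelH₂ e = 0 := by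
  refine e.ext fun μ => ?_
  simp only [LinearMap.sub_apply, LinearMap.neg_apply, LinearMap.zero_apply, Module.End.mul_apply,
    modelH₂_basis, map_smul]
  simp only [modelCre₁, Module.Basis.constr_basis, map_add, map_sub, map_smul, modelH₂_ket]
  match_scalars <;> push_cast <;> ring

theorem modelParity_mul_modelCre₁ :
    modelParity e * modelCre₁ e = modelCre₁ e * modelParity e := by
  refine e.ext fun μ => ?_
  simp only [LinearMap.neg_apply, Module.End.mul_apply, modelParity_basis, map_smul]
  simp only [modelCre₁, Module.Basis.constr_basis, map_add, map_sub, map_smul, modelParity_ket]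
  have h : (-1 : ℂ) ≠ 0 := by norm_num
  match_scalars <;> simp only [zpow_add₀ h, zpow_sub₀ h, zpow_one] <;> field_simp

theorem modelH₁_comm_modelCre₂ : modelH₁ e * modelCre₂ e - modelCre₂ e * modelH₁ e = 0 := by
  refine e.ext fun μ => ?_
  simp only [LinearMap.sub_apply, LinearMap.neg_apply, LinearMap.zero_apply, Module.End.mul_apply,
    modelH₁_basis, map_smul]
  simp only [modelCre₂, Module.Basis.constr_basis, map_add, map_sub, map_smul, modelH₁_ket]
  match_scalars <;> push_cast <;> ring

theorem modelH₂_comm_modelCre₂ : modelH₂ e * modelCre₂ e - modelCre₂ e * modelH₂ e = modelCre₂ e := by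
  refine e.ext fun μ => ?_
  simp only [LinearMap.sub_apply, LinearMap.neg_apply, LinearMap.zero_apply, Module.End.mul_apply,
    modelH₂_basis, map_smul]
  simp only [modelCre₂, Module.Basis.constr_basis, map_add, map_sub, map_smul, modelH₂_ket]
  match_scalars <;> push_cast <;> ring

theorem modelParity_mul_modelCre₂ :
    modelParity e * modelCre₂ e = -(modelCre₂ e * modelParity e) := by
  refine e.ext fun μ => ?_
  simp only [LinearMap.neg_apply, Module.End.mul_apply, modelParity_basis, map_smul]
  simp only [modelCre₂, Module.Basis.constr_basis, map_add, map_sub, map_smul, modelParity_ket]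
  have h : (-1 : ℂ) ≠ 0 := by norm_num
  match_scalars <;> simp only [zpow_add₀ h, zpow_sub₀ h, zpow_one] <;> field_simp

theorem modelH₁_comm_modelAnn₁ : modelH₁ e * modelAnn₁ e - modelAnn₁ e * modelH₁ e = -modelAnn₁ e := by
  refine e.ext fun μ => ?_
  simp only [LinearMap.sub_apply, LinearMap.neg_apply, LinearMap.zero_apply, Module.End.mul_apply,
    modelH₁_basis, map_smul]
  simp only [modelAnn₁, Module.Basis.constr_basis, map_add, map_sub, map_smul, modelH₁_ket]
  match_scalars <;> push_cast <;> ring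

theorem modelH₂_comm_modelAnn₁ : modelH₂ e * modelAnn₁ e - modelAnn₁ e * modelH₂ e = 0 := by
  refine e.ext fun μ => ?_
  simp only [LinearMap.sub_apply, LinearMap.neg_apply, LinearMap.zero_apply, Module.End.mul_apply,
    modelH₂_basis, map_smul]
  simp only [modelAnn₁, Module.Basis.constr_basis, map_add, map_sub, map_smul, modelH₂_ket]
  match_scalars <;> push_cast <;> ring

theorem modelParity_mul_modelAnn₁ :
    modelParity e * modelAnn₁ e = modelAnn₁ e * modelParity e := by
  refine e.ext fun μ => ?_
  simp only [LinearMap.neg_apply, Module.End.mul_apply, modelParity_basis, map_smul]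
  simp only [modelAnn₁, Module.Basis.constr_basis, map_add, map_sub, map_smul, modelParity_ket]
  have h : (-1 : ℂ) ≠ 0 := by norm_num
  match_scalars <;> simp only [zpow_add₀ h, zpow_sub₀ h, zpow_one] <;> field_simp

theorem modelH₁_comm_modelAnn₂ : modelH₁ e * modelAnn₂ e - modelAnn₂ e * modelH₁ e = 0 := by
  refine e.ext fun μ => ?_
  simp only [LinearMap.sub_apply, LinearMap.neg_apply, LinearMap.zero_apply, Module.End.mul_apply,
    modelH₁_basis, map_smul]
  simp only [modelAnn₂, Module.Basis.constr_basis, map_add, map_sub, map_smul, modelH₁_ket]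
  match_scalars <;> push_cast <;> ring

theorem modelH₂_comm_modelAnn₂ : modelH₂ e * modelAnn₂ e - modelAnn₂ e * modelH₂ e = -modelAnn₂ e := by
  refine e.ext fun μ => ?_
  simp only [LinearMap.sub_apply, LinearMap.neg_apply, LinearMap.zero_apply, Module.End.mul_apply,
    modelH₂_basis, map_smul]
  simp only [modelAnn₂, Module.Basis.constr_basis, map_add, map_sub, map_smul, modelH₂_ket]
  match_scalars <;> push_cast <;> ring

theorem modelParity_mul_modelAnn₂ :
    modelParity e * modelAnn₂ e = -(modelAnn₂ e * modelParity e) := by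
  refine e.ext fun μ => ?_
  simp only [LinearMap.neg_apply, Module.End.mul_apply, modelParity_basis, map_smul]
  simp only [modelAnn₂, Module.Basis.constr_basis, map_add, map_sub, map_smul, modelParity_ket]
  have h : (-1 : ℂ) ≠ 0 := by norm_num
  match_scalars <;> simp only [zpow_add₀ h, zpow_sub₀ h, zpow_one] <;> field_simp

/-- Operators on the model are determined by their values on the vacuum and the rescaled
vectors. -/
theorem model_ext (e : Module.Basis (Pattern p) ℂ V) {S T : Module.End ℂ V}
    (hv : S (modelVac e) = T (modelVac e))
    (h₁ : S (vecA e 1 0) = T (vecA e 1 0) ∧ S (vecB e 1 0) = T (vecB e 1 0) ∧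
      S (vecC e 1 0) = T (vecC e 1 0) ∧ S (vecD e 1 0) = T (vecD e 1 0))
    (h₂ : ∀ k j : ℤ, 1 ≤ k → 0 ≤ j → 2 ≤ k + 2 * j → S (vecA e k j) = T (vecA e k j) ∧
      S (vecB e k j) = T (vecB e k j) ∧ S (vecC e k j) = T (vecC e k j) ∧
      S (vecD e k j) = T (vecD e k j)) : S = T := by
  have h : ∀ k j : ℤ, 1 ≤ k → 0 ≤ j → S (vecA e k j) = T (vecA e k j) ∧
      S (vecB e k j) = T (vecB e k j) ∧ S (vecC e k j) = T (vecC e k j) ∧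
      S (vecD e k j) = T (vecD e k j) := by
    intro k j hk hj
    by_cases hkj : 2 ≤ k + 2 * j
    · exact h₂ k j hk hj hkj
    · obtain ⟨rfl, rfl⟩ : k = 1 ∧ j = 0 := by omega
      exact h₁
  refine e.ext fun ⟨k, l, m, hμ⟩ => ?_
  rw [← ket_of hμ]
  obtain ⟨h1, -, h3, h4, h5, h6⟩ := hμ
  by_cases hk : k = 0
  · obtain ⟨rfl, rfl, rfl⟩ : k = 0 ∧ l = 0 ∧ m = 0 := by omega
    exact hv
  have hkR : (1 : ℝ) ≤ k := by exact_mod_cast (by omega : 1 ≤ k)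
  rcases Int.even_or_odd' l with ⟨j, rfl | rfl⟩
  · obtain ⟨hA, hB, hC, hD⟩ := h k j (by omega) (by omega)
    rcases h5 with h5 | h5
    · have hj : (0 : ℝ) ≤ j := by exact_mod_cast (by omega : 0 ≤ j)
      rw [vecA, map_smul, map_smul] at hA
      obtain rfl : m = k := by omega
      exact smul_right_injective V (ofReal_sqrt_ne (by linarith)) hA
    · obtain rfl : m = k - 1 := by omega
      exact hC
  · obtain ⟨hA, hB, hC, hD⟩ := h k j (by omega) (by omega)
    rcases h5 with h5 | h5
    · obtain rfl : m = k := by omega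
      exact hB
    · have hj : (0 : ℝ) ≤ j := by exact_mod_cast (by omega : 0 ≤ j)
      rw [vecD, map_smul, map_smul] at hD
      obtain rfl : m = k - 1 := by omega
      exact smul_right_injective V (inv_ne_zero (ofReal_sqrt_ne (by linarith))) hD

/-- With `t = k + 2j`, these are the denominators that arise when up to three model operators are
composed. -/
theorem denominators_ne_zero {k j : ℤ} {t : ℂ} (ht : (k : ℂ) = t - 2 * j)
    (hkj : 2 ≤ k + 2 * j) : -1 + t ≠ 0 ∧ t ≠ 0 ∧ 1 + t ≠ 0 ∧ 2 + t ≠ 0 ∧ 3 + t ≠ 0 ∧ 4 + t ≠ 0 := by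
  obtain rfl : t = k + 2 * j := by rw [ht]; ring
  refine ⟨?_, ?_, ?_, ?_, ?_, ?_⟩
  · exact_mod_cast (by omega : -1 + (k + 2 * j) ≠ 0)
  · exact_mod_cast (by omega : k + 2 * j ≠ 0)
  · exact_mod_cast (by omega : 1 + (k + 2 * j) ≠ 0)
  · exact_mod_cast (by omega : 2 + (k + 2 * j) ≠ 0)
  · exact_mod_cast (by omega : 3 + (k + 2 * j) ≠ 0)
  · exact_mod_cast (by omega : 4 + (k + 2 * j) ≠ 0)

/-- The left sides have the shape in which `ring_nf` leaves them, such as `-1 + k`; the cube appears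
when `gCoeff p k ^ 2` multiplies a further `gCoeff p k`. -/
theorem coefficient_squares {k j : ℤ} {t : ℂ} (ht : (k : ℂ) = t - 2 * j) (hk : 1 ≤ k)
    (hj : 0 ≤ j) :
    gCoeff p k ^ 2 = (t - 2 * j) * (p - t + 2 * j) ∧
    gCoeff p k ^ 3 = gCoeff p k * ((t - 2 * j) * (p - t + 2 * j)) ∧
    gCoeff p (-1 + k) ^ 2 = (-1 + t - 2 * j) * (p + 1 - t + 2 * j) ∧
    gCoeff p (1 + k) ^ 2 = (1 + t - 2 * j) * (p - 1 - t + 2 * j) ∧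
    yCoeff p j ^ 2 = 2 * j * (p + 2 * j) ∧
    yCoeff p (1 + j) ^ 2 = 2 * (1 + j) * (p + 2 * (1 + j)) := by
  have h := gCoeff_sq (p := p) (k := k) (by omega)
  refine ⟨?_, ?_, ?_, ?_, ?_, ?_⟩
  · rw [h, ht]; ring
  · rw [pow_succ', h, ht]; ring
  · rw [gCoeff_sq (by omega)]; push_cast; rw [ht]; ring
  · rw [gCoeff_sq (by omega)]; push_cast; rw [ht]; ring
  · rw [yCoeff_sq hj]
  · rw [yCoeff_sq (by omega)]; push_cast; ring

theorem special_squares :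
    gCoeff p 1 ^ 3 = gCoeff p 1 * ((p : ℂ) - 1) ∧
    (gCoeff p 1 ^ 2 = (p : ℂ) - 1 ∧ gCoeff p 2 ^ 2 = 2 * ((p : ℂ) - 2)) ∧
    yCoeff p 1 ^ 2 = 2 * ((p : ℂ) + 2) ∧ ((√(p : ℝ) : ℝ) : ℂ) ^ 2 = p := by
  refine ⟨?_, ⟨?_, ?_⟩, ?_, ?_⟩
  · rw [pow_succ, gCoeff_sq (by omega)]; push_cast; ring
  · rw [gCoeff_sq (by omega)]; push_cast; ring
  · rw [gCoeff_sq (by omega)]; push_cast; ring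
  · rw [yCoeff_sq (by omega)]; push_cast; ring
  · rw [ofReal_sqrt_sq (Nat.cast_nonneg p)]; simp

set_option maxHeartbeats 4000000 in
/-- The relations of the model which are not conjugate to each other. -/
theorem model_relations (hp : 1 ≤ p) :
    (modelCre₁ e * (modelCre₂ e * modelCre₂ e) - (modelCre₂ e * modelCre₂ e) * modelCre₁ e = 0) ∧
    (modelCre₁ e * (modelCre₁ e * modelCre₂ e - modelCre₂ e * modelCre₁ e) -
      (modelCre₁ e * modelCre₂ e - modelCre₂ e * modelCre₁ e) * modelCre₁ e = 0) ∧
    (modelAnn₁ e * (modelCre₁ e * modelCre₂ e - modelCre₂ e * modelCre₁ e) -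
      (modelCre₁ e * modelCre₂ e - modelCre₂ e * modelCre₁ e) * modelAnn₁ e = (2 : ℂ) • modelCre₂ e) ∧
    (modelAnn₂ e * (modelCre₁ e * modelCre₂ e - modelCre₂ e * modelCre₁ e) +
      (modelCre₁ e * modelCre₂ e - modelCre₂ e * modelCre₁ e) * modelAnn₂ e = (-2 : ℂ) • modelCre₁ e) ∧
    (modelAnn₁ e * (modelCre₂ e * modelCre₂ e) - (modelCre₂ e * modelCre₂ e) * modelAnn₁ e = 0) ∧
    (modelCre₁ e * (modelCre₁ e * modelAnn₂ e - modelAnn₂ e * modelCre₁ e) -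
      (modelCre₁ e * modelAnn₂ e - modelAnn₂ e * modelCre₁ e) * modelCre₁ e = 0) ∧
    (modelCre₁ e * modelAnn₁ e - modelAnn₁ e * modelCre₁ e = (2 : ℂ) • modelH₁ e) ∧
    (modelCre₂ e * modelAnn₂ e + modelAnn₂ e * modelCre₂ e = (2 : ℂ) • modelH₂ e) := by
  refine ⟨?_, ?_, ?_, ?_, ?_, ?_, ?_, ?_⟩ <;>
    (refine model_ext e ?_ ⟨?_, ?_, ?_, ?_⟩ fun k j hk hj hkj => ?_
     -- The sixth goal is the generic family of labels; the other five are the vacuum and the four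
     -- vectors with label `(1, 0)`, where the annihilation formulas differ.
     on_goal 6 =>
      -- In the variable `t = k + 2j` every denominator is of the form `i + t`.
      obtain ⟨t, ht⟩ : ∃ t : ℂ, (k : ℂ) = t - 2 * j := ⟨k + 2 * j, by ring⟩
      obtain ⟨hm, h0, h1, h2, h3, h4⟩ := denominators_ne_zero ht hkj
      obtain ⟨g0, g0c, g1, g2, y0, y1⟩ := coefficient_squares (p := p) ht hk hj
      refine ⟨?_, ?_, ?_, ?_⟩ <;>
        simp (disch := omega) only [Module.End.mul_apply, LinearMap.sub_apply, LinearMap.add_apply,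
          LinearMap.smul_apply, LinearMap.zero_apply, map_smul, map_add, map_sub, map_neg,
            map_zero, add_sub_cancel_right, sub_add_cancel, modelCre₁_vecA, modelCre₁_vecB,
              modelCre₁_vecC, modelCre₁_vecD, modelCre₂_vecA,
          modelCre₂_vecB, modelCre₂_vecC, modelCre₂_vecD,
          modelAnn₁_vecA, modelAnn₁_vecB, modelAnn₁_vecC, modelAnn₁_vecD, modelAnn₂_vecA,
          modelAnn₂_vecB, modelAnn₂_vecC, modelAnn₂_vecD, modelH₁_vecA, modelH₁_vecB, modelH₁_vecC,
            modelH₁_vecD, modelH₂_vecA,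
          modelH₂_vecB, modelH₂_vecC, modelH₂_vecD] <;>
        match_scalars <;> push_cast <;> (try simp only [ht]) <;> (try ring_nf) <;>
        (try field_simp) <;> (try ring_nf) <;> (try simp only [g0, g0c, g1, g2, y0, y1]) <;>
        (try ring)
     all_goals
      simp (disch := omega) only [Module.End.mul_apply, LinearMap.sub_apply, LinearMap.add_apply,
          LinearMap.smul_apply, LinearMap.zero_apply, map_smul, map_add, map_sub, map_neg,
            map_zero, add_sub_cancel_right, sub_add_cancel, modelCre₁_vac,
        modelCre₂_vac, modelAnn₁_vac, modelAnn₂_vac, modelAnn₁_vecA_one hp, modelAnn₁_vecC_one hp,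
        modelAnn₂_vecA_one hp, modelAnn₂_vecC_one hp, modelCre₁_vecA, modelCre₁_vecB,
          modelCre₁_vecC, modelCre₁_vecD, modelCre₂_vecA,
          modelCre₂_vecB, modelCre₂_vecC, modelCre₂_vecD, modelAnn₁_vecA,
        modelAnn₁_vecB, modelAnn₁_vecC, modelAnn₁_vecD, modelAnn₂_vecA, modelAnn₂_vecB,
        modelAnn₂_vecC, modelAnn₂_vecD, modelH₁_vac, modelH₂_vac, modelH₁_vecA, modelH₁_vecB,
          modelH₁_vecC, modelH₁_vecD, modelH₂_vecA,
          modelH₂_vecB, modelH₂_vecC, modelH₂_vecD, smul_zero, zero_add,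
        sub_self, gCoeff_zero, yCoeff_zero, zero_smul, zero_mul, zero_div]
      try simp only [one_add_one_eq_two, zero_add, Int.reduceAdd]
      try match_scalars <;> push_cast <;> (try norm_num) <;> (try ring_nf) <;> (try field_simp) <;>
        (try ring_nf) <;> (try simp only [special_squares]) <;> (try ring))

theorem modelCre₁_comm_modelAnn₁ (hp : 1 ≤ p) :
    modelCre₁ e * modelAnn₁ e - modelAnn₁ e * modelCre₁ e = (2 : ℂ) • modelH₁ e :=
  (model_relations hp).2.2.2.2.2.2.1

theorem modelCre₂_anticomm_modelAnn₂ (hp : 1 ≤ p) :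
    modelCre₂ e * modelAnn₂ e + modelAnn₂ e * modelCre₂ e = (2 : ℂ) • modelH₂ e :=
  (model_relations hp).2.2.2.2.2.2.2

end Model

/-! ### Formal adjoints -/

section Adjoint

variable {V : Type*} [NormedAddCommGroup V] [InnerProductSpace ℂ V]

/-- `T` is a formal adjoint of `S`. -/
def AdjointPair (S T : Module.End ℂ V) : Prop := ∀ v w, ⟪S v, w⟫_ℂ = ⟪v, T w⟫_ℂ

namespace AdjointPair

variable {S T S' T' : Module.End ℂ V}

theorem symm (h : AdjointPair S T) : AdjointPair T S := fun v w => by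
  rw [← inner_conj_symm, ← h, inner_conj_symm]

theorem add (h : AdjointPair S T) (h' : AdjointPair S' T') : AdjointPair (S + S') (T + T') :=
  fun v w => by
    rw [LinearMap.add_apply, LinearMap.add_apply, inner_add_left, inner_add_right, h, h']

theorem sub (h : AdjointPair S T) (h' : AdjointPair S' T') : AdjointPair (S - S') (T - T') :=
  fun v w => by
    rw [LinearMap.sub_apply, LinearMap.sub_apply, inner_sub_left, inner_sub_right, h, h']

theorem mul (h : AdjointPair S T) (h' : AdjointPair S' T') : AdjointPair (S * S') (T' * T) :=
  fun v w => by rw [Module.End.mul_apply, Module.End.mul_apply, h, h']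

theorem smul_real (r : ℝ) (h : AdjointPair S T) : AdjointPair ((r : ℂ) • S) ((r : ℂ) • T) :=
  fun v w => by
    rw [LinearMap.smul_apply, LinearMap.smul_apply, inner_smul_left, inner_smul_right, h,
      Complex.conj_ofReal]

theorem zero : AdjointPair (0 : Module.End ℂ V) 0 := fun v w => by simp

/-- Applied to two expressions for the same operator, this turns a relation into its conjugate
relation. -/
theorem unique (h : AdjointPair S T) (h' : AdjointPair S' T') (hS : S = S') : T = T' := by
  subst hS
  refine LinearMap.ext fun w => ext_inner_left ℂ fun v => ?_
  rw [← h, ← h']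

/-- It suffices to compare matrix elements. -/
theorem of_basis {ι : Type*} (e : Module.Basis ι ℂ V)
    (h : ∀ μ ν, ⟪S (e μ), e ν⟫_ℂ = ⟪e μ, T (e ν)⟫_ℂ) : AdjointPair S T := by
  have h1 : ∀ μ w, ⟪S (e μ), w⟫_ℂ = ⟪e μ, T w⟫_ℂ := fun μ w => by
    have : innerₛₗ ℂ (S (e μ)) = innerₛₗ ℂ (e μ) ∘ₗ T := e.ext fun ν => h μ ν
    exact LinearMap.congr_fun this w
  -- The inner product is conjugate linear in its first argument, so linearity there is used after
  -- exchanging the two sides.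
  refine symm fun w v => ?_
  have : innerₛₗ ℂ (T w) = innerₛₗ ℂ w ∘ₗ S := e.ext fun μ => by
    rw [LinearMap.comp_apply, innerₛₗ_apply_apply, innerₛₗ_apply_apply, ← inner_conj_symm, ← h1,
      inner_conj_symm]
  exact LinearMap.congr_fun this v

end AdjointPair

variable {p : ℕ} {e : Module.Basis (Pattern p) ℂ V}

theorem inner_ket (he : Orthonormal ℂ e) (a b c : ℤ) (ν : Pattern p) :
    ⟪ket e a b c, e ν⟫_ℂ = if a = ν.μ₁₂ ∧ b = ν.μ₂₂ ∧ c = ν.μ₁₁ then 1 else 0 := by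
  classical
  have hν := ν.isPattern
  by_cases h : IsPattern p a b c
  · rw [ket_of h, orthonormal_iff_ite.mp he]
    simp only [Pattern.ext_iff]
  · rw [ket_of_not h, inner_zero_left, if_neg]
    rintro ⟨rfl, rfl, rfl⟩
    exact h hν

theorem inner_ket_right (he : Orthonormal ℂ e) (a b c : ℤ) (ν : Pattern p) :
    ⟪e ν, ket e a b c⟫_ℂ = if a = ν.μ₁₂ ∧ b = ν.μ₂₂ ∧ c = ν.μ₁₁ then 1 else 0 := by
  rw [← inner_conj_symm, inner_ket he]
  split_ifs <;> simp

theorem ite_congr_mul {P Q : Prop} [Decidable P] [Decidable Q] {a b : ℂ} (h : P ↔ Q)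
    (hab : P → a = b) : a * (if P then 1 else 0) = b * (if Q then 1 else 0) := by
  by_cases hP : P
  · rw [if_pos hP, if_pos (h.mp hP), hab hP]
  · rw [if_neg hP, if_neg (fun hQ => hP (h.mpr hQ)), mul_zero, mul_zero]

/-- The terms of the annihilation operator shift the labels oppositely to those of the creation
operator, with coefficients evaluated at the shifted label; corresponding matrix elements are
compared. -/
theorem modelCre₁_adjoint (he : Orthonormal ℂ e) : AdjointPair (modelCre₁ e) (modelAnn₁ e) := by
  refine .of_basis e fun μ ν => ?_
  simp only [modelCre₁, modelAnn₁, Module.Basis.constr_basis, inner_sub_left, inner_sub_right,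
    inner_smul_left, inner_smul_right, Complex.conj_ofReal, inner_ket he, inner_ket_right he]
  congr 1 <;> refine ite_congr_mul (by omega) ?_ <;> rintro ⟨h1, h2, h3⟩
  · have e1 : (ν.μ₁₂ : ℝ) = μ.μ₁₂ + 1 := by exact_mod_cast h1.symm
    rw [← h2, e1, show ν.μ₁₂ - 1 = μ.μ₁₂ by omega, show ν.θ = μ.θ by unfold Pattern.θ; omega]
    congr 3; ring
  · have e2 : (ν.μ₂₂ : ℝ) = μ.μ₂₂ + 1 := by exact_mod_cast h2.symm
    have e3 : (ν.θ : ℝ) = μ.θ - 1 := by unfold Pattern.θ; rw [← h3, h1]; push_cast; ring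
    rw [← h1, e2, e3, show ν.μ₂₂ - 1 = μ.μ₂₂ by omega]
    rcases μ.isPattern.theta with h | h
    -- The target would have `θ = -1`.
    · exfalso
      have := ν.isPattern.theta
      omega
    · rw [show μ.θ = 1 from h]
      norm_num [add_assoc]

theorem modelCre₂_adjoint (he : Orthonormal ℂ e) : AdjointPair (modelCre₂ e) (modelAnn₂ e) := by
  refine .of_basis e fun μ ν => ?_
  simp only [modelCre₂, modelAnn₂, Module.Basis.constr_basis, inner_add_left, inner_add_right,
    inner_smul_left, inner_smul_right, Complex.conj_ofReal, inner_ket he, inner_ket_right he]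
  congr 1 <;> refine ite_congr_mul (by omega) ?_ <;> rintro ⟨h1, h2, h3⟩
  · have e1 : (ν.μ₁₂ : ℝ) = μ.μ₁₂ + 1 := by exact_mod_cast h1.symm
    have e3 : (ν.θ : ℝ) = μ.θ + 1 := by unfold Pattern.θ; rw [← h3, ← h1]; push_cast; ring
    rw [← h2, e1, e3, show ν.μ₁₂ - 1 = μ.μ₁₂ by omega]
    rcases μ.isPattern.theta with h | h
    · rw [show μ.θ = 0 from h]
      norm_num [add_right_comm]
    -- The target would have `θ = 2`.
    · exfalso
      have := ν.isPattern.theta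
      omega
  · have e2 : (ν.μ₂₂ : ℝ) = μ.μ₂₂ + 1 := by exact_mod_cast h2.symm
    rw [← h1, ← h3, e2, show ν.θ = μ.θ by unfold Pattern.θ; omega,
      show ν.μ₂₂ - 1 = μ.μ₂₂ by omega]
    congr 5 <;> ring

end Adjoint

/-- The triple relations in the usual normalization of the generators. -/
theorem OspTriple.of_scaled {R : Type*} [Ring R] [Algebra ℂ R] {P M Q N H₁ H₂ : R} {α : ℂ}
    (hα : α * α = 1 / 2)
    (PM : P * M - M * P = (2 : ℂ) • H₁) (QN : Q * N + N * Q = (2 : ℂ) • H₂)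
    (h₁P : H₁ * P - P * H₁ = P) (h₁M : H₁ * M - M * H₁ = -M)
    (h₁Q : H₁ * Q - Q * H₁ = 0) (h₁N : H₁ * N - N * H₁ = 0)
    (h₂P : H₂ * P - P * H₂ = 0) (h₂M : H₂ * M - M * H₂ = 0)
    (h₂Q : H₂ * Q - Q * H₂ = Q) (h₂N : H₂ * N - N * H₂ = -N)
    (PQQ : P * (Q * Q) - (Q * Q) * P = 0) (MQQ : M * (Q * Q) - (Q * Q) * M = 0)
    (PNN : P * (N * N) - (N * N) * P = 0) (MNN : M * (N * N) - (N * N) * M = 0)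
    (PPQ : P * (P * Q - Q * P) - (P * Q - Q * P) * P = 0)
    (PPN : P * (P * N - N * P) - (P * N - N * P) * P = 0)
    (MMQ : M * (M * Q - Q * M) - (M * Q - Q * M) * M = 0)
    (MMN : M * (M * N - N * M) - (M * N - N * M) * M = 0)
    (MPQ : M * (P * Q - Q * P) - (P * Q - Q * P) * M = (2 : ℂ) • Q)
    (PMN : P * (M * N - N * M) - (M * N - N * M) * P = (2 : ℂ) • N)
    (NPQ : N * (P * Q - Q * P) + (P * Q - Q * P) * N = (-2 : ℂ) • P)
    (QMN : Q * (M * N - N * M) + (M * N - N * M) * Q = (2 : ℂ) • M) :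
    OspTriple (α • P) (α • M) (α • Q) (α • N) := by
  -- All relations are cubic in the generators on the left and linear on the right; since `α³ = α /
  -- 2`, the rescaling absorbs the factor `2`.
  have scale : ∀ {S T W : R}, S = (α * α * α) • T → T = (2 : ℂ) • W → S = α • W := by
    rintro S T W rfl rfl
    rw [hα, smul_smul]
    congr 1; ring
  have comm₁ : ∀ {X W : R}, H₁ * X - X * H₁ = W →
      (P * M - M * P) * X - X * (P * M - M * P) = (2 : ℂ) • W := by
    rintro X W rfl
    rw [PM, smul_mul_assoc, mul_smul_comm, smul_sub]
  have comm₂ : ∀ {X W : R}, H₂ * X - X * H₂ = W →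
      (Q * N + N * Q) * X - X * (Q * N + N * Q) = (2 : ℂ) • W := by
    rintro X W rfl
    rw [QN, smul_mul_assoc, mul_smul_comm, smul_sub]
  have zero : ∀ {T : R}, T = 0 → T = (2 : ℂ) • 0 := by rintro T rfl; simp
  have neg_two : ∀ {T W : R}, T = (-2 : ℂ) • W → T = (2 : ℂ) • -W := by rintro T W rfl; simp
  refine ⟨(scale ?_ (comm₁ h₁P)).trans rfl,
    (scale ?_ (comm₁ h₁M)).trans (smul_neg α M),
    (scale ?_ (comm₁ h₁Q)).trans (smul_zero α),
    (scale ?_ (comm₁ h₁N)).trans (smul_zero α),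
    (scale ?_ (comm₂ h₂P)).trans (smul_zero α),
    (scale ?_ (comm₂ h₂M)).trans (smul_zero α),
    (scale ?_ (comm₂ h₂Q)).trans rfl,
    (scale ?_ (comm₂ h₂N)).trans (smul_neg α N),
    (scale ?_ (zero PQQ)).trans (smul_zero α),
    (scale ?_ (zero MQQ)).trans (smul_zero α),
    (scale ?_ (zero PNN)).trans (smul_zero α),
    (scale ?_ (zero MNN)).trans (smul_zero α),
    (scale ?_ (zero PPQ)).trans (smul_zero α),
    (scale ?_ (zero PPN)).trans (smul_zero α),
    (scale ?_ (zero MMQ)).trans (smul_zero α),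
    (scale ?_ (zero MMN)).trans (smul_zero α),
    (scale ?_ (MPQ)).trans rfl,
    (scale ?_ (PMN)).trans rfl,
    (scale ?_ (neg_two NPQ)).trans (smul_neg α P),
    (scale ?_ (QMN)).trans rfl⟩
  all_goals
    simp only [smul_mul_assoc, mul_smul_comm, smul_sub, smul_add, mul_sub, sub_mul, mul_add,
      add_mul, mul_assoc]
    module

/-! ### The model is a Fock space with the required basis -/

section ModelFock

variable {p : ℕ} {V : Type*} [NormedAddCommGroup V] [InnerProductSpace ℂ V]
  {e : Module.Basis (Pattern p) ℂ V}

/-- The normalization `1 / √2` of the generators of the triple system. -/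
noncomputable def tripleScale : ℂ := ((√2 : ℝ) : ℂ)⁻¹

theorem tripleScale_mul_self : tripleScale * tripleScale = 1 / 2 := by
  rw [tripleScale, ← mul_inv, ← sq, ofReal_sqrt_sq (by norm_num)]
  norm_num

theorem sqrt_two_smul_tripleScale (T : Module.End ℂ V) :
    ((√2 : ℝ) : ℂ) • tripleScale • T = T := by
  rw [tripleScale, smul_inv_smul₀]
  simp

/-- Taking adjoints exchanges `P` with `M` and `Q` with `N` and reverses products. This supplies the
six missing relations: `MNN` from `PQQ`, `PNN` from `MQQ`, `MMN` from `PPQ`, `MMQ` from `PPN`, `PMN`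
from `MPQ` and `QMN` from `NPQ`. -/
theorem model_ospTriple (hp : 1 ≤ p) (he : Orthonormal ℂ e) :
    OspTriple (tripleScale • modelCre₁ e) (tripleScale • modelAnn₁ e)
      (tripleScale • modelCre₂ e) (tripleScale • modelAnn₂ e) := by
  obtain ⟨hPQQ, hPPQ, hMPQ, hNPQ, hMQQ, hPPN, hPM, hQN⟩ := model_relations (e := e) hp
  have a₁ := modelCre₁_adjoint he
  have a₂ := modelCre₂_adjoint he
  have t : AdjointPair ((2 : ℂ) • modelCre₁ e) ((2 : ℂ) • modelAnn₁ e) := by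
    simpa using a₁.smul_real 2
  have t₁ : AdjointPair ((-2 : ℂ) • modelCre₁ e) ((-2 : ℂ) • modelAnn₁ e) := by
    simpa using a₁.smul_real (-2)
  have t₂ : AdjointPair ((2 : ℂ) • modelCre₂ e) ((2 : ℂ) • modelAnn₂ e) := by
    simpa using a₂.smul_real 2
  have PQ := (a₁.mul a₂).sub (a₂.mul a₁)
  have PN := (a₁.mul a₂.symm).sub (a₂.symm.mul a₁)
  have PQQ := ((a₁.mul (a₂.mul a₂)).sub ((a₂.mul a₂).mul a₁)).unique .zero hPQQ
  have MQQ := ((a₁.symm.mul (a₂.mul a₂)).sub ((a₂.mul a₂).mul a₁.symm)).unique .zero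
    hMQQ
  have PPQ := ((a₁.mul PQ).sub (PQ.mul a₁)).unique .zero hPPQ
  have PPN := ((a₁.mul PN).sub (PN.mul a₁)).unique .zero hPPN
  have MPQ := ((a₁.symm.mul PQ).sub (PQ.mul a₁.symm)).unique t₂ hMPQ
  have NPQ := ((a₂.symm.mul PQ).add (PQ.mul a₂.symm)).unique t₁ hNPQ
  refine .of_scaled tripleScale_mul_self hPM hQN modelH₁_comm_modelCre₁
    modelH₁_comm_modelAnn₁ modelH₁_comm_modelCre₂ modelH₁_comm_modelAnn₂ modelH₂_comm_modelCre₁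
    modelH₂_comm_modelAnn₁ modelH₂_comm_modelCre₂ modelH₂_comm_modelAnn₂ hPQQ hMQQ
    ?_ ?_ hPPQ hPPN ?_ ?_ hMPQ ?_ hNPQ ?_
  · rw [← neg_eq_zero, ← MQQ]; noncomm_ring
  · rw [← neg_eq_zero, ← PQQ]; noncomm_ring
  · rw [← PPN]; noncomm_ring
  · rw [← PPQ]; noncomm_ring
  · rw [← MPQ]; noncomm_ring
  · rw [← neg_inj, ← neg_smul, ← NPQ]; noncomm_ring

end ModelFock

section ModelFock

variable {p : ℕ} {V : Type*} [NormedAddCommGroup V] [InnerProductSpace ℂ V]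
  (e : Module.Basis (Pattern p) ℂ V)

/-- The representation of `osp(3|2)` on the model. -/
noncomputable def modelRep : osp32 →ₗ[ℂ] Module.End ℂ V :=
  ospOperators (tripleScale • modelCre₁ e) (tripleScale • modelAnn₁ e)
    (tripleScale • modelCre₂ e) (tripleScale • modelAnn₂ e)

theorem modelRep_apply {A : Matrix (Fin 5) (Fin 5) ℂ} (hA : A ∈ osp32) :
    modelRep e ⟨A, hA⟩ = ospExtend (tripleScale • modelCre₁ e) (tripleScale • modelAnn₁ e)
      (tripleScale • modelCre₂ e) (tripleScale • modelAnn₂ e) A := rfl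

theorem cPlus_modelRep_zero : cPlus (modelRep e) 0 = modelCre₁ e := by
  rw [cPlus, modelRep_apply, cPlusMatrix_zero, map_smul, ospExtend_ospMatrix]
  simp [sqrt_two_smul_tripleScale, -Complex.coe_smul]

theorem cPlus_modelRep_one : cPlus (modelRep e) 1 = modelCre₂ e := by
  rw [cPlus, modelRep_apply, cPlusMatrix_one, map_smul, ospExtend_ospMatrix]
  simp [sqrt_two_smul_tripleScale, -Complex.coe_smul]

theorem cMinus_modelRep_zero : cMinus (modelRep e) 0 = modelAnn₁ e := by
  rw [cMinus, modelRep_apply, cMinusMatrix_zero, map_smul, ospExtend_ospMatrix]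
  simp [sqrt_two_smul_tripleScale, -Complex.coe_smul]

theorem cMinus_modelRep_one : cMinus (modelRep e) 1 = modelAnn₂ e := by
  rw [cMinus, modelRep_apply, cMinusMatrix_one, map_smul, ospExtend_ospMatrix]
  simp [sqrt_two_smul_tripleScale, -Complex.coe_smul]

theorem hMatrix_zero : hMatrix 0 = ospMatrix 1 0 0 0 0 0 0 0 0 0 0 0 := by
  ext i j; fin_cases i <;> fin_cases j <;> simp [hMatrix, ospMatrix]

theorem hMatrix_one : hMatrix 1 = ospMatrix 0 0 0 1 0 0 0 0 0 0 0 0 := by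
  ext i j; fin_cases i <;> fin_cases j <;> simp [hMatrix, ospMatrix]

theorem hOp_modelRep_zero (hp : 1 ≤ p) : hOp (modelRep e) 0 = modelH₁ e := by
  rw [hOp, modelRep_apply, hMatrix_zero, ospExtend_ospMatrix]
  simp only [smul_mul_assoc, mul_smul_comm, smul_smul, tripleScale_mul_self, ← smul_sub,
    modelCre₁_comm_modelAnn₁ hp]
  module

theorem hOp_modelRep_one (hp : 1 ≤ p) : hOp (modelRep e) 1 = modelH₂ e := by
  rw [hOp, modelRep_apply, hMatrix_one, ospExtend_ospMatrix]
  simp only [smul_mul_assoc, mul_smul_comm, smul_smul, tripleScale_mul_self, ← smul_add,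
    modelCre₂_anticomm_modelAnn₂ hp]
  module

variable {e}

theorem gCoeff_ne_zero {k : ℤ} (h : 1 ≤ k) (hk : k < p) : gCoeff p k ≠ 0 := by
  intro h0
  have := gCoeff_sq (p := p) (k := k) (by omega)
  rw [h0, zero_pow two_ne_zero, eq_comm, mul_eq_zero] at this
  norm_cast at this
  omega

theorem yCoeff_ne_zero {j : ℤ} (h : 1 ≤ j) : yCoeff p j ≠ 0 := by
  intro h0
  have := yCoeff_sq (p := p) (j := j) (by omega)
  rw [h0, zero_pow two_ne_zero, eq_comm, mul_eq_zero] at this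
  norm_cast at this
  omega

/-- The vacuum is cyclic for the creation operators. -/
theorem model_generated (hp : 1 ≤ p) (U : Submodule ℂ V) (h0 : modelVac e ∈ U)
    (h₁ : ∀ v ∈ U, modelCre₁ e v ∈ U) (h₂ : ∀ v ∈ U, modelCre₂ e v ∈ U) : U = ⊤ := by
  have div : ∀ {r : ℂ} {v : V}, r ≠ 0 → r • v ∈ U → v ∈ U := fun hr hv =>
    (Submodule.smul_mem_iff U hr).mp hv
  have hsp : ((√p : ℝ) : ℂ) ≠ 0 := ofReal_sqrt_ne (by exact_mod_cast hp)
  -- With `s = k + 2j`, `c₂⁺ A - c₁⁺ C = (s + 1) B` and `c₂⁺ C = -(s + 1) D`.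
  have BD : ∀ k j : ℤ, 1 ≤ k → 0 ≤ j → vecA e k j ∈ U → vecC e k j ∈ U →
      vecB e k j ∈ U ∧ vecD e k j ∈ U := by
    intro k j hk hj hA hC
    have hs : (k + 2 * j + 1 : ℂ) ≠ 0 := by exact_mod_cast (by omega : k + 2 * j + 1 ≠ 0)
    constructor
    · refine div hs ?_
      have := U.sub_mem (h₂ _ hA) (h₁ _ hC)
      rw [modelCre₁_vecC (by omega) (by omega), modelCre₂_vecA (by omega) (by omega)] at this
      convert this using 1
      module
    · have := h₂ _ hC
      rw [modelCre₂_vecC (by omega) (by omega)] at this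
      exact div (neg_ne_zero.mpr hs) this
  -- At `j = 0` the label `k` is raised by `c₁⁺ A = g A'` and `c₁⁺ C + B = g C'`, where `g ≠ 0` as
  -- long as `k < p`.
  have AC : ∀ j k : ℕ, (k : ℤ) + 1 ≤ p → vecA e (k + 1) j ∈ U ∧ vecC e (k + 1) j ∈ U := by
    intro j
    induction j with
    | zero =>
      intro k
      induction k with
      | zero =>
        intro _
        have hA := h₁ _ h0
        have hC := h₂ _ h0
        rw [modelCre₁_vac] at hA
        rw [modelCre₂_vac] at hC
        exact ⟨by simpa using div hsp hA, by simpa using div hsp hC⟩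
      | succ k ih =>
        intro hk
        push_cast at hk ⊢
        obtain ⟨hA, hC⟩ := ih (by omega)
        obtain ⟨hB, -⟩ := BD _ _ (by omega) (by omega) hA hC
        have hg : gCoeff p (k + 1 : ℤ) ≠ 0 := gCoeff_ne_zero (by omega) (by omega)
        have hA' := h₁ _ hA
        have hC' := U.add_mem (h₁ _ hC) hB
        rw [modelCre₁_vecA (by omega) (by omega)] at hA'
        rw [modelCre₁_vecC (by omega) (by omega), sub_add_cancel] at hC'
        exact ⟨div hg hA', div hg hC'⟩
    | succ j ih =>
      intro k hk
      obtain ⟨hA, hC⟩ := ih k hk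
      obtain ⟨hB, hD⟩ := BD _ _ (by omega) (by omega) hA hC
      have hy : yCoeff p (j + 1 : ℤ) ≠ 0 := yCoeff_ne_zero (by omega)
      have s1 : (((k + 1 : ℤ) : ℂ) + 2 * (j : ℤ) + 1) ≠ 0 := by
        exact_mod_cast (by omega : (k : ℤ) + 1 + 2 * j + 1 ≠ 0)
      have s2 : (((k + 1 : ℤ) : ℂ) + 2 * (j : ℤ) + 2) ≠ 0 := by
        exact_mod_cast (by omega : (k : ℤ) + 1 + 2 * j + 2 ≠ 0)
      -- The label `j` is raised at fixed `k`: the `D` terms cancel in `c₂⁺ B - c₁⁺ D`, leaving `y /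
      -- (s + 1)` times the next `A`, and `c₂⁺ D` is `-y / (s + 1)` times the next `C`.
      have hA' := U.sub_mem (h₂ _ hB) (h₁ _ hD)
      have hC' := h₂ _ hD
      rw [modelCre₁_vecD (by omega) (by omega), modelCre₂_vecB (by omega) (by omega)] at hA'
      rw [modelCre₂_vecD (by omega) (by omega)] at hC'
      rw [Nat.cast_succ]
      refine ⟨div (div_ne_zero hy s1) ?_, div (neg_ne_zero.mpr (div_ne_zero hy s1)) hC'⟩
      convert hA' using 1
      match_scalars
      · push_cast at s1 s2 ⊢
        field_simp
        ring
      · ring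
  have all : ∀ k j : ℤ, 1 ≤ k → 0 ≤ j → k ≤ p → vecA e k j ∈ U ∧ vecB e k j ∈ U ∧
      vecC e k j ∈ U ∧ vecD e k j ∈ U := by
    intro k j hk hj hkp
    obtain ⟨hA, hC⟩ := AC j.toNat (k - 1).toNat (by omega)
    rw [show (((k - 1).toNat : ℤ) + 1) = k by omega, show (j.toNat : ℤ) = j by omega] at hA hC
    obtain ⟨hB, hD⟩ := BD k j hk hj hA hC
    exact ⟨hA, hB, hC, hD⟩
  rw [eq_top_iff, ← e.span_eq, Submodule.span_le]
  rintro _ ⟨⟨k, l, m, hμ⟩, rfl⟩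
  rw [← ket_of hμ]
  obtain ⟨h1, h2, h3, h4, h5, h6⟩ := hμ
  by_cases hk : k = 0
  · obtain ⟨rfl, rfl, rfl⟩ : k = 0 ∧ l = 0 ∧ m = 0 := by omega
    exact h0
  have hkR : (1 : ℝ) ≤ k := by exact_mod_cast (by omega : 1 ≤ k)
  rcases Int.even_or_odd' l with ⟨j, rfl | rfl⟩ <;>
    obtain ⟨hA, hB, hC, hD⟩ := all k j (by omega) (by omega) h2 <;>
    have hj : (0 : ℝ) ≤ j := by exact_mod_cast (by omega : 0 ≤ j)
  · rcases h5 with h5 | h5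
    · obtain rfl : m = k := by omega
      exact div (ofReal_sqrt_ne (by linarith)) hA
    · obtain rfl : m = k - 1 := by omega
      exact hC
  · rcases h5 with h5 | h5
    · obtain rfl : m = k := by omega
      exact hB
    · obtain rfl : m = k - 1 := by omega
      exact div (inv_ne_zero (ofReal_sqrt_ne (by linarith))) hD

theorem model_isParaFock (hp : 1 ≤ p) (he : Orthonormal ℂ e) :
    IsParaFock p (modelRep e) (modelVac e) where
  rep := by
    refine (model_ospTriple hp he).isOspRep (Z := modelParity e) modelParity_mul_self ?_ ?_ ?_ ?_
    · rw [mul_smul_comm, smul_mul_assoc, modelParity_mul_modelCre₁]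
    · rw [mul_smul_comm, smul_mul_assoc, modelParity_mul_modelAnn₁]
    · rw [mul_smul_comm, smul_mul_assoc, modelParity_mul_modelCre₂, smul_neg]
    · rw [mul_smul_comm, smul_mul_assoc, modelParity_mul_modelAnn₂, smul_neg]
  adjoint j v w := by
    fin_cases j
    · simpa [cPlus_modelRep_zero, cMinus_modelRep_zero] using modelCre₁_adjoint he v w
    · simpa [cPlus_modelRep_one, cMinus_modelRep_one] using modelCre₂_adjoint he v w
  vac_norm := by
    rw [modelVac, ket_of isPattern_zero, inner_self_eq_norm_sq_to_K, he.1]; simp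
  annihilate j := by
    fin_cases j
    · simpa [cMinus_modelRep_zero] using modelAnn₁_vac
    · simpa [cMinus_modelRep_one] using modelAnn₂_vac
  vac_bracket j k := by
    have hsp : ((√p : ℝ) : ℂ) * ((√p : ℝ) : ℂ) = p := by
      rw [← sq, ofReal_sqrt_sq (Nat.cast_nonneg p)]; simp
    fin_cases j <;> fin_cases k <;>
      simp [cMinus_modelRep_zero, cMinus_modelRep_one, cPlus_modelRep_zero, cPlus_modelRep_one,
        cDeg, superComm_zero_left, superComm_zero_right, superComm_one_one, modelAnn₁_vac,
        modelAnn₂_vac, modelCre₁_vac, modelCre₂_vac, modelAnn₁_vecA_one hp,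
        modelAnn₁_vecC_one hp, modelAnn₂_vecA_one hp, modelAnn₂_vecC_one hp, smul_smul, hsp,
        -Complex.coe_smul]
  generated U h0 hU := by
    refine model_generated hp U h0 (fun v hv => ?_) fun v hv => ?_
    · rw [← cPlus_modelRep_zero]; exact hU _ v hv
    · rw [← cPlus_modelRep_one]; exact hU _ v hv

theorem model_isKetBasis (hp : 1 ≤ p) (he : Orthonormal ℂ e) :
    IsKetBasis p (modelRep e) (modelVac e) e where
  orthonormal := he
  vacuum := rfl
  h₁ μ := by rw [hOp_modelRep_zero e hp, modelH₁_basis]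
  h₂ μ := by rw [hOp_modelRep_one e hp, modelH₂_basis]
  c₁_plus μ := by rw [cPlus_modelRep_zero, modelCre₁, Module.Basis.constr_basis]
  c₂_plus μ := by rw [cPlus_modelRep_one, modelCre₂, Module.Basis.constr_basis]
  c₁_minus μ := by rw [cMinus_modelRep_zero, modelAnn₁, Module.Basis.constr_basis]
  c₂_minus μ := by rw [cMinus_modelRep_one, modelAnn₂, Module.Basis.constr_basis]

end ModelFock

/-- The Fock space `V(p)` exists. -/
theorem exists_isParaFock {p : ℕ} (hp : 1 ≤ p) :
    ∃ (V : Type) (_ : NormedAddCommGroup V) (_ : InnerProductSpace ℂ V)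
      (ρ : osp32 →ₗ[ℂ] Module.End ℂ V) (vac : V) (e : Module.Basis (Pattern p) ℂ V),
      IsParaFock p ρ vac ∧ IsKetBasis p ρ vac e := by
  obtain ⟨V, _, _, e, he⟩ := exists_orthonormal_basis (Pattern p)
  exact ⟨V, _, _, modelRep e, modelVac e, e, model_isParaFock hp he, model_isKetBasis hp he⟩

/-- The basis of the model is transported along the isometry that exists by uniqueness. -/
theorem IsParaFock.exists_isKetBasis {p : ℕ} (hp : 1 ≤ p) {V : Type*} [NormedAddCommGroup V]
    [InnerProductSpace ℂ V] {ρ : osp32 →ₗ[ℂ] Module.End ℂ V} {vac : V}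
    (h : IsParaFock p ρ vac) : ∃ e : Module.Basis (Pattern p) ℂ V, IsKetBasis p ρ vac e := by
  obtain ⟨V', _, _, ρ', vac', e, h', he⟩ := exists_isParaFock hp
  obtain ⟨Φ, hvac, hΦ⟩ := h'.exists_equiv h
  exact ⟨_, he.map Φ hvac hΦ⟩

/-! ### The Hamiltonian as a Cartan element -/

section Hamiltonian

variable {V : Type*} [AddCommGroup V] [Module ℂ V] {ρ : osp32 →ₗ[ℂ] Module.End ℂ V}

/-- The last identity holds already for matrices: with `E = bP - cM`, the bracket of `[E, Q]` and
`[E, N]` is `2bc h₂`. The combinations `c₁⁻ ∓ c₁⁺` in `a₁^±`, `a₂^±` are, up to `√2`, of this form.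
-/
theorem IsOspRep.exists_generators (h : IsOspRep ρ) : ∃ P M Q N : Module.End ℂ V,
    cPlus ρ 0 = ((√2 : ℝ) : ℂ) • P ∧ cMinus ρ 0 = ((√2 : ℝ) : ℂ) • M ∧
    cPlus ρ 1 = ((√2 : ℝ) : ℂ) • Q ∧ cMinus ρ 1 = ((√2 : ℝ) : ℂ) • N ∧
    Q * N + N * Q = hOp ρ 1 ∧ ∀ b c : ℂ,
      ((b • P - c • M) * Q - Q * (b • P - c • M)) * ((b • P - c • M) * N - N * (b • P - c • M)) +
      ((b • P - c • M) * N - N * (b • P - c • M)) * ((b • P - c • M) * Q - Q * (b • P - c • M)) =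
      (2 * b * c) • hOp ρ 1 := by
  obtain ⟨f, hf, hb⟩ := h.exists_extend
  have hQ : ospMatrix 0 0 0 0 0 0 0 0 0 0 0 1 ∈ ospPart 1 := ⟨0, 0, 0, 0, 0, 1, rfl⟩
  have hN : ospMatrix 0 0 0 0 0 0 0 0 1 0 0 0 ∈ ospPart 1 := ⟨0, 0, 1, 0, 0, 0, rfl⟩
  have h2 : hOp ρ 1 = f (hMatrix 1) := (hf _).symm
  refine ⟨f (ospMatrix 0 1 0 0 0 0 0 0 0 0 0 0), f (ospMatrix 0 0 (-1) 0 0 0 0 0 0 0 0 0),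
    f (ospMatrix 0 0 0 0 0 0 0 0 0 0 0 1), f (ospMatrix 0 0 0 0 0 0 0 0 1 0 0 0),
    ?_, ?_, ?_, ?_, ?_, fun b c => ?_⟩
  · rw [← map_smul, ← cPlusMatrix_zero]; exact (hf _).symm
  · rw [← map_smul, ← cMinusMatrix_zero]; exact (hf _).symm
  · rw [← map_smul, ← cPlusMatrix_one]; exact (hf _).symm
  · rw [← map_smul, ← cMinusMatrix_one]; exact (hf _).symm
  · have := hb 1 1 _ hQ _ hN
    rw [odd_comm_odd, superComm_one_one] at this
    rw [← this, h2, hMatrix_one]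
    congr 2 <;> ring
  · have hE : b • f (ospMatrix 0 1 0 0 0 0 0 0 0 0 0 0) - c • f (ospMatrix 0 0 (-1) 0 0 0 0 0 0 0 0 0)
        = f (ospMatrix 0 b c 0 0 0 0 0 0 0 0 0) := by
      rw [← map_smul, ← map_smul, ← map_sub, sub_eq_add_neg, ospMatrix_smul, ospMatrix_smul,
        ospMatrix_neg, ospMatrix_add]
      congr 2 <;> ring
    have hE' : ospMatrix 0 b c 0 0 0 0 0 0 0 0 0 ∈ ospPart 0 := ⟨0, b, c, 0, 0, 0, rfl⟩
    have e1 := hb 0 1 _ hE' _ hQ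
    have e2 := hb 0 1 _ hE' _ hN
    have e3 := hb 1 1 _ (superComm_mem hE' hQ) _ (superComm_mem hE' hN)
    rw [e1, e2, even_comm_odd, even_comm_odd, odd_comm_odd, superComm_one_one,
      superComm_zero_left, superComm_zero_left] at e3
    rw [hE, ← e3, h2, hMatrix_one, ← map_smul, ospMatrix_smul]
    congr 2 <;> ring

theorem IsOspRep.anticommutator (h : IsOspRep ρ) :
    cPlus ρ 1 * cMinus ρ 1 + cMinus ρ 1 * cPlus ρ 1 = (2 : ℂ) • hOp ρ 1 := by
  obtain ⟨P, M, Q, N, -, -, e3, e4, hQN, -⟩ := h.exists_generators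
  have h2 : ((√2 : ℝ) : ℂ) * ((√2 : ℝ) : ℂ) = 2 := by
    rw [← sq, ofReal_sqrt_sq (by norm_num)]; norm_num
  rw [e3, e4, ← hQN]
  simp only [smul_mul_assoc, mul_smul_comm, smul_smul, h2, ← smul_add]

/-- Each `k` contributes `(2/3) h₂`: for `k = 1, 2` this is `r² · 8bc` with `r² = ±1/12` and `bc =
±1` of the same sign, and for `k = 3` it is `(1/3) · 2`. -/
theorem IsOspRep.sum_anticommutator (h : IsOspRep ρ) :
    ∑ k, (aPlus ρ k * aMinus ρ k + aMinus ρ k * aPlus ρ k) = (2 : ℂ) • hOp ρ 1 := by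
  obtain ⟨P, M, Q, N, e1, e2, e3, e4, hQN, hE⟩ := h.exists_generators
  have h2 : ((√2 : ℝ) : ℂ) ^ 2 = 2 := by
    rw [ofReal_sqrt_sq (by norm_num)]; norm_num
  have h3 : (((√3 : ℝ) : ℂ)⁻¹) ^ 2 = 1 / 3 := by
    rw [inv_pow, ofReal_sqrt_sq (by norm_num)]; norm_num
  have h4 : ((√2 : ℝ) : ℂ) ^ 4 = 4 := by
    rw [show 4 = 2 * 2 from rfl, pow_mul, h2]; norm_num
  have pair : ∀ (r b c : ℂ) (X : Module.End ℂ V), X = ((√2 : ℝ) : ℂ) • (b • P - c • M) →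
      (r • ⁅X, cPlus ρ 1⁆) * (r • ⁅X, cMinus ρ 1⁆) + (r • ⁅X, cMinus ρ 1⁆) * (r • ⁅X, cPlus ρ 1⁆) =
        (r ^ 2 * (8 * b * c)) • hOp ρ 1 := by
    rintro r b c X rfl
    rw [show r ^ 2 * (8 * b * c) = (r ^ 2 * ((√2 : ℝ) : ℂ) ^ 4) * (2 * b * c) by rw [h4]; ring,
      mul_smul, ← hE, e3, e4]
    simp only [Ring.lie_def]
    generalize b • P - c • M = Y
    simp only [smul_mul_assoc, mul_smul_comm, smul_smul, ← smul_sub, smul_add]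
    congr 2 <;> ring
  rw [Fin.sum_univ_three]
  simp only [aPlus, aMinus, Matrix.cons_val_zero, Matrix.cons_val_one, Matrix.cons_val]
  rw [pair _ (-1) (-1) _ (by rw [e1, e2]; module), pair _ 1 (-1) _ (by rw [e1, e2]; module), e3, e4]
  simp only [smul_mul_assoc, mul_smul_comm, smul_smul, ← smul_add, hQN, ← add_smul]
  congr 1
  linear_combination (8 / 4 - 8 / 4 * Complex.I ^ 2 + ((√2 : ℝ) : ℂ) ^ 2) * h3 +
    (1 / 3) * h2 - (2 / 3) * Complex.I_sq

theorem IsOspRep.hamiltonian_eq (h : IsOspRep ρ) {m ω ħ : ℝ} (hm : 0 < m) (hω : 0 < ω)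
    (hħ : 0 < ħ) : hamiltonian ρ m ω ħ = (ħ * ω : ℂ) • hOp ρ 1 := by
  have hs := h.sum_anticommutator
  have hmC : (m : ℂ) ≠ 0 := by exact_mod_cast hm.ne'
  have hωC : (ω : ℂ) ≠ 0 := by exact_mod_cast hω.ne'
  have r2 : ((√(ħ / (2 * m * ω)) : ℝ) : ℂ) ^ 2 = ħ / (2 * m * ω) := by
    rw [ofReal_sqrt_sq (by positivity)]; push_cast; rfl
  have p2 : ((√(m * ω * ħ / 2) : ℝ) : ℂ) ^ 2 = m * ω * ħ / 2 := by
    rw [ofReal_sqrt_sq (by positivity)]; push_cast; rfl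
  -- The two terms are `-ħω/4` times the square of `a⁺ - a⁻` and `ħω/4` times the square of `a⁺ +
  -- a⁻`, so only the mixed products remain.
  have key : ∀ k, (1 / (2 * m) : ℂ) • momentumOp ρ m ω ħ k ^ 2 +
      (m * ω ^ 2 / 2 : ℂ) • positionOp ρ m ω ħ k ^ 2 =
      (ħ * ω / 2 : ℂ) • (aPlus ρ k * aMinus ρ k + aMinus ρ k * aPlus ρ k) := by
    intro k
    rw [momentumOp, positionOp, smul_pow, smul_pow, mul_pow, r2, p2, Complex.I_sq, smul_smul,
      smul_smul, show (1 / (2 * m) * (-1 * (m * ω * ħ / 2)) : ℂ) = -(ħ * ω / 4) by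
        field_simp; norm_num [mul_comm], show (m * ω ^ 2 / 2 * (ħ / (2 * m * ω)) : ℂ) = ħ * ω / 4 by
        field_simp; norm_num [mul_comm]]
    simp only [sq, mul_add, add_mul, mul_sub, sub_mul]
    module
  rw [hamiltonian, Finset.smul_sum, Finset.smul_sum, ← Finset.sum_add_distrib,
    Finset.sum_congr rfl fun k _ => key k, ← Finset.smul_sum, hs, smul_smul]
  congr 1; ring

end Hamiltonian

section

variable {p : ℕ} {V : Type*} [NormedAddCommGroup V] [InnerProductSpace ℂ V]
  {ρ : osp32 →ₗ[ℂ] Module.End ℂ V} {vac : V} {m ω ħ : ℝ}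

theorem IsParaFock.hamiltonian_apply (h : IsParaFock p ρ vac) (hm : 0 < m) (hω : 0 < ω)
    (hħ : 0 < ħ) {e : Module.Basis (Pattern p) ℂ V} (he : IsKetBasis p ρ vac e) (μ : Pattern p) :
    hamiltonian ρ m ω ħ (e μ) = (ħ * ω / 2 * (p + 2 * μ.μ₂₂ + 2 * μ.θ) : ℂ) • e μ := by
  rw [h.rep.hamiltonian_eq hm hω hħ, LinearMap.smul_apply, he.h₂, smul_smul]
  congr 1
  simp only [Pattern.θ]
  push_cast
  ring

theorem IsParaFock.hamiltonian_apply_eq_anticommutator (h : IsParaFock p ρ vac) (hm : 0 < m)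
    (hω : 0 < ω) (hħ : 0 < ħ) (v : V) : hamiltonian ρ m ω ħ v =
      (ħ * ω / 2 : ℂ) • (cPlus ρ 1 * cMinus ρ 1 + cMinus ρ 1 * cPlus ρ 1) v := by
  rw [h.rep.hamiltonian_eq hm hω hħ, h.rep.anticommutator, LinearMap.smul_apply,
    LinearMap.smul_apply, smul_smul]
  congr 1; ring

end

/-! ### Spectra of diagonal operators -/

section Diagonal

variable {V : Type*} {ι : Type*}

theorem repr_diagonal [AddCommGroup V] [Module ℂ V] {T : Module.End ℂ V} {e : Module.Basis ι ℂ V}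
    {l : ι → ℂ} (hT : ∀ μ, T (e μ) = l μ • e μ) (v : V) (μ : ι) :
    e.repr (T v) μ = l μ * e.repr v μ := by
  have : e.coord μ ∘ₗ T = l μ • e.coord μ := e.ext fun ν => by
    classical
    simp only [LinearMap.comp_apply, hT, map_smul, LinearMap.smul_apply, Module.Basis.coord_apply,
      Module.Basis.repr_self, Finsupp.single_apply, smul_eq_mul]
    split_ifs with h
    · rw [h]
    · simp
  exact LinearMap.congr_fun this v

theorem eigenvalueSet_diagonal [AddCommGroup V] [Module ℂ V] {T : Module.End ℂ V}
    {e : Module.Basis ι ℂ V} {l : ι → ℂ} (hT : ∀ μ, T (e μ) = l μ • e μ) :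
    eigenvalueSet T = Set.range l := by
  ext z
  constructor
  · intro hz
    obtain ⟨v, hv⟩ := Module.End.HasEigenvalue.exists_hasEigenvector hz
    obtain ⟨μ, hμ⟩ : ∃ μ, e.repr v μ ≠ 0 := by
      by_contra! h
      exact hv.2 (e.repr.map_eq_zero_iff.mp (Finsupp.ext h))
    have := repr_diagonal hT v μ
    rw [hv.apply_eq_smul, map_smul, Finsupp.smul_apply, smul_eq_mul] at this
    exact ⟨μ, (mul_right_cancel₀ hμ this).symm⟩
  · rintro ⟨μ, rfl⟩
    exact Module.End.hasEigenvalue_of_hasEigenvector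
      (Module.End.hasEigenvector_iff.mpr ⟨Module.End.mem_eigenspace_iff.mpr (hT μ), e.ne_zero μ⟩)

variable [NormedAddCommGroup V] [InnerProductSpace ℂ V]

/-- The operator `T`, on the image of `V` in the completion. -/
noncomputable def toCompletionPMap (T : Module.End ℂ V) :
    UniformSpace.Completion V →ₗ.[ℂ] UniformSpace.Completion V where
  domain := LinearMap.range (UniformSpace.Completion.toComplₗᵢ (𝕜 := ℂ) (E := V)).toLinearMap
  toFun := (UniformSpace.Completion.toComplₗᵢ (𝕜 := ℂ) (E := V)).toLinearMap ∘ₗ T ∘ₗ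
    (LinearEquiv.ofInjective (UniformSpace.Completion.toComplₗᵢ (𝕜 := ℂ) (E := V)).toLinearMap
      UniformSpace.Completion.toComplₗᵢ.injective).symm.toLinearMap

theorem hilbertClosure_eq (T : Module.End ℂ V) :
    hilbertClosure T = (toCompletionPMap T).closure := rfl

theorem mem_graph_toCompletionPMap {T : Module.End ℂ V}
    {x : UniformSpace.Completion V × UniformSpace.Completion V} :
    x ∈ (toCompletionPMap T).graph ↔ ∃ v : V, x = ((v : UniformSpace.Completion V),
      ((T v : V) : UniformSpace.Completion V)) := by
  set i := (UniformSpace.Completion.toComplₗᵢ (𝕜 := ℂ) (E := V)).toLinearMap with hi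
  have key : ∀ v : V, (LinearEquiv.ofInjective i
      UniformSpace.Completion.toComplₗᵢ.injective).symm ⟨i v, v, rfl⟩ = v := fun v =>
    (LinearEquiv.symm_apply_eq _).mpr rfl
  rw [LinearPMap.mem_graph_iff']
  constructor
  · rintro ⟨⟨_, v, rfl⟩, rfl⟩
    refine ⟨v, Prod.ext rfl ?_⟩
    exact congrArg (fun w => i (T w)) (key v)
  · rintro ⟨v, rfl⟩
    refine ⟨⟨_, v, rfl⟩, Prod.ext rfl ?_⟩
    exact congrArg (fun w => i (T w)) (key v)

/-- A closed condition on pairs passes from the graph of `T` on `V` to the closure of this graph. -/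
theorem closure_graph_induction {T : Module.End ℂ V}
    {P : UniformSpace.Completion V → UniformSpace.Completion V → Prop}
    (hc : IsClosed {x : UniformSpace.Completion V × UniformSpace.Completion V | P x.1 x.2})
    (h : ∀ v : V, P v (T v)) {x y : UniformSpace.Completion V}
    (hxy : (x, y) ∈ (toCompletionPMap T).graph.topologicalClosure) : P x y := by
  have : ((toCompletionPMap T).graph.topologicalClosure :
      Set (UniformSpace.Completion V × UniformSpace.Completion V)) ⊆ {x | P x.1 x.2} := by
    rw [Submodule.topologicalClosure_coe]
    refine closure_minimal (fun x hx => ?_) hc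
    obtain ⟨v, rfl⟩ := mem_graph_toCompletionPMap.mp hx
    exact h v
  exact this hxy

/-- By symmetry, a limit point `(0, y)` of the graph satisfies `⟨y, w⟩ = ⟨0, T w⟩ = 0` for all `w`
in the dense subspace `V`. -/
theorem isClosable_of_symmetric {T : Module.End ℂ V} (hT : ∀ v w, ⟪T v, w⟫_ℂ = ⟪v, T w⟫_ℂ) :
    (toCompletionPMap T).IsClosable := by
  refine ⟨(toCompletionPMap T).graph.topologicalClosure.toLinearPMap,
    (Submodule.toLinearPMap_graph_eq _ ?_).symm⟩
  rintro ⟨x, y⟩ hxy (rfl : x = 0)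
  change y = 0
  have h : ∀ w : V, ⟪y, (w : UniformSpace.Completion V)⟫_ℂ = 0 := fun w => by
    have := closure_graph_induction (P := fun x y => ⟪y, (w : UniformSpace.Completion V)⟫_ℂ =
      ⟪x, ((T w : V) : UniformSpace.Completion V)⟫_ℂ)
      (isClosed_eq (by fun_prop) (by fun_prop))
      (fun v => by rw [UniformSpace.Completion.inner_coe, UniformSpace.Completion.inner_coe, hT])
      hxy
    rwa [inner_zero_left] at this
  have h' : ∀ w : UniformSpace.Completion V, ⟪y, w⟫_ℂ = 0 := fun w =>
    UniformSpace.Completion.induction_on w (isClosed_eq (by fun_prop) continuous_const) h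
  exact inner_self_eq_zero.mp (h' y)

theorem diagonal_norm_le {e : Module.Basis ι ℂ V} (he : Orthonormal ℂ e) {T : Module.End ℂ V}
    {l : ι → ℂ} (hT : ∀ μ, T (e μ) = l μ • e μ) {C : ℝ} (hC : 0 ≤ C) (hl : ∀ μ, ‖l μ‖ ≤ C) (v : V) :
    ‖T v‖ ≤ C * ‖v‖ := by
  have hv : v = ∑ μ ∈ (e.repr v).support, e.repr v μ • e μ := (e.linearCombination_repr v).symm
  have hTv : T v = ∑ μ ∈ (e.repr v).support, (l μ * e.repr v μ) • e μ := by
    conv_lhs => rw [hv, map_sum]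
    refine Finset.sum_congr rfl fun μ _ => ?_
    rw [map_smul, hT, smul_smul, mul_comm]
  refine le_of_sq_le_sq ?_ (by positivity)
  rw [mul_pow]
  have n : ∀ c : ι → ℂ, ‖∑ μ ∈ (e.repr v).support, c μ • e μ‖ ^ 2 =
      ∑ μ ∈ (e.repr v).support, ‖c μ‖ ^ 2 := fun c => by
    have := he.inner_sum c c (e.repr v).support
    rw [inner_self_eq_norm_sq_to_K] at this
    simp only [Complex.conj_mul'] at this
    apply Complex.ofReal_injective
    push_cast
    exact this
  have n1 : ‖v‖ ^ 2 = ∑ μ ∈ (e.repr v).support, ‖e.repr v μ‖ ^ 2 := by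
    rw [← n, ← hv]
  have n2 : ‖T v‖ ^ 2 = ∑ μ ∈ (e.repr v).support, ‖l μ * e.repr v μ‖ ^ 2 := by
    rw [← n, ← hTv]
  rw [n1, n2, Finset.mul_sum]
  refine Finset.sum_le_sum fun μ _ => ?_
  rw [norm_mul, mul_pow]
  gcongr
  exact hl μ

theorem resolvent_mem_of_dense {W : Type*} [NormedAddCommGroup W] [NormedSpace ℂ W]
    {G : Set (W × W)} (hG : IsClosed G) (R : W →L[ℂ] W) (z : ℂ) {D : Set W} (hD : Dense D)
    (h : ∀ v ∈ D, (R v, v + z • R v) ∈ G) (w : W) : (R w, w + z • R w) ∈ G := by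
  have hc : IsClosed {w : W | (R w, w + z • R w) ∈ G} := hG.preimage (by fun_prop)
  exact hc.closure_subset_iff.mpr h (hD w)

theorem isClosed_left_inverse {W : Type*} [NormedAddCommGroup W] [NormedSpace ℂ W]
    (R : W →L[ℂ] W) (z : ℂ) : IsClosed {x : W × W | R (x.2 - z • x.1) = x.1} :=
  isClosed_eq (by fun_prop) (by fun_prop)

/-- Closedness of the set of diagonal entries is essential: it gives each outside point a positive
distance `δ` from them, so that the diagonal inverse is bounded by `δ⁻¹`. -/
theorem unboundedSpectrum_diagonal {e : Module.Basis ι ℂ V} (he : Orthonormal ℂ e)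
    {T : Module.End ℂ V} {l : ι → ℝ} (hT : ∀ μ, T (e μ) = (l μ : ℂ) • e μ)
    (hl : IsClosed (Set.range fun μ => (l μ : ℂ))) :
    unboundedSpectrum (hilbertClosure T) = Set.range fun μ => (l μ : ℂ) := by
  have hsym : AdjointPair T T := by
    classical
    refine .of_basis e fun μ ν => ?_
    rw [hT, hT, inner_smul_left, inner_smul_right, orthonormal_iff_ite.mp he, Complex.conj_ofReal]
    split_ifs with h
    · rw [h]
    · simp
  -- `LinearPMap.closure` is a genuine closure only for closable operators; otherwise it returns the
  -- operator itself.
  have hclos := isClosable_of_symmetric hsym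
  have hgraph := hclos.graph_closure_eq_closure_graph
  rw [← hilbertClosure_eq] at hgraph
  have hmem : ∀ v : V, ((v : UniformSpace.Completion V), ((T v : V) : UniformSpace.Completion V)) ∈
      (hilbertClosure T).graph := fun v => by
    rw [← hgraph]
    exact Submodule.le_topologicalClosure _ (mem_graph_toCompletionPMap.mpr ⟨v, rfl⟩)
  ext z
  constructor
  · intro hz
    by_contra hz'
    refine hz ?_
    obtain ⟨δ, hδ, hball⟩ := Metric.isOpen_iff.mp hl.isOpen_compl z hz'
    have hd : ∀ μ, δ ≤ ‖(l μ : ℂ) - z‖ := fun μ => by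
      by_contra! h
      exact hball (by rwa [Metric.mem_ball, dist_eq_norm]) ⟨μ, rfl⟩
    have hne : ∀ μ, (l μ : ℂ) - z ≠ 0 := fun μ => norm_pos_iff.mp (hδ.trans_le (hd μ))
    let R₀ : Module.End ℂ V := e.constr ℂ fun μ => ((l μ : ℂ) - z)⁻¹ • e μ
    have hR₀ : ∀ μ, R₀ (e μ) = ((l μ : ℂ) - z)⁻¹ • e μ := fun μ => e.constr_basis ℂ _ μ
    have hbound : ∀ v, ‖R₀ v‖ ≤ δ⁻¹ * ‖v‖ := diagonal_norm_le he hR₀ (by positivity) fun μ => by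
      rw [norm_inv]
      exact inv_anti₀ hδ (hd μ)
    have hTR : ∀ v, T (R₀ v) = v + z • R₀ v := fun v => by
      have : T * R₀ = 1 + z • R₀ := e.ext fun μ => by
        rw [Module.End.mul_apply, LinearMap.add_apply, LinearMap.smul_apply, hR₀, map_smul, hT,
          Module.End.one_apply, smul_smul, smul_smul]
        match_scalars
        field_simp [hne μ]
        ring
      exact LinearMap.congr_fun this v
    have hRT : ∀ v, R₀ (T v - z • v) = v := fun v => by
      have : R₀ * (T - z • (1 : Module.End ℂ V)) = 1 := e.ext fun μ => by
        rw [Module.End.mul_apply, LinearMap.sub_apply, LinearMap.smul_apply, hT,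
          Module.End.one_apply, ← sub_smul, map_smul, hR₀, smul_inv_smul₀ (hne μ)]
      exact LinearMap.congr_fun this v
    -- The bounded inverse extends by continuity to the completion. Both inverse identities are
    -- closed conditions and carry over from `V`.
    let i : V →L[ℂ] UniformSpace.Completion V :=
      (UniformSpace.Completion.toComplₗᵢ (𝕜 := ℂ) (E := V)).toContinuousLinearMap
    let R : UniformSpace.Completion V →L[ℂ] UniformSpace.Completion V :=
      (i ∘L LinearMap.mkContinuous R₀ δ⁻¹ hbound).extend i
    have hR : ∀ v : V, R (v : UniformSpace.Completion V) = (R₀ v : V) := fun v =>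
      ContinuousLinearMap.extend_eq _ UniformSpace.Completion.denseRange_coe
        (UniformSpace.Completion.isUniformInducing_coe V) v
    refine ⟨R, fun w => ?_, fun x => ?_⟩
    · have hw : (R w, w + z • R w) ∈ (hilbertClosure T).graph := by
        rw [← hgraph]
        refine resolvent_mem_of_dense (Submodule.isClosed_topologicalClosure _) R z
          UniformSpace.Completion.denseRange_coe ?_ w
        rintro _ ⟨v, rfl⟩
        have := hmem (R₀ v)
        rw [hTR, UniformSpace.Completion.coe_add, UniformSpace.Completion.coe_smul, ← hgraph,
          ← hR] at this
        exact this
      have hdom := LinearPMap.mem_domain_of_mem_graph hw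
      refine ⟨hdom, ?_⟩
      rw [← (LinearPMap.image_iff hdom).mpr hw, add_sub_cancel_right]
    · have := (hilbertClosure T).mem_graph x
      rw [← hgraph] at this
      refine closure_graph_induction (P := fun x y => R (y - z • x) = x)
        (isClosed_left_inverse R z) (fun v => ?_) this
      rw [← UniformSpace.Completion.coe_smul, ← UniformSpace.Completion.coe_sub, hR, hRT]
  -- A left inverse would send `(T - l μ) (e μ) = 0` to `e μ`.
  · rintro ⟨μ, rfl⟩ ⟨R, -, hR⟩
    have hμ := hmem (e μ)
    have hdom := LinearPMap.mem_domain_of_mem_graph hμ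
    have := hR ⟨_, hdom⟩
    rw [← (LinearPMap.image_iff hdom).mpr hμ, hT, UniformSpace.Completion.coe_smul, sub_self,
      map_zero] at this
    exact e.ne_zero μ (UniformSpace.Completion.coe_eq_zero_iff.mp this.symm)

end Diagonal

/-! ### Energy levels -/

section

variable {p : ℕ} {V : Type*} [NormedAddCommGroup V] [InnerProductSpace ℂ V]
  {ρ : osp32 →ₗ[ℂ] Module.End ℂ V} {vac : V} {m ω ħ : ℝ}

theorem range_energy (hp : 1 ≤ p) :
    (Set.range fun μ : Pattern p => (ħ * ω / 2 * (p + 2 * μ.μ₂₂ + 2 * μ.θ) : ℂ)) =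
      Set.range (fun n : ℕ => (ħ * ω * (n + p / 2) : ℂ)) := by
  ext z
  constructor
  · rintro ⟨μ, rfl⟩
    refine ⟨(μ.μ₂₂ + μ.θ).toNat, ?_⟩
    have h : (((μ.μ₂₂ + μ.θ).toNat : ℤ) : ℂ) = ((μ.μ₂₂ + μ.θ : ℤ) : ℂ) := by
      have h1 := μ.isPattern.right_nonneg
      have h2 := μ.isPattern.theta
      rw [Int.toNat_of_nonneg (by unfold Pattern.θ; omega)]
    push_cast at h
    simp only [h]
    ring
  · rintro ⟨n, rfl⟩
    -- With `μ₁₂ = μ₁₁ = 1`, so `θ = 0`, every `μ₂₂` is allowed; admissibility uses `1 ≤ p`.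
    refine ⟨⟨1, n, 1, by constructor <;> omega⟩, ?_⟩
    simp [Pattern.θ]
    ring

/-- Distinct levels are at distance at least `ħω`. -/
theorem isClosed_range_energy (hω : 0 < ω) (hħ : 0 < ħ) :
    IsClosed (Set.range (fun n : ℕ => (ħ * ω * (n + p / 2) : ℂ))) := by
  refine (Metric.isClosedEmbedding_of_pairwise_le_dist (mul_pos hħ hω)
    fun a b hab => ?_).isClosed_range
  have : (ħ * ω * (a + p / 2) - ħ * ω * (b + p / 2) : ℂ) = ((ħ * ω * (a - b) : ℝ) : ℂ) := by
    push_cast; ring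
  beta_reduce
  rw [dist_eq_norm, this, Complex.norm_real, norm_mul, Real.norm_of_nonneg (mul_pos hħ hω).le]
  refine le_mul_of_one_le_right (mul_pos hħ hω).le ?_
  rw [← dist_eq_norm]
  exact Nat.pairwise_one_le_dist hab

theorem IsParaFock.eigenvalueSet_hamiltonian (hp : 1 ≤ p) (h : IsParaFock p ρ vac) (hm : 0 < m)
    (hω : 0 < ω) (hħ : 0 < ħ) : eigenvalueSet (hamiltonian ρ m ω ħ) =
      Set.range (fun n : ℕ => (ħ * ω * (n + p / 2) : ℂ)) := by
  obtain ⟨e, he⟩ := h.exists_isKetBasis hp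
  rw [eigenvalueSet_diagonal (h.hamiltonian_apply hm hω hħ he), range_energy hp]

theorem IsParaFock.unboundedSpectrum_hamiltonian (hp : 1 ≤ p) (h : IsParaFock p ρ vac) (hm : 0 < m)
    (hω : 0 < ω) (hħ : 0 < ħ) : unboundedSpectrum (hilbertClosure (hamiltonian ρ m ω ħ)) =
      Set.range (fun n : ℕ => (ħ * ω * (n + p / 2) : ℂ)) := by
  obtain ⟨e, he⟩ := h.exists_isKetBasis hp
  have hc : ∀ μ : Pattern p, ((ħ * ω / 2 * (p + 2 * μ.μ₂₂ + 2 * μ.θ) : ℝ) : ℂ) =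
      (ħ * ω / 2 * (p + 2 * μ.μ₂₂ + 2 * μ.θ) : ℂ) := fun μ => by push_cast; rfl
  rw [← range_energy hp]
  simp only [← hc]
  refine unboundedSpectrum_diagonal he.orthonormal (fun μ => ?_) ?_
  · rw [hc, h.hamiltonian_apply hm hω hħ he]
  · simp only [hc]
    rw [range_energy hp]
    exact isClosed_range_energy hω hħ

end

/-! ### The canonical oscillator -/

section Ladder

variable {V : Type*} [AddCommGroup V] [Module ℂ V]

/-- The spectrum of a number operator: if `[A, B]` is a positive multiple of the identity, `A` has
a kernel and `B A` has no eigenvalues with negative real part, the eigenvalues of `B A` are the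
multiples of `[A, B]`. -/
theorem eigenvalueSet_ladder {A B : Module.End ℂ V} {κ : ℝ}
    (hκ : 0 < κ) (hAB : ∀ v, A (B v) = B (A v) + (κ : ℂ) • v) {φ : V} (hφ : φ ≠ 0) (hAφ : A φ = 0)
    (hpos : ∀ (l : ℂ) (v : V), v ≠ 0 → B (A v) = l • v → 0 ≤ l.re) :
    eigenvalueSet (B * A) = Set.range fun n : ℕ => (κ * n : ℂ) := by
  ext l
  constructor
  · intro hl
    obtain ⟨v, hv⟩ := Module.End.HasEigenvalue.exists_hasEigenvector hl
    -- Applying `A` lowers the eigenvalue by `κ`. As real parts are bounded below by `0`, this must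
    -- stop at a vector killed by `A`, whose eigenvalue is `0`; `n` bounds the number of descents.
    have key : ∀ (n : ℕ) (l : ℂ) (v : V), v ≠ 0 → B (A v) = l • v → l.re < κ * n →
        ∃ k : ℕ, l = κ * k := by
      intro n
      induction n with
      | zero =>
        intro l v hv h hlt
        have := hpos l v hv h
        simp at hlt
        linarith
      | succ n ih =>
        intro l v hv h hlt
        by_cases hA : A v = 0
        · rw [hA, map_zero, eq_comm, smul_eq_zero] at h
          exact ⟨0, by simpa using h.resolve_right hv⟩
        · obtain ⟨k, hk⟩ := ih (l - κ) (A v) hA (by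
            rw [sub_smul, ← map_smul, ← h, hAB, add_sub_cancel_right]) (by
            push_cast at hlt
            simp only [Complex.sub_re, Complex.ofReal_re]
            linarith)
          refine ⟨k + 1, ?_⟩
          push_cast
          linear_combination hk
    obtain ⟨n, hn⟩ := exists_nat_gt (l.re / κ)
    obtain ⟨k, hk⟩ := key n l v hv.2 hv.apply_eq_smul (by rwa [div_lt_iff₀' hκ] at hn)
    exact ⟨k, hk.symm⟩
  · rintro ⟨n, rfl⟩
    have hκ' : (κ : ℂ) ≠ 0 := by exact_mod_cast hκ.ne'
    -- Nonvanishing is proved together with the eigenvalue: `A` sends the next vector to a nonzero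
    -- multiple of the current one.
    have key : ∀ n : ℕ, (B ^ n) φ ≠ 0 ∧ B (A ((B ^ n) φ)) = (κ * n : ℂ) • (B ^ n) φ := by
      intro n
      induction n with
      | zero => simp [hφ, hAφ]
      | succ n ih =>
        have h : A ((B ^ (n + 1)) φ) = (κ * (n + 1 : ℕ) : ℂ) • (B ^ n) φ := by
          rw [pow_succ', Module.End.mul_apply, hAB, ih.2, ← add_smul]
          congr 1; push_cast; ring
        constructor
        · intro h0
          rw [h0, map_zero, eq_comm, smul_eq_zero] at h
          exact h.elim (mul_ne_zero hκ' (by exact_mod_cast n.succ_ne_zero)) ih.1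
        · rw [h, map_smul, pow_succ', Module.End.mul_apply]
    exact Module.End.hasEigenvalue_of_hasEigenvector (Module.End.hasEigenvector_iff.mpr
      ⟨Module.End.mem_eigenspace_iff.mpr (key n).2, (key n).1⟩)

theorem eigenvalueSet_affine {T : Module.End ℂ V} {a : ℂ} (ha : a ≠ 0) (b : ℂ) :
    eigenvalueSet (a • T + b • 1) = (fun l => a * l + b) '' eigenvalueSet T := by
  have key : ∀ l v, (a • T + b • 1) v = (a * l + b) • v ↔ T v = l • v := fun l v => by
    rw [LinearMap.add_apply, LinearMap.smul_apply, LinearMap.smul_apply, Module.End.one_apply,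
      add_smul, add_left_inj, mul_smul, smul_right_inj ha]
  have key' : ∀ l, (a • T + b • 1).HasEigenvalue (a * l + b) ↔ T.HasEigenvalue l := fun l => by
    constructor <;> intro h <;> obtain ⟨v, hv⟩ := h.exists_hasEigenvector <;>
      refine Module.End.hasEigenvalue_of_hasEigenvector
        (Module.End.hasEigenvector_iff.mpr ⟨Module.End.mem_eigenspace_iff.mpr ?_, hv.2⟩)
    · exact (key l v).mp hv.apply_eq_smul
    · exact (key l v).mpr hv.apply_eq_smul
  ext z
  constructor
  · intro hz
    have hl : a * ((z - b) / a) + b = z := by field_simp; ring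
    exact ⟨(z - b) / a, (key' _).mp (by rwa [hl]), hl⟩
  · rintro ⟨l, hl, rfl⟩
    exact (key' l).mpr hl

end Ladder

/-! ### The Gaussian as a Schwartz function -/

section Gaussian

open Polynomial

theorem bounded_polynomial_mul_gaussian {b : ℝ} (hb : 0 < b) (q : ℝ[X]) :
    ∃ C : ℝ, ∀ x : ℝ, |q.eval x * Real.exp (-b * x ^ 2)| ≤ C := by
  induction q using Polynomial.induction_on' with
  | add q r hq hr =>
    obtain ⟨C, hC⟩ := hq
    obtain ⟨D, hD⟩ := hr
    refine ⟨C + D, fun x => ?_⟩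
    rw [eval_add, add_mul]
    exact (abs_add_le _ _).trans (add_le_add (hC x) (hD x))
  | monomial n a =>
    have h := tendsto_rpow_abs_mul_exp_neg_mul_sq_cocompact hb n
    have hc : Continuous fun x : ℝ => |x| ^ (n : ℝ) * Real.exp (-b * x ^ 2) := by
      simp only [Real.rpow_natCast]
      fun_prop
    obtain ⟨C, hC⟩ : ∃ C, ∀ x : ℝ, ‖|x| ^ (n : ℝ) * Real.exp (-b * x ^ 2)‖ ≤ C := by
      -- A continuous function vanishing at infinity is bounded.
      let g : ZeroAtInftyContinuousMap ℝ ℝ := ⟨⟨_, hc⟩, h⟩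
      exact ⟨‖g.toBCF‖, fun x => g.toBCF.norm_coe_le_norm x⟩
    refine ⟨|a| * C, fun x => ?_⟩
    have := hC x
    rw [eval_monomial, mul_assoc, abs_mul]
    gcongr
    rw [Real.norm_eq_abs, abs_mul, Real.rpow_natCast, ← abs_pow, abs_abs] at this
    rw [abs_mul]
    exact this

theorem iteratedDeriv_gaussian (b : ℝ) (n : ℕ) : ∃ q : ℝ[X],
    iteratedDeriv n (fun x : ℝ => Real.exp (-b * x ^ 2)) =
      fun x => q.eval x * Real.exp (-b * x ^ 2) := by
  induction n with
  | zero => exact ⟨1, by simp [iteratedDeriv_zero]⟩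
  | succ n ih =>
    obtain ⟨q, hq⟩ := ih
    refine ⟨derivative q - C (2 * b) * X * q, ?_⟩
    rw [iteratedDeriv_succ, hq]
    funext x
    have h1 : HasDerivAt (fun x : ℝ => -b * x ^ 2) (-b * (2 * x)) x := by
      simpa using (hasDerivAt_pow 2 x).const_mul (-b)
    rw [((q.hasDerivAt x).fun_mul h1.exp).deriv]
    simp only [eval_sub, eval_mul, eval_C, eval_X]
    ring

/-- The Gaussian, as a Schwartz function. -/
noncomputable def gaussianSchwartz {b : ℝ} (hb : 0 < b) : SchwartzMap ℝ ℝ where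
  toFun x := Real.exp (-b * x ^ 2)
  smooth' := by fun_prop
  decay' k n := by
    obtain ⟨q, hq⟩ := iteratedDeriv_gaussian b n
    obtain ⟨C, hC⟩ := bounded_polynomial_mul_gaussian hb (X ^ k * q)
    refine ⟨C, fun x => ?_⟩
    rw [norm_iteratedFDeriv_eq_norm_iteratedDeriv, hq, ← norm_pow, ← norm_mul]
    simpa [mul_assoc] using hC x

end Gaussian

/-! ### The canonical oscillator on the Schwartz space -/

section Schwartz

open MeasureTheory

theorem canonicalPosition_apply (f : SchwartzMap ℝ ℂ) (x : ℝ) : canonicalPosition f x = x * f x :=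
  SchwartzMap.smulLeftCLM_apply_apply Function.Complex.hasTemperateGrowth_ofReal f x

/-- Differentiation on the Schwartz space. -/
noncomputable def schwartzDeriv : Module.End ℂ (SchwartzMap ℝ ℂ) :=
  (SchwartzMap.derivCLM ℂ ℂ).toLinearMap

theorem schwartzDeriv_apply (f : SchwartzMap ℝ ℂ) (x : ℝ) : schwartzDeriv f x = deriv f x := rfl

theorem schwartzDeriv_mul_canonicalPosition :
    schwartzDeriv * canonicalPosition = canonicalPosition * schwartzDeriv + 1 := by
  refine LinearMap.ext fun f => SchwartzMap.ext fun x => ?_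
  have h : (canonicalPosition f : ℝ → ℂ) = fun x : ℝ => (x : ℂ) * f x :=
    funext fun x => canonicalPosition_apply f x
  change deriv (canonicalPosition f) x = canonicalPosition (schwartzDeriv f) x + f x
  have hx : HasDerivAt (fun x : ℝ => (x : ℂ)) 1 x := Complex.ofRealCLM.hasDerivAt
  rw [h, (hx.fun_mul (f.hasDerivAt x)).deriv, canonicalPosition_apply, schwartzDeriv_apply]
  ring

/-- The embedding of the Schwartz space in `L²`. -/
noncomputable def schwartzToL2 : SchwartzMap ℝ ℂ →ₗ[ℂ] Lp ℂ 2 (volume : Measure ℝ) :=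
  (SchwartzMap.toLpCLM ℂ ℂ 2 volume).toLinearMap

theorem schwartzToL2_injective : Function.Injective schwartzToL2 :=
  SchwartzMap.injective_toLp (E := ℝ) (F := ℂ) 2 volume

theorem inner_schwartzToL2 (f g : SchwartzMap ℝ ℂ) :
    ⟪schwartzToL2 f, schwartzToL2 g⟫_ℂ = ∫ x, ⟪f x, g x⟫_ℂ :=
  SchwartzMap.inner_toL2_toL2_eq f g

theorem inner_canonicalPosition (f g : SchwartzMap ℝ ℂ) :
    ⟪schwartzToL2 (canonicalPosition f), schwartzToL2 g⟫_ℂ =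
      ⟪schwartzToL2 f, schwartzToL2 (canonicalPosition g)⟫_ℂ := by
  rw [inner_schwartzToL2, inner_schwartzToL2]
  congr 1
  funext x
  rw [canonicalPosition_apply, canonicalPosition_apply]
  simp
  ring

/-- Integration by parts for the pairing `conj f · g`, which is bilinear only over `ℝ`. -/
theorem inner_schwartzDeriv (f g : SchwartzMap ℝ ℂ) :
    ⟪schwartzToL2 (schwartzDeriv f), schwartzToL2 g⟫_ℂ =
      -⟪schwartzToL2 f, schwartzToL2 (schwartzDeriv g)⟫_ℂ := by
  have := SchwartzMap.integral_bilinear_deriv_right_eq_neg_left f g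
    ((ContinuousLinearMap.mul ℝ ℂ).comp (Complex.conjCLE : ℂ →L[ℝ] ℂ))
  rw [inner_schwartzToL2, inner_schwartzToL2, eq_neg_iff_add_eq_zero, add_comm,
    ← eq_neg_iff_add_eq_zero]
  convert this using 3
  · simp [schwartzDeriv_apply, mul_comm]
  · congr 1
    funext x
    simp [schwartzDeriv_apply, mul_comm]

theorem gaussianSchwartz_apply {b : ℝ} (hb : 0 < b) (x : ℝ) :
    gaussianSchwartz hb x = Real.exp (-b * x ^ 2) := rfl

/-- The function `exp (-κ x² / 2)` solves `φ' = -κ x φ`. -/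
theorem exists_gaussian_vacuum {κ : ℝ} (hκ : 0 < κ) : ∃ φ : SchwartzMap ℝ ℂ, φ ≠ 0 ∧
    (schwartzDeriv + (κ : ℂ) • canonicalPosition) φ = 0 := by
  refine ⟨(gaussianSchwartz (half_pos hκ)).postcompCLM Complex.ofRealCLM, fun h => ?_, ?_⟩
  · have := congrArg (fun f : SchwartzMap ℝ ℂ => f 0) h
    simp [gaussianSchwartz_apply] at this
  · refine SchwartzMap.ext fun x => ?_
    set φ := (gaussianSchwartz (half_pos hκ)).postcompCLM Complex.ofRealCLM with hφ
    have h : (φ : ℝ → ℂ) = fun x : ℝ => ((Real.exp (-(κ / 2) * x ^ 2) : ℝ) : ℂ) := rfl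
    have h1 : HasDerivAt (fun x : ℝ => -(κ / 2) * x ^ 2) (-(κ / 2) * (2 * x)) x := by
      simpa using (hasDerivAt_pow 2 x).const_mul (-(κ / 2))
    change schwartzDeriv φ x + (κ : ℂ) * canonicalPosition φ x = 0
    rw [schwartzDeriv_apply, canonicalPosition_apply, h, h1.exp.ofReal_comp.deriv]
    push_cast
    ring

/-- With `A = D + κX` and `B = -D + κX` one has `[A, B] = 2κ` and `B A = -D² + κ²X² - κ`, so that `H
= (ħ²/2m) B A + ħω/2` for `κ = mω/ħ`. -/
theorem eigenvalueSet_canonicalHamiltonian {m ω ħ : ℝ} (hm : 0 < m) (hω : 0 < ω) (hħ : 0 < ħ) :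
    eigenvalueSet (canonicalHamiltonian m ω ħ) =
      Set.range (fun n : ℕ => (ħ * ω * (n + 1 / 2) : ℂ)) := by
  have hmC : (m : ℂ) ≠ 0 := by exact_mod_cast hm.ne'
  have hωC : (ω : ℂ) ≠ 0 := by exact_mod_cast hω.ne'
  have hħC : (ħ : ℂ) ≠ 0 := by exact_mod_cast hħ.ne'
  set κ : ℝ := m * ω / ħ with hκd
  have hκ : 0 < κ := by positivity
  have hκC : (κ : ℂ) = m * ω / ħ := by rw [hκd]; push_cast; rfl
  set D := schwartzDeriv
  set X := canonicalPosition
  have hDX : D * X = X * D + 1 := schwartzDeriv_mul_canonicalPosition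
  set A : Module.End ℂ (SchwartzMap ℝ ℂ) := D + (κ : ℂ) • X with hA
  set B : Module.End ℂ (SchwartzMap ℝ ℂ) := -D + (κ : ℂ) • X with hB
  have hAB : A * B = B * A + ((2 * κ : ℝ) : ℂ) • (1 : Module.End ℂ (SchwartzMap ℝ ℂ)) := by
    simp only [hA, hB, mul_add, add_mul, smul_mul_assoc, mul_smul_comm, neg_mul, mul_neg, hDX]
    push_cast
    module
  have hadj : ∀ f g, ⟪schwartzToL2 (A f), schwartzToL2 g⟫_ℂ =
      ⟪schwartzToL2 f, schwartzToL2 (B g)⟫_ℂ := fun f g => by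
    simp only [hA, hB, LinearMap.add_apply, LinearMap.smul_apply, LinearMap.neg_apply, map_add,
      map_smul, map_neg, inner_add_left, inner_add_right, inner_smul_left, inner_smul_right,
      inner_neg_right, Complex.conj_ofReal]
    rw [inner_schwartzDeriv, inner_canonicalPosition]
  obtain ⟨φ, hφ, hAφ⟩ := exists_gaussian_vacuum hκ
  have hN := eigenvalueSet_ladder (A := A) (B := B) (κ := 2 * κ) (by positivity)
    -- Positivity: `A` and `B` are adjoint in `L²`, so `‖A v‖² = l ‖v‖²` for an eigenvector `v` of
    -- `B A`, and `‖v‖ ≠ 0` since the Schwartz space embeds in `L²`.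
    (fun v => LinearMap.congr_fun hAB v) hφ hAφ fun l v hv h => by
      have h1 := hadj v (A v)
      rw [h, map_smul, inner_smul_right, inner_self_eq_norm_sq_to_K,
        inner_self_eq_norm_sq_to_K] at h1
      have h2 : 0 < ‖schwartzToL2 v‖ := by
        rw [norm_pos_iff]
        exact fun h0 => hv (schwartzToL2_injective (h0.trans (map_zero _).symm))
      have h3 : ‖schwartzToL2 (A v)‖ ^ 2 = l.re * ‖schwartzToL2 v‖ ^ 2 := by
        have h4 : ((‖schwartzToL2 (A v)‖ ^ 2 : ℝ) : ℂ) =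
            ((‖schwartzToL2 v‖ ^ 2 : ℝ) : ℂ) * l := by
          push_cast
          rw [mul_comm]
          exact h1
        have := congrArg Complex.re h4
        rw [Complex.ofReal_re, Complex.re_ofReal_mul] at this
        rw [this, mul_comm]
      by_contra! hl
      have := mul_neg_of_neg_of_pos hl (pow_pos h2 2)
      linarith [sq_nonneg ‖schwartzToL2 (A v)‖]
  have hH : canonicalHamiltonian m ω ħ = (ħ ^ 2 / (2 * m) : ℂ) • (B * A) +
      (ħ * ω / 2 : ℂ) • (1 : Module.End ℂ (SchwartzMap ℝ ℂ)) := by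
    have hp : canonicalMomentum ħ = (-Complex.I * ħ : ℂ) • D := rfl
    rw [canonicalHamiltonian, hp, smul_pow, mul_pow, neg_sq, Complex.I_sq]
    simp only [hA, hB, mul_add, add_mul, smul_mul_assoc, mul_smul_comm, neg_mul, mul_neg, hDX, sq,
      hκC]
    match_scalars <;> field_simp <;> ring
  rw [hH, eigenvalueSet_affine (div_ne_zero (pow_ne_zero 2 hħC) (mul_ne_zero two_ne_zero hmC)), hN,
    ← Set.range_comp]
  congr 1
  funext n
  simp only [Function.comp_apply]
  push_cast
  rw [hκC]
  field_simp

end Schwartz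

theorem mainTheorem2 (p : ℕ) (hp : 1 ≤ p) (m ω ħ : ℝ) (hm : 0 < m) (hω : 0 < ω) (hħ : 0 < ħ) :
    (∃ (V : Type) (_ : NormedAddCommGroup V) (_ : InnerProductSpace ℂ V)
      (ρ : osp32 →ₗ[ℂ] Module.End ℂ V) (vac : V), IsParaFock p ρ vac) ∧
    ∀ (V : Type u) [NormedAddCommGroup V] [InnerProductSpace ℂ V]
      (ρ : osp32 →ₗ[ℂ] Module.End ℂ V) (vac : V), IsParaFock p ρ vac →
      (∃ e : Module.Basis (Pattern p) ℂ V, IsKetBasis p ρ vac e) ∧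
      (∀ e : Module.Basis (Pattern p) ℂ V, IsKetBasis p ρ vac e → ∀ μ : Pattern p,
        hamiltonian ρ m ω ħ (e μ) =
          (ħ * ω / 2 : ℂ) • (cPlus ρ 1 * cMinus ρ 1 + cMinus ρ 1 * cPlus ρ 1) (e μ) ∧
        hamiltonian ρ m ω ħ (e μ) =
          (ħ * ω / 2 * (p + 2 * μ.μ₂₂ + 2 * μ.θ) : ℂ) • e μ) ∧
      eigenvalueSet (hamiltonian ρ m ω ħ) =
        Set.range (fun n : ℕ => (ħ * ω * (n + p / 2) : ℂ)) ∧
      unboundedSpectrum (hilbertClosure (hamiltonian ρ m ω ħ)) =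
        Set.range (fun n : ℕ => (ħ * ω * (n + p / 2) : ℂ)) ∧
      (p = 1 → eigenvalueSet (hamiltonian ρ m ω ħ) =
        eigenvalueSet (canonicalHamiltonian m ω ħ)) := by
  refine ⟨?_, fun V _ _ ρ vac h => ⟨h.exists_isKetBasis hp, fun e he μ =>
    ⟨h.hamiltonian_apply_eq_anticommutator hm hω hħ (e μ), h.hamiltonian_apply hm hω hħ he μ⟩,
    h.eigenvalueSet_hamiltonian hp hm hω hħ, h.unboundedSpectrum_hamiltonian hp hm hω hħ, ?_⟩⟩
  · obtain ⟨V, _, _, ρ, vac, -, h, -⟩ := exists_isParaFock hp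
    exact ⟨V, _, _, ρ, vac, h⟩
  · rintro rfl
    rw [h.eigenvalueSet_hamiltonian hp hm hω hħ, eigenvalueSet_canonicalHamiltonian hm hω hħ,
      Nat.cast_one]
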